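/- Let $\mathcal X,\mathcal Y,\mathcal Z$ be finite sets and let $P_{XYZ}$ be a distribution on $\mathcal X\times\mathcal Y\times\mathcal Z$ satisfying the Markov chain $X-Y-Z$, with marginals $P_X,P_Y,P_Z$. All logarithms are natural. An $(n,N_1,N_2)$-code consists of encoders $f_1:\mathcal X^n\to[N_1]$, $f_2:[N_1]\times\mathcal Y^n\to[N_2]$ and decoders $g_1:[N_1]\times\mathcal Y^n\to\{\mathrm H_0,\mathrm H_1\}$, $g_2:[N_2]\times\mathcal Z^n\to\{\mathrm H_0,\mathrm H_1\}$. Put $M_1=f_1(X^n)$ and $M_2=f_2(M_1,Y^n)$. Under $\mathrm H_0$ one has $(X^n,Y^n,Z^n)\sim P_{XYZ}^n$, under $\mathrm H_1$ one has $(X^n,Y^n,Z^n)\sim P_X^nP_Y^nP_Z^n$. Let $\beta_1$ (resp. $\eta_1$) be the probability under $\mathrm H_0$ that $g_1(M_1,Y^n)\ne\mathrm H_0$ (resp. $g_2(M_2,Z^n)\neq\mathrm H_0$), and $\beta_2$ (resp. $\eta_2$) the probability under $\mathrm H_1$ that $g_1(M_1,Y^n)=\mathrm H_0$ (resp. $g_2(M_2,Z^n)=\mathrm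 H_0$). Let $\mathcal Q$ be the set of distributions $Q_{XYZUV}$, with $U,V$ taking values in arbitrary finite sets, such that $Q_{XYZ}=P_{XYZ}$ and $U-X-Y$ and $V-Y-Z$ are Markov chains under $Q$. For $b,c,d\ge0$ let $$\mathrm R_{b,c,d}:=\min_{Q\in\mathcal Q}\big(-I_Q(U;Y)+b\,I_Q(U;X)-c\,(I_Q(U;Y)+I_Q(V;Z))+d\,I_Q(V;Y)\big),$$ $$\mathcal R^*:=\bigcup_{Q\in\mathcal Q}\big\{(R_1,R_2,E_1,E_2)\in\mathbb R^4: R_1\ge I_Q(U;X),\ R_2\ge I_Q(V;Y),\ E_1\le I_Q(U;Y),\ E_2\le I_Q(U;Y)+I_Q(V;Z)\big\}.$$ Let $\mathcal R(\varepsilon_1,\varepsilon_2)$ be the closure of the set of tuples $(R_1,R_2,E_1,E_2)\in\mathbb R^4$ for which there is a sequence of $(n,N_1,N_2)$-codes, with $N_1,N_2$ depending on $n$, such that $\limsup_n\frac1n\log N_i\le R_i$ for $i=1,2$, $\limsup_n\beta_1\le\varepsilon_1$, $\limsup_n\eta_1\le\varepsilon_2$, $\liminf_n-\frac1n\log\beta_2\ge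 E_1$ and $\liminf_n-\frac1n\log\eta_2\ge E_2$. **Theorem.** Let $(\varepsilon_1,\varepsilon_2)\in(0,1)^2$ with $\varepsilon_1+\varepsilon_2<1$. (i) For all $b,c,d\ge0$ there is a real sequence $r(n)=\Theta(n^{3/4}\log n)$ (its absolute value has this order as $n\to\infty$; its sign may be negative), depending only on $P_{XYZ},\varepsilon_1,\varepsilon_2,b,c,d$, such that for all $n\ge1$ and all $N_1,N_2$, every $(n,N_1,N_2)$-code with $\beta_1\le\varepsilon_1$ and $\eta_1\le\varepsilon_2$ satisfies $\beta_2>0$, $\eta_2>0$ and $$\log\beta_2+b\log N_1+c\log\eta_2+d\log N_2\ \ge\ n\,\mathrm R_{b,c,d}+r(n).$$ (ii) The strong converse holds: $\mathcal R(\varepsilon_1,\varepsilon_2)=\mathcal R^*$. -/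

import Mathlib

open Filter Topology Asymptotics

namespace TwoHop

/-! ### Finite probability: distributions are elements of `stdSimplex ℝ Ω`, random variables are
functions on the finite sample space `Ω`. -/

open Classical in
/-- The law of the random variable `A` when the sample point has distribution `p`:
`law p A a = p {ω | A ω = a}`. -/
noncomputable def law {Ω α : Type*} [Fintype Ω] (p : Ω → ℝ) (A : Ω → α) (a : α) : ℝ :=
  ∑ ω, if A ω = a then p ω else 0

/-- Mutual information `I_p(A;B) = ∑ p(a,b) log (p(a,b) / (p(a) p(b)))`, natural logarithm.
A term with `p(a,b) = 0` is `0`, and `p(a,b) > 0` forces `p(a), p(b) > 0`. -/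
noncomputable def mutualInfo {Ω α β : Type*} [Fintype Ω] [Fintype α] [Fintype β]
    (p : Ω → ℝ) (A : Ω → α) (B : Ω → β) : ℝ :=
  ∑ a, ∑ b, law p (fun ω => (A ω, B ω)) (a, b) *
    Real.log (law p (fun ω => (A ω, B ω)) (a, b) / (law p A a * law p B b))

/-- The Markov chain `A - B - C` under `p`, that is `p(a,b,c) = p(a,b) p(c|b)`,
multiplied out by `p(b)`. -/
def IsMarkov {Ω α β γ : Type*} [Fintype Ω] (p : Ω → ℝ)
    (A : Ω → α) (B : Ω → β) (C : Ω → γ) : Prop :=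
  ∀ a b c, law p (fun ω => (A ω, B ω, C ω)) (a, b, c) * law p B b =
    law p (fun ω => (A ω, B ω)) (a, b) * law p (fun ω => (B ω, C ω)) (b, c)

/-- A source distribution `P_{XYZ}` on `X × Y × Z` with the Markov chain `X - Y - Z`. -/
structure IsSource {X Y Z : Type*} [Fintype X] [Fintype Y] [Fintype Z]
    (P : X × Y × Z → ℝ) : Prop where
  mem_simplex : P ∈ stdSimplex ℝ (X × Y × Z)
  markov : IsMarkov P (fun ω => ω.1) (fun ω => ω.2.1) (fun ω => ω.2.2)

/-! ### Codes and error probabilities -/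

/-- The two hypotheses: `H0` is the joint law `P_{XYZ}^n`, `H1` is `P_X^n P_Y^n P_Z^n`. -/
inductive Hyp : Type
  | H0 : Hyp
  | H1 : Hyp

/-- An `(n, N₁, N₂)`-code: two encoders `f₁, f₂` and two decoders `g₁, g₂`. -/
structure Code (X Y Z : Type*) (n N₁ N₂ : ℕ) where
  f₁ : (Fin n → X) → Fin N₁
  f₂ : Fin N₁ → (Fin n → Y) → Fin N₂
  g₁ : Fin N₁ → (Fin n → Y) → Hyp
  g₂ : Fin N₂ → (Fin n → Z) → Hyp

section Errors

variable {X Y Z : Type*} [Fintype X] [Fintype Y] [Fintype Z] {n N₁ N₂ : ℕ}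

open Classical in
/-- Joint probability of `(x^n, y^n, z^n, m₁, m₂)` under `H0`. -/
noncomputable def Code.jointH0 (C : Code X Y Z n N₁ N₂) (P : X × Y × Z → ℝ)
    (x : Fin n → X) (y : Fin n → Y) (z : Fin n → Z) (m₁ : Fin N₁) (m₂ : Fin N₂) : ℝ :=
  (∏ i, P (x i, y i, z i)) * (if C.f₁ x = m₁ then 1 else 0) * (if C.f₂ m₁ y = m₂ then 1 else 0)

open Classical in
/-- Joint probability of `(x^n, y^n, z^n, m₁, m₂)` under `H1`. -/
noncomputable def Code.jointH1 (C : Code X Y Z n N₁ N₂) (P : X × Y × Z → ℝ)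
    (x : Fin n → X) (y : Fin n → Y) (z : Fin n → Z) (m₁ : Fin N₁) (m₂ : Fin N₂) : ℝ :=
  (∏ i, law P (fun ω => ω.1) (x i)) * (∏ i, law P (fun ω => ω.2.1) (y i)) *
      (∏ i, law P (fun ω => ω.2.2) (z i)) *
    (if C.f₁ x = m₁ then 1 else 0) * (if C.f₂ m₁ y = m₂ then 1 else 0)

open Classical in
/-- Type-I error probability at the relay. -/
noncomputable def Code.beta1 (C : Code X Y Z n N₁ N₂) (P : X × Y × Z → ℝ) : ℝ :=
  ∑ x : Fin n → X, ∑ y : Fin n → Y, ∑ z : Fin n → Z, ∑ m₁ : Fin N₁, ∑ m₂ : Fin N₂,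
    if C.g₁ m₁ y = Hyp.H0 then 0 else C.jointH0 P x y z m₁ m₂

open Classical in
/-- Type-II error probability at the relay. -/
noncomputable def Code.beta2 (C : Code X Y Z n N₁ N₂) (P : X × Y × Z → ℝ) : ℝ :=
  ∑ x : Fin n → X, ∑ y : Fin n → Y, ∑ z : Fin n → Z, ∑ m₁ : Fin N₁, ∑ m₂ : Fin N₂,
    if C.g₁ m₁ y = Hyp.H0 then C.jointH1 P x y z m₁ m₂ else 0

open Classical in
/-- Type-I error probability at the receiver. -/
noncomputable def Code.eta1 (C : Code X Y Z n N₁ N₂) (P : X × Y × Z → ℝ) : ℝ :=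
  ∑ x : Fin n → X, ∑ y : Fin n → Y, ∑ z : Fin n → Z, ∑ m₁ : Fin N₁, ∑ m₂ : Fin N₂,
    if C.g₂ m₂ z = Hyp.H0 then 0 else C.jointH0 P x y z m₁ m₂

open Classical in
/-- Type-II error probability at the receiver. -/
noncomputable def Code.eta2 (C : Code X Y Z n N₁ N₂) (P : X × Y × Z → ℝ) : ℝ :=
  ∑ x : Fin n → X, ∑ y : Fin n → Y, ∑ z : Fin n → Z, ∑ m₁ : Fin N₁, ∑ m₂ : Fin N₂,
    if C.g₂ m₂ z = Hyp.H0 then C.jointH1 P x y z m₁ m₂ else 0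

end Errors

/-! ### Rate-exponent regions -/

section Regions

variable {X Y Z : Type*} [Fintype X] [Fintype Y] [Fintype Z]

/-- `(R₁, R₂, E₁, E₂)` is `(ε₁, ε₂)`-achievable. The limits are taken in the extended reals.
It is used for `ε₁, ε₂ < 1` only; then the type-I errors are eventually below `1`, which forces
the type-II errors to be positive, so that no logarithm of `0` enters the limits. -/
def IsAchievable (P : X × Y × Z → ℝ) (ε₁ ε₂ : ℝ) (T : ℝ × ℝ × ℝ × ℝ) : Prop :=
  ∃ (N₁ N₂ : ℕ → ℕ) (C : ∀ n, Code X Y Z n (N₁ n) (N₂ n)),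
    limsup (fun n : ℕ => ((1 / (n : ℝ) * Real.log (N₁ n) : ℝ) : EReal)) atTop ≤ (T.1 : EReal) ∧
    limsup (fun n : ℕ => ((1 / (n : ℝ) * Real.log (N₂ n) : ℝ) : EReal)) atTop ≤ (T.2.1 : EReal) ∧
    limsup (fun n : ℕ => (((C n).beta1 P : ℝ) : EReal)) atTop ≤ (ε₁ : EReal) ∧
    limsup (fun n : ℕ => (((C n).eta1 P : ℝ) : EReal)) atTop ≤ (ε₂ : EReal) ∧
    (T.2.2.1 : EReal) ≤
      liminf (fun n : ℕ => ((-(1 / (n : ℝ)) * Real.log ((C n).beta2 P) : ℝ) : EReal)) atTop ∧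
    (T.2.2.2 : EReal) ≤
      liminf (fun n : ℕ => ((-(1 / (n : ℝ)) * Real.log ((C n).eta2 P) : ℝ) : EReal)) atTop

/-- The `(ε₁, ε₂)`-rate-exponent region `𝓡(ε₁, ε₂)`. -/
def region (P : X × Y × Z → ℝ) (ε₁ ε₂ : ℝ) : Set (ℝ × ℝ × ℝ × ℝ) :=
  closure {T | IsAchievable P ε₁ ε₂ T}

/-- `Q_{XYZUV} ∈ 𝓠`: the `XYZ`-marginal is `P`, and `U - X - Y`, `V - Y - Z`. The auxiliary
alphabets are arbitrary finite sets, represented by `Fin k` and `Fin l`. -/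
structure IsTest (P : X × Y × Z → ℝ) {k l : ℕ} (Q : X × Y × Z × Fin k × Fin l → ℝ) : Prop where
  mem_simplex : Q ∈ stdSimplex ℝ (X × Y × Z × Fin k × Fin l)
  marginal : ∀ x y z, law Q (fun ω => (ω.1, ω.2.1, ω.2.2.1)) (x, y, z) = P (x, y, z)
  markov_UXY : IsMarkov Q (fun ω => ω.2.2.2.1) (fun ω => ω.1) (fun ω => ω.2.1)
  markov_VYZ : IsMarkov Q (fun ω => ω.2.2.2.2) (fun ω => ω.2.1) (fun ω => ω.2.2.1)

variable {k l : ℕ}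

/-- `I_Q(U;X)`. -/
noncomputable def infoUX (Q : X × Y × Z × Fin k × Fin l → ℝ) : ℝ :=
  mutualInfo Q (fun ω => ω.2.2.2.1) (fun ω => ω.1)

/-- `I_Q(U;Y)`. -/
noncomputable def infoUY (Q : X × Y × Z × Fin k × Fin l → ℝ) : ℝ :=
  mutualInfo Q (fun ω => ω.2.2.2.1) (fun ω => ω.2.1)

/-- `I_Q(V;Y)`. -/
noncomputable def infoVY (Q : X × Y × Z × Fin k × Fin l → ℝ) : ℝ :=
  mutualInfo Q (fun ω => ω.2.2.2.2) (fun ω => ω.2.1)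

/-- `I_Q(V;Z)`. -/
noncomputable def infoVZ (Q : X × Y × Z × Fin k × Fin l → ℝ) : ℝ :=
  mutualInfo Q (fun ω => ω.2.2.2.2) (fun ω => ω.2.2.1)

/-- The single-letter region `𝓡*`, a union over all test distributions `Q`. -/
def regionStar (P : X × Y × Z → ℝ) : Set (ℝ × ℝ × ℝ × ℝ) :=
  {T | ∃ (k l : ℕ) (Q : X × Y × Z × Fin k × Fin l → ℝ), IsTest P Q ∧
    infoUX Q ≤ T.1 ∧ infoVY Q ≤ T.2.1 ∧ T.2.2.1 ≤ infoUY Q ∧ T.2.2.2 ≤ infoUY Q + infoVZ Q}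

/-- `R_{b,c,d}(Q)`. -/
noncomputable def weightedInfo (b c d : ℝ) (Q : X × Y × Z × Fin k × Fin l → ℝ) : ℝ :=
  -infoUY Q + b * infoUX Q - c * (infoUY Q + infoVZ Q) + d * infoVY Q

/-- `R_{b,c,d}`, the minimum of `R_{b,c,d}(Q)` over the test distributions `Q`. For a source `P`
the set is non-empty (take `U`, `V` constant) and bounded below (by
`-(1 + c) log |Y| - c log |Z|`, for non-negative weights). -/
noncomputable def minWeightedInfo (P : X × Y × Z → ℝ) (b c d : ℝ) : ℝ :=
  sInf {r | ∃ (k l : ℕ) (Q : X × Y × Z × Fin k × Fin l → ℝ), IsTest P Q ∧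
    r = weightedInfo b c d Q}

end Regions

end TwoHop

/-!
The proof has a converse half, which gives (i) and `𝓡(ε₁, ε₂) ⊆ 𝓡*`, and an achievability half.

**Converse.** Since `ε₁ + ε₂ < 1`, under `H0` both decoders accept with probability at least
`δ = 1 - ε₁ - ε₂`. Condition the source on this event. For the new law `p` the tests never fail, so
data processing bounds the type-II exponents by divergences under `p`, up to terms bounded by
`log (1 / δ)`; on the other hand the density of `p` with respect to `P ^ n` is at most `1 / δ`, so
all block entropies and the Markov chains `M₁ - x - y` and `M₂ - y - z` are those of the i.i.d.
source up to `log (1 / δ)` (`exists_conditioned`, `crossEnt_sub_le_ent`). The chain rule with the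
auxiliary variable `U = (J, M, x^{<J}, y^{<J})`, where `J` is a uniform time, turns rates and
exponents into single-letter informations (`exists_mem_entHull_of_block`). The single-letter law so
obtained has marginals and channels that are within `O(1 / √n)` of those of `P`. It is corrected to
an exact test distribution at the cost of `O(1 / √n)`: the channel is replaced by the true one,
using that entropy is Lipschitz in the square roots of the probabilities, and the marginal is
repaired by mixing in point masses (`exists_mem_entHull_near`). Hence the loss is `O(√n)` after multiplication
by `n`, and the remainder `-K (n ^ (3 / 4) log n + 1)` is more than enough (`exists_remainder`).

A test distribution enters the informations of a hop only through the law of the posterior of the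
hop input given the auxiliary variable, so that the pairs of conditional entropies which it realizes
form a convex hull of a compact set (`entHull`, `mem_entHull_of_isMarkov`, `exists_isTest`).
The hull is compact, by Carathéodory's theorem (`isCompact_convexHull_of_finiteDimensional`); this
makes `𝓡*` closed (`isClosed_regionStar`), as the converse needs in the limit.

**Achievability.** For one hop with auxiliary variable `U`, a greedy choice of at most
`exp (n (I(U;A) + δ))` words `u` covers almost all of the source, the decoder for a given word
accepts when the information density of `(u, b)` is at least `n (I(U;B) - δ)`, and Chernoff bounds
control the error probabilities (`exists_greedy_cover`, `eventually_exists_hop`). The two hops are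
chained by a relay that forwards an extra error symbol when its own test rejects, so that the
exponents add up at the receiver (`exists_code_of_hops`).
-/

namespace TwoHop

/-! ### Entropy of random variables on a finite probability space -/

section Entropy

variable {Ω α β γ : Type*} [Fintype Ω]

lemma sum_law_mul [Fintype α] (p : Ω → ℝ) (A : Ω → α) (g : α → ℝ) :
    ∑ a, law p A a * g a = ∑ ω, p ω * g (A ω) := by
  classical
  simp only [law, Finset.sum_mul]
  rw [Finset.sum_comm]
  refine Finset.sum_congr rfl fun ω _ => ?_
  simp

lemma sum_law [Fintype α] (p : Ω → ℝ) (A : Ω → α) : ∑ a, law p A a = ∑ ω, p ω := by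
  simpa using sum_law_mul p A (fun _ => 1)

lemma law_nonneg {p : Ω → ℝ} (hp : ∀ ω, 0 ≤ p ω) (A : Ω → α) (a : α) : 0 ≤ law p A a := by
  classical
  refine Finset.sum_nonneg fun ω _ => ?_
  split_ifs <;> simp [hp ω]

lemma le_law {p : Ω → ℝ} (hp : ∀ ω, 0 ≤ p ω) (A : Ω → α) (ω : Ω) : p ω ≤ law p A (A ω) := by
  classical
  have := Finset.single_le_sum (f := fun ω' => if A ω' = A ω then p ω' else 0)
    (fun ω' _ => by split_ifs <;> simp [hp ω']) (Finset.mem_univ ω)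
  simpa [law] using this

lemma exists_of_law_ne_zero {p : Ω → ℝ} {A : Ω → α} {a : α} (h : law p A a ≠ 0) :
    ∃ ω, p ω ≠ 0 ∧ A ω = a := by
  classical
  obtain ⟨ω, -, hω⟩ := Finset.exists_ne_zero_of_sum_ne_zero h
  by_cases h1 : A ω = a
  · exact ⟨ω, by simpa [h1] using hω, h1⟩
  · simp [h1] at hω

lemma law_le_law {p : Ω → ℝ} (hp : ∀ ω, 0 ≤ p ω) {A : Ω → α} {B : Ω → β} {a : α} {b : β}
    (h : ∀ ω, A ω = a → B ω = b) : law p A a ≤ law p B b := by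
  classical
  refine Finset.sum_le_sum fun ω _ => ?_
  by_cases h1 : A ω = a
  · simp [h1, h ω h1]
  · simp only [h1, if_false]
    split_ifs <;> simp [hp ω]

lemma law_congr {p : Ω → ℝ} {A : Ω → α} {B : Ω → β} {a : α} {b : β}
    (h : ∀ ω, A ω = a ↔ B ω = b) : law p A a = law p B b := by
  classical
  simp only [law, h]

lemma law_le_one {p : Ω → ℝ} (hp : p ∈ stdSimplex ℝ Ω) (A : Ω → α) (a : α) : law p A a ≤ 1 := by
  classical
  rw [← hp.2]
  refine Finset.sum_le_sum fun ω _ => ?_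
  split_ifs <;> simp [hp.1 ω]

lemma law_mem_stdSimplex [Fintype α] {p : Ω → ℝ} (hp : p ∈ stdSimplex ℝ Ω) (A : Ω → α) :
    law p A ∈ stdSimplex ℝ α :=
  ⟨law_nonneg hp.1 A, by rw [sum_law, hp.2]⟩

/-- A marginal of a joint law. -/
lemma sum_law_pair [Fintype β] (p : Ω → ℝ) (A : Ω → α) (B : Ω → β) (a : α) :
    ∑ b, law p (fun ω => (A ω, B ω)) (a, b) = law p A a := by
  classical
  simp only [law]
  rw [Finset.sum_comm]
  refine Finset.sum_congr rfl fun ω _ => ?_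
  by_cases h : A ω = a <;> simp [h]

lemma sum_law_pair' [Fintype α] (p : Ω → ℝ) (A : Ω → α) (B : Ω → β) (b : β) :
    ∑ a, law p (fun ω => (A ω, B ω)) (a, b) = law p B b := by
  classical
  simp only [law]
  rw [Finset.sum_comm]
  refine Finset.sum_congr rfl fun ω _ => ?_
  by_cases h : B ω = b <;> simp [h]

/-- The Shannon entropy `H_p(A)`, written as the expectation of `-log P(A)`. In this form, that a
function of `A` has at most the entropy of `A` is a termwise inequality. -/
noncomputable def ent (p : Ω → ℝ) (A : Ω → α) : ℝ := ∑ ω, p ω * -Real.log (law p A (A ω))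

lemma ent_congr {p : Ω → ℝ} {A : Ω → α} {B : Ω → β} (h : ∀ ω ω', A ω' = A ω ↔ B ω' = B ω) :
    ent p A = ent p B := by
  refine Finset.sum_congr rfl fun ω _ => ?_
  rw [law_congr (h ω)]

lemma ent_mono {p : Ω → ℝ} (hp : ∀ ω, 0 ≤ p ω) {A : Ω → α} {B : Ω → β}
    (h : ∀ ω ω', B ω' = B ω → A ω' = A ω) : ent p A ≤ ent p B := by
  refine Finset.sum_le_sum fun ω _ => ?_
  rcases (hp ω).eq_or_lt with h0 | h0
  · simp [← h0]
  · refine mul_le_mul_of_nonneg_left (neg_le_neg ?_) (hp ω)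
    exact Real.log_le_log (h0.trans_le (le_law hp B ω)) (law_le_law hp (h ω))

lemma ent_nonneg {p : Ω → ℝ} (hp : p ∈ stdSimplex ℝ Ω) (A : Ω → α) : 0 ≤ ent p A := by
  refine Finset.sum_nonneg fun ω _ => mul_nonneg (hp.1 ω) ?_
  simpa using Real.log_nonpos (law_nonneg hp.1 A _) (law_le_one hp A _)

lemma ent_eq_sum_negMulLog [Fintype α] (p : Ω → ℝ) (A : Ω → α) :
    ent p A = ∑ a, Real.negMulLog (law p A a) := by
  rw [ent, ← sum_law_mul p A (fun a => -Real.log (law p A a))]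
  simp [Real.negMulLog]

/-- Gibbs' inequality, with the squared Hellinger distance as the remainder: the cross-entropy of
`A` relative to a subprobability `q` exceeds the entropy by the divergence of the law of `A` from
`q`, which is at least the squared Hellinger distance. -/
lemma ent_add_hellinger_le [Fintype α] {p : Ω → ℝ} (hp : p ∈ stdSimplex ℝ Ω) (A : Ω → α)
    {q : α → ℝ} (hq : ∀ a, 0 ≤ q a) (hq1 : ∑ a, q a ≤ 1) (hpos : ∀ ω, 0 < p ω → 0 < q (A ω)) :
    ent p A + ∑ a, (√(law p A a) - √(q a)) ^ 2 ≤ ∑ ω, p ω * -Real.log (q (A ω)) := by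
  have h1 : ∑ a, (√(law p A a) - √(q a)) ^ 2
      ≤ 2 - 2 * ∑ a, √(law p A a) * √(q a) := by
    have : ∀ a, (√(law p A a) - √(q a)) ^ 2 = law p A a + q a - 2 * (√(law p A a) * √(q a)) := by
      intro a
      rw [sub_sq, Real.sq_sqrt (law_nonneg hp.1 A a), Real.sq_sqrt (hq a)]; ring
    rw [Finset.sum_congr rfl fun a _ => this a, Finset.sum_sub_distrib, Finset.sum_add_distrib,
      sum_law, hp.2, Finset.mul_sum]
    linarith
  have h2 : ∑ a, √(law p A a) * √(q a) = ∑ ω, p ω * √(q (A ω) / law p A (A ω)) := by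
    rw [← sum_law_mul p A (fun a => √(q a / law p A a))]
    refine Finset.sum_congr rfl fun a _ => ?_
    rcases (law_nonneg hp.1 A a).eq_or_lt with h0 | h0
    · simp [← h0]
    · rw [Real.sqrt_div (hq a)]
      have := Real.mul_self_sqrt h0.le
      have h3 := (Real.sqrt_pos.2 h0).ne'
      field_simp
      rw [pow_two, this, mul_comm]
  have h3 : ∀ ω, p ω * -Real.log (law p A (A ω)) + 2 * (p ω - p ω * √(q (A ω) / law p A (A ω)))
      ≤ p ω * -Real.log (q (A ω)) := by
    intro ω
    rcases (hp.1 ω).eq_or_lt with h0 | h0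
    · simp [← h0]
    · have hl : 0 < law p A (A ω) := h0.trans_le (le_law hp.1 A ω)
      have hqp := hpos ω h0
      have hlog := Real.log_le_sub_one_of_pos (Real.sqrt_pos.2 (div_pos hqp hl))
      rw [Real.log_sqrt (div_pos hqp hl).le, Real.log_div hqp.ne' hl.ne'] at hlog
      nlinarith
  have h4 := Finset.sum_le_sum fun ω (_ : ω ∈ Finset.univ) => h3 ω
  rw [Finset.sum_add_distrib, ← Finset.mul_sum, Finset.sum_sub_distrib, hp.2] at h4
  rw [h2] at h1
  unfold ent
  linarith

lemma ent_le_cross [Fintype α] {p : Ω → ℝ} (hp : p ∈ stdSimplex ℝ Ω) (A : Ω → α)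
    {q : α → ℝ} (hq : ∀ a, 0 ≤ q a) (hq1 : ∑ a, q a ≤ 1) (hpos : ∀ ω, 0 < p ω → 0 < q (A ω)) :
    ent p A ≤ ∑ ω, p ω * -Real.log (q (A ω)) := by
  have := ent_add_hellinger_le hp A hq hq1 hpos
  have h2 : 0 ≤ ∑ a, (√(law p A a) - √(q a)) ^ 2 := Finset.sum_nonneg fun _ _ => sq_nonneg _
  linarith

lemma ent_le_log_card [Fintype α] {p : Ω → ℝ} (hp : p ∈ stdSimplex ℝ Ω) (A : Ω → α) :
    ent p A ≤ Real.log (Fintype.card α) := by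
  rcases isEmpty_or_nonempty α with h | h
  · have : IsEmpty Ω := ⟨fun ω => h.elim (A ω)⟩
    simp [ent]
  · have hc : (0 : ℝ) < Fintype.card α := by exact_mod_cast Fintype.card_pos
    have := ent_le_cross hp A (q := fun _ => (Fintype.card α : ℝ)⁻¹) (fun _ => by positivity)
      (by simp [hc.ne']) (fun _ _ => by positivity)
    simpa [← Finset.sum_mul, hp.2] using this

/-- Conditional Gibbs inequality: `H(B|A) ≤ E[-log W(A,B)]` for a subprobability kernel `W`. -/
lemma ent_pair_le_cross [Fintype α] [Fintype β] {p : Ω → ℝ} (hp : p ∈ stdSimplex ℝ Ω)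
    (A : Ω → α) (B : Ω → β) {W : α → β → ℝ} (hW : ∀ a b, 0 ≤ W a b) (hW1 : ∀ a, ∑ b, W a b ≤ 1)
    (hpos : ∀ ω, 0 < p ω → 0 < W (A ω) (B ω)) :
    ent p (fun ω => (A ω, B ω)) ≤ ent p A + ∑ ω, p ω * -Real.log (W (A ω) (B ω)) := by
  have h := ent_le_cross hp (fun ω => (A ω, B ω)) (q := fun ab => law p A ab.1 * W ab.1 ab.2)
    (fun ab => mul_nonneg (law_nonneg hp.1 A _) (hW _ _)) ?_ ?_
  · refine h.trans_eq ?_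
    rw [ent, ← Finset.sum_add_distrib]
    refine Finset.sum_congr rfl fun ω _ => ?_
    rcases (hp.1 ω).eq_or_lt with h0 | h0
    · simp [← h0]
    · rw [Real.log_mul (h0.trans_le (le_law hp.1 A ω)).ne' (hpos ω h0).ne']; ring
  · rw [Fintype.sum_prod_type]
    calc ∑ a, ∑ b, law p A a * W a b ≤ ∑ a, law p A a := by
          refine Finset.sum_le_sum fun a _ => ?_
          rw [← Finset.mul_sum]
          exact mul_le_of_le_one_right (law_nonneg hp.1 A a) (hW1 a)
      _ = 1 := by rw [sum_law, hp.2]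
      _ ≤ 1 := le_rfl
  · intro ω h0
    exact mul_pos (h0.trans_le (le_law hp.1 A ω)) (hpos ω h0)

/-- Submodularity of entropy: `H(A,B,C) + H(C) ≤ H(A,C) + H(B,C)`. -/
lemma ent_submodular [Fintype α] [Fintype β] [Fintype γ] {p : Ω → ℝ} (hp : p ∈ stdSimplex ℝ Ω)
    (A : Ω → α) (B : Ω → β) (C : Ω → γ) :
    ent p (fun ω => (A ω, B ω, C ω)) + ent p C
      ≤ ent p (fun ω => (A ω, C ω)) + ent p (fun ω => (B ω, C ω)) := by
  have key := ent_pair_le_cross hp (fun ω => (B ω, C ω)) A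
    (W := fun bc a => law p (fun ω => (A ω, C ω)) (a, bc.2) / law p C bc.2)
    (fun bc a => div_nonneg (law_nonneg hp.1 _ _) (law_nonneg hp.1 _ _)) ?_ ?_
  · have h1 : ent p (fun ω => (A ω, B ω, C ω)) = ent p (fun ω => ((B ω, C ω), A ω)) :=
      ent_congr fun ω ω' => by simp only [Prod.mk.injEq]; tauto
    have h2 : ∑ ω, p ω * -Real.log (law p (fun ω => (A ω, C ω)) (A ω, C ω) / law p C (C ω))
        = ent p (fun ω => (A ω, C ω)) - ent p C := by
      rw [ent, ent, ← Finset.sum_sub_distrib]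
      refine Finset.sum_congr rfl fun ω _ => ?_
      rcases (hp.1 ω).eq_or_lt with h0 | h0
      · simp [← h0]
      · rw [Real.log_div (h0.trans_le (le_law hp.1 (fun ω => (A ω, C ω)) ω)).ne'
          (h0.trans_le (le_law hp.1 C ω)).ne']; ring
    rw [h1]
    linarith
  · intro bc
    rw [← Finset.sum_div, sum_law_pair']
    exact div_self_le_one _
  · intro ω h0
    exact div_pos (h0.trans_le (le_law hp.1 (fun ω => (A ω, C ω)) ω))
      (h0.trans_le (le_law hp.1 C ω))

lemma ent_pair_le_add [Fintype α] [Fintype β] {p : Ω → ℝ} (hp : p ∈ stdSimplex ℝ Ω)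
    (A : Ω → α) (B : Ω → β) : ent p (fun ω => (A ω, B ω)) ≤ ent p A + ent p B := by
  refine ent_pair_le_cross hp A B (W := fun _ b => law p B b) (fun _ _ => law_nonneg hp.1 _ _)
    (fun _ => by rw [sum_law, hp.2]) fun ω h0 => h0.trans_le (le_law hp.1 B ω)

lemma mutualInfo_eq [Fintype α] [Fintype β] {p : Ω → ℝ} (hp : ∀ ω, 0 ≤ p ω)
    (A : Ω → α) (B : Ω → β) :
    mutualInfo p A B = ent p A + ent p B - ent p (fun ω => (A ω, B ω)) := by
  rw [mutualInfo, ← Fintype.sum_prod_type'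
    (f := fun a b => law p (fun ω => (A ω, B ω)) (a, b) *
      Real.log (law p (fun ω => (A ω, B ω)) (a, b) / (law p A a * law p B b))),
    sum_law_mul p (fun ω => (A ω, B ω)) (fun ab =>
      Real.log (law p (fun ω => (A ω, B ω)) (ab.1, ab.2) / (law p A ab.1 * law p B ab.2))),
    ent, ent, ent, ← Finset.sum_add_distrib, ← Finset.sum_sub_distrib]
  refine Finset.sum_congr rfl fun ω _ => ?_
  rcases (hp ω).eq_or_lt with h0 | h0
  · simp [← h0]
  · have hA := (h0.trans_le (le_law hp A ω)).ne'
    have hB := (h0.trans_le (le_law hp B ω)).ne'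
    have hAB := (h0.trans_le (le_law hp (fun ω => (A ω, B ω)) ω)).ne'
    rw [Real.log_div hAB (mul_ne_zero hA hB), Real.log_mul hA hB]
    ring

lemma mutualInfo_nonneg [Fintype α] [Fintype β] {p : Ω → ℝ} (hp : p ∈ stdSimplex ℝ Ω)
    (A : Ω → α) (B : Ω → β) : 0 ≤ mutualInfo p A B := by
  rw [mutualInfo_eq hp.1]
  linarith [ent_pair_le_add hp A B]

lemma mutualInfo_le_log_card [Fintype α] [Fintype β] {p : Ω → ℝ} (hp : p ∈ stdSimplex ℝ Ω)
    (A : Ω → α) (B : Ω → β) : mutualInfo p A B ≤ Real.log (Fintype.card β) := by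
  rw [mutualInfo_eq hp.1]
  have h1 := ent_le_log_card hp B
  have h2 : ent p A ≤ ent p (fun ω => (A ω, B ω)) :=
    ent_mono hp.1 fun ω ω' h => (Prod.mk.inj h).1
  linarith

end Entropy

/-! ### Compactness of convex hulls in finite dimension -/

/-- In finite dimension the convex hull of a compact set is compact: by Carathéodory's theorem it is
the image of `Δ × S ^ (d + 1)` under `(w, z) ↦ ∑ w i • z i`. -/
lemma isCompact_convexHull_of_finiteDimensional {E : Type*} [AddCommGroup E] [Module ℝ E]
    [FiniteDimensional ℝ E] [TopologicalSpace E] [ContinuousAdd E] [ContinuousSMul ℝ E] {S : Set E}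
    (hS : IsCompact S) : IsCompact (convexHull ℝ S) := by
  classical
  rcases S.eq_empty_or_nonempty with rfl | ⟨s₀, hs₀⟩
  · simp
  set D := Fin (Module.finrank ℝ E + 1)
  have hK : IsCompact ((stdSimplex ℝ D) ×ˢ (Set.univ.pi fun _ : D => S)) :=
    (isCompact_stdSimplex ℝ D).prod (isCompact_univ_pi fun _ => hS)
  have hf : Continuous fun wz : (D → ℝ) × (D → E) => ∑ i, wz.1 i • wz.2 i := by fun_prop
  convert hK.image hf using 1
  ext x
  constructor
  · intro hx
    obtain ⟨ι, _, z, w, hz, hind, hw, hw1, hx⟩ := eq_pos_convex_span_of_mem_convexHull hx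
    have hcard : Fintype.card ι ≤ Fintype.card D := by
      have := hind.card_le_finrank_succ
      refine this.trans ?_
      rw [Fintype.card_fin]
      exact Nat.succ_le_succ (Submodule.finrank_le _)
    obtain ⟨e⟩ := Function.Embedding.nonempty_of_card_le hcard
    refine ⟨(Function.extend e w 0, Function.extend e z fun _ => s₀), ⟨⟨?_, ?_⟩, ?_⟩, ?_⟩
    · intro d
      by_cases h : ∃ i, e i = d
      · obtain ⟨i, rfl⟩ := h
        simpa [e.injective.extend_apply] using (hw i).le
      · simp [Function.extend_apply' _ _ _ h]
    · rw [← hw1]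
      refine (Fintype.sum_of_injective e e.injective _ _ ?_ ?_).symm
      · intro d hd
        exact Function.extend_apply' _ _ _ hd
      · intro i
        exact (e.injective.extend_apply _ _ _).symm
    · intro d _
      by_cases h : ∃ i, e i = d
      · obtain ⟨i, rfl⟩ := h
        simpa [e.injective.extend_apply] using hz (Set.mem_range_self i)
      · simpa [Function.extend_apply' _ _ _ h] using hs₀
    · rw [← hx]
      refine (Fintype.sum_of_injective e e.injective _ _ ?_ ?_).symm
      · intro d hd
        simp [Function.extend_apply' _ _ _ hd]
      · intro i
        simp [e.injective.extend_apply]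
  · rintro ⟨⟨w, z⟩, ⟨hw, hz⟩, rfl⟩
    exact (convex_convexHull ℝ S).sum_mem (fun i _ => hw.1 i) hw.2
      fun i _ => subset_convexHull ℝ S (hz i (Set.mem_univ i))

/-! ### The convex hull of the entropy curve of a channel -/

section Hull

variable {α β ι : Type*} [Fintype α]

/-- The output of the channel `W` when its input has mass distribution `q`. -/
def output (W : α → β → ℝ) (q : α → ℝ) (b : β) : ℝ := ∑ a, q a * W a b

lemma output_smul (W : α → β → ℝ) (c : ℝ) (q : α → ℝ) :
    output W (fun a => c * q a) = fun b => c * output W q b := by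
  ext b
  simp only [output, Finset.mul_sum, mul_assoc]

/-- `m H(q / m)` for a mass distribution `q` of total mass `m`. It is homogeneous of degree one, so
the conditional entropy `H(A|U)` is the sum over `u` of its values at `a ↦ P(a,u)`. -/
noncomputable def massEnt (q : α → ℝ) : ℝ := ∑ a, Real.negMulLog (q a) - Real.negMulLog (∑ a, q a)

lemma massEnt_smul (c : ℝ) (q : α → ℝ) : massEnt (fun a => c * q a) = c * massEnt q := by
  simp only [massEnt, Real.negMulLog_mul, Finset.sum_add_distrib, ← Finset.mul_sum,
    ← Finset.sum_mul]
  ring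

lemma massEnt_zero : massEnt (fun _ : α => (0 : ℝ)) = 0 := by simp [massEnt]

lemma massEnt_nonneg {q : α → ℝ} (hq : ∀ a, 0 ≤ q a) : 0 ≤ massEnt q := by
  rcases (Finset.sum_nonneg fun a _ => hq a : 0 ≤ ∑ a, q a).eq_or_lt with h0 | h0
  · have : q = fun _ => 0 := by
      ext a
      exact (Finset.sum_eq_zero_iff_of_nonneg fun a _ => hq a).1 h0.symm a (Finset.mem_univ a)
    rw [this, massEnt_zero]
  · have hle : ∀ a, q a ≤ ∑ a, q a := fun a =>
      Finset.single_le_sum (fun a _ => hq a) (Finset.mem_univ a)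
    have : q = fun a => (∑ a, q a) * (q a / ∑ a, q a) := by
      ext a; field_simp
    rw [this, massEnt_smul]
    refine mul_nonneg h0.le ?_
    rw [massEnt, ← Finset.sum_div, div_self h0.ne', Real.negMulLog_one, sub_zero]
    refine Finset.sum_nonneg fun a _ => Real.negMulLog_nonneg ?_ ?_
    · exact div_nonneg (hq a) h0.le
    · exact (div_le_one h0).2 (hle a)

lemma massEnt_le {q : α → ℝ} (hq : ∀ a, 0 ≤ q a) :
    massEnt q ≤ Fintype.card α * ∑ a, q a := by
  rcases (Finset.sum_nonneg fun a _ => hq a : 0 ≤ ∑ a, q a).eq_or_lt with h0 | h0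
  · have : q = fun _ => 0 := by
      ext a
      exact (Finset.sum_eq_zero_iff_of_nonneg fun a _ => hq a).1 h0.symm a (Finset.mem_univ a)
    rw [this, massEnt_zero]; simp
  · have : q = fun a => (∑ a, q a) * (q a / ∑ a, q a) := by
      ext a; field_simp
    have h2 : massEnt q = (∑ a, q a) * massEnt (fun a => q a / ∑ a, q a) := by
      conv_lhs => rw [this, massEnt_smul]
    rw [h2, mul_comm]
    refine mul_le_mul_of_nonneg_right ?_ h0.le
    rw [massEnt, ← Finset.sum_div, div_self h0.ne', Real.negMulLog_one, sub_zero]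
    calc ∑ a, Real.negMulLog (q a / ∑ a, q a) ≤ ∑ _a : α, (1 : ℝ) := by
          refine Finset.sum_le_sum fun a _ => ?_
          have h3 : 0 ≤ q a / ∑ a, q a := div_nonneg (hq a) h0.le
          linarith [Real.negMulLog_le_one_sub_self h3]
      _ = Fintype.card α := by simp

variable [Fintype β] [Fintype ι]

/-- The point `(q, H(q), H(qW))` on the entropy curve of the channel `W`. -/
noncomputable def entPoint (W : α → β → ℝ) (q : α → ℝ) : (α → ℝ) × ℝ × ℝ :=
  (q, massEnt q, massEnt (output W q))

/-- The convex hull of the entropy curve. It consists of the triples `(P_A, H(A|U), H(B|U))` for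
the Markov chains `U - A - B` in which `B` is the output of `W` on input `A`. -/
noncomputable def entHull (W : α → β → ℝ) : Set ((α → ℝ) × ℝ × ℝ) :=
  convexHull ℝ (entPoint W '' stdSimplex ℝ α)

lemma isCompact_entHull (W : α → β → ℝ) : IsCompact (entHull W) := by
  refine isCompact_convexHull_of_finiteDimensional ((isCompact_stdSimplex ℝ α).image ?_)
  have h : ∀ b, Continuous fun q : α → ℝ => output W q b := fun b => by
    unfold output; fun_prop
  unfold entPoint massEnt
  fun_prop

/-- The mass distributions `m i` of total mass one, seen as the joint law of `(U, A)`, give the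
point `(P_A, H(A|U), H(B|U))` of the hull. -/
lemma sum_mem_entHull (W : α → β → ℝ) {m : ι → α → ℝ} (hm : ∀ i a, 0 ≤ m i a)
    (hm1 : ∑ i, ∑ a, m i a = 1) :
    ((fun a => ∑ i, m i a), ∑ i, massEnt (m i), ∑ i, massEnt (output W (m i))) ∈ entHull W := by
  classical
  set w : ι → ℝ := fun i => ∑ a, m i a with hw
  have hw0 : ∀ i, 0 ≤ w i := fun i => Finset.sum_nonneg fun a _ => hm i a
  have hz : ∀ i, w i = 0 → m i = fun _ => 0 := by
    intro i hi
    ext a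
    exact (Finset.sum_eq_zero_iff_of_nonneg fun a _ => hm i a).1 hi a (Finset.mem_univ a)
  set q : ι → α → ℝ := fun i a => (w i)⁻¹ * m i a with hq
  have hmq : ∀ i, m i = fun a => w i * q i a := by
    intro i
    ext a
    by_cases h : w i = 0
    · simp [hz i h, h]
    · simp only [hq]; field_simp
  have hmem : ∑ i ∈ Finset.univ.filter (fun i => w i ≠ 0), w i • entPoint W (q i) ∈ entHull W := by
    refine (convex_convexHull ℝ _).sum_mem (fun i _ => hw0 i) ?_ fun i hi => ?_
    · rw [Finset.sum_filter_ne_zero]; exact hm1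
    · refine subset_convexHull ℝ _ ⟨q i, ⟨fun a => mul_nonneg (inv_nonneg.2 (hw0 i)) (hm i a), ?_⟩,
        rfl⟩
      simp only [hq, ← Finset.mul_sum]
      exact inv_mul_cancel₀ (Finset.mem_filter.1 hi).2
  convert hmem using 1
  rw [Finset.sum_filter_of_ne (p := fun i => w i ≠ 0)
    (fun i _ h (hi : w i = 0) => h (by rw [hi, zero_smul]))]
  have hE : ∀ i, massEnt (m i) = w i * massEnt (q i) := fun i => by
    conv_lhs => rw [hmq i, massEnt_smul]
  have hO : ∀ i, massEnt (output W (m i)) = w i * massEnt (output W (q i)) := fun i => by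
    conv_lhs => rw [hmq i, output_smul, massEnt_smul]
  ext a
  · simp only [entPoint, Prod.smul_mk, Prod.fst_sum, Finset.sum_apply, Pi.smul_apply, smul_eq_mul]
    exact Finset.sum_congr rfl fun i _ => congrFun (hmq i) a
  · simp [entPoint, Prod.snd_sum, Prod.fst_sum, hE]
  · simp [entPoint, Prod.snd_sum, hO]

/-- Every point of the hull comes from finitely many mass distributions. -/
lemma exists_of_mem_entHull {W : α → β → ℝ} {T : (α → ℝ) × ℝ × ℝ} (hT : T ∈ entHull W) :
    ∃ (k : ℕ) (m : Fin k → α → ℝ), (∀ i a, 0 ≤ m i a) ∧ (fun a => ∑ i, m i a) = T.1 ∧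
      ∑ i, massEnt (m i) = T.2.1 ∧ ∑ i, massEnt (output W (m i)) = T.2.2 := by
  obtain ⟨κ, _, z, w, hz, -, hw, -, hx⟩ := eq_pos_convex_span_of_mem_convexHull hT
  choose q hq hqz using fun i => hz (Set.mem_range_self i)
  let e := Fintype.equivFin κ
  refine ⟨Fintype.card κ, fun i a => w (e.symm i) * q (e.symm i) a,
    fun i a => mul_nonneg (hw _).le ((hq _).1 a), ?_, ?_, ?_⟩
  · rw [← hx]
    ext a
    simp only [← hqz, entPoint, Prod.smul_mk, Prod.fst_sum, Finset.sum_apply, Pi.smul_apply,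
      smul_eq_mul]
    exact Equiv.sum_comp e.symm fun i => w i * q i a
  · rw [← hx]
    simp only [massEnt_smul, ← hqz, entPoint, Prod.smul_mk, Prod.snd_sum, Prod.fst_sum, smul_eq_mul]
    exact Equiv.sum_comp e.symm fun i => w i * massEnt (q i)
  · rw [← hx]
    simp only [output_smul, massEnt_smul, ← hqz, entPoint, Prod.smul_mk, Prod.snd_sum, smul_eq_mul]
    exact Equiv.sum_comp e.symm fun i => w i * massEnt (output W (q i))

end Hull

/-! ### Continuity of entropy in the Hellinger distance -/

section Hellinger

variable {Ω α β υ : Type*} [Fintype α] [Fintype β]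

/-- `a ↦ -a² log a²` is Lipschitz on `[0, 1]`, so that entropy is Lipschitz in the square roots of
the probabilities. -/
lemma abs_negMulLog_sq_sub_le {a b : ℝ} (ha : 0 ≤ a) (hab : a ≤ b) (hb : b ≤ 1) :
    |Real.negMulLog (b ^ 2) - Real.negMulLog (a ^ 2)| ≤ 6 * (b - a) := by
  have e : ∀ x : ℝ, Real.negMulLog (x ^ 2) = -2 * (x ^ 2 * Real.log x) := fun x => by
    rw [Real.negMulLog, Real.log_pow]; push_cast; ring
  rw [e, e]
  rcases (ha.trans hab).eq_or_lt with h0 | h0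
  · have : a = 0 := le_antisymm (h0 ▸ hab) ha
    simp [← h0, this]
  have hlb : -Real.log b ≤ b⁻¹ - 1 := by linarith [Real.one_sub_inv_le_log_of_pos h0]
  have hlb0 : 0 ≤ -Real.log b := by linarith [Real.log_nonpos h0.le hb]
  have hblb : b * -Real.log b ≤ 1 := by
    calc b * -Real.log b ≤ b * (b⁻¹ - 1) := mul_le_mul_of_nonneg_left hlb h0.le
      _ = 1 - b := by field_simp
      _ ≤ 1 := by linarith
  have h1 : (b - a) * ((b + a) * -Real.log b) ≤ (b - a) * 2 := by
    refine mul_le_mul_of_nonneg_left ?_ (sub_nonneg.2 hab)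
    nlinarith
  have h1' : 0 ≤ (b - a) * ((b + a) * -Real.log b) :=
    mul_nonneg (sub_nonneg.2 hab) (mul_nonneg (by linarith) hlb0)
  have h2 : 0 ≤ a ^ 2 * (Real.log b - Real.log a) ∧
      a ^ 2 * (Real.log b - Real.log a) ≤ b - a := by
    rcases ha.eq_or_lt with h | h
    · simp [← h, h0.le]
    · have h3 : Real.log a ≤ Real.log b := Real.log_le_log h hab
      have h4 := Real.log_le_sub_one_of_pos (div_pos h0 h)
      rw [Real.log_div h0.ne' h.ne'] at h4
      refine ⟨mul_nonneg (sq_nonneg a) (by linarith), ?_⟩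
      calc a ^ 2 * (Real.log b - Real.log a) ≤ a ^ 2 * (b / a - 1) :=
            mul_le_mul_of_nonneg_left h4 (sq_nonneg a)
        _ = a * (b - a) := by field_simp
        _ ≤ b - a := mul_le_of_le_one_left (by linarith) (by linarith)
  rw [abs_le]
  constructor <;> nlinarith

lemma negMulLog_sub_le {u v : ℝ} (hu : 0 ≤ u) (hu1 : u ≤ 1) (hv : 0 ≤ v) (hv1 : v ≤ 1) :
    Real.negMulLog u - Real.negMulLog v ≤ 6 * |√u - √v| := by
  have key : ∀ {s t : ℝ}, 0 ≤ s → t ≤ 1 → s ≤ t →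
      |Real.negMulLog t - Real.negMulLog s| ≤ 6 * (√t - √s) := by
    intro s t hs ht hst
    have := abs_negMulLog_sq_sub_le (Real.sqrt_nonneg s) (Real.sqrt_le_sqrt hst)
      (Real.sqrt_le_one.2 ht)
    rwa [Real.sq_sqrt hs, Real.sq_sqrt (hs.trans hst)] at this
  rcases le_total u v with h | h
  · have := key hu hv1 h
    rw [abs_sub_comm (√u), abs_of_nonneg (sub_nonneg.2 (Real.sqrt_le_sqrt h))]
    linarith [(abs_le.1 this).1]
  · have := key hv hu1 h
    rw [abs_of_nonneg (sub_nonneg.2 (Real.sqrt_le_sqrt h))]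
    exact (le_abs_self _).trans this

lemma massEnt_sub_le {r s : β → ℝ} (hr : ∀ b, 0 ≤ r b) (hs : ∀ b, 0 ≤ s b)
    (h : ∑ b, r b = ∑ b, s b) :
    massEnt r - massEnt s ≤ 6 * ∑ b, √(∑ b, s b) * |√(r b) - √(s b)| := by
  obtain ⟨m, hm⟩ : ∃ m, m = ∑ b, s b := ⟨_, rfl⟩
  rw [← hm] at h ⊢
  rcases (hm ▸ Finset.sum_nonneg fun b _ => hs b : 0 ≤ m).eq_or_lt with h0 | h0
  · have h1 : ∀ b, s b = 0 := fun b =>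
      (Finset.sum_eq_zero_iff_of_nonneg fun b _ => hs b).1 (hm.symm.trans h0.symm) b
        (Finset.mem_univ b)
    have h2 : ∀ b, r b = 0 := fun b =>
      (Finset.sum_eq_zero_iff_of_nonneg fun b _ => hr b).1 (h.trans h0.symm) b
        (Finset.mem_univ b)
    simp [massEnt, h1, h2]
  · have hle : ∀ {t : β → ℝ}, (∀ b, 0 ≤ t b) → ∑ b, t b = m → ∀ b, t b / m ≤ 1 := by
      intro t ht htm b
      rw [div_le_one h0, ← htm]
      exact Finset.single_le_sum (fun b _ => ht b) (Finset.mem_univ b)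
    have hE : ∀ {t : β → ℝ}, ∑ b, t b = m → massEnt t = m * ∑ b, Real.negMulLog (t b / m) := by
      intro t htm
      have : t = fun b => m * (t b / m) := by ext b; field_simp
      conv_lhs => rw [this, massEnt_smul, massEnt, ← Finset.sum_div, htm, div_self h0.ne',
        Real.negMulLog_one, sub_zero]
    rw [hE h, hE hm.symm, ← mul_sub, ← Finset.sum_sub_distrib, Finset.mul_sum, Finset.mul_sum]
    refine Finset.sum_le_sum fun b _ => ?_
    calc m * (Real.negMulLog (r b / m) - Real.negMulLog (s b / m))
        ≤ m * (6 * |√(r b / m) - √(s b / m)|) :=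
          mul_le_mul_of_nonneg_left (negMulLog_sub_le (div_nonneg (hr b) h0.le) (hle hr h b)
            (div_nonneg (hs b) h0.le) (hle hs hm.symm b)) h0.le
      _ = 6 * (√m * |√(r b) - √(s b)|) := by
          rw [Real.sqrt_div (hr b), Real.sqrt_div (hs b), ← sub_div, abs_div,
            abs_of_nonneg (Real.sqrt_nonneg m)]
          have := Real.mul_self_sqrt h0.le
          field_simp
          rw [Real.sq_sqrt h0.le, mul_comm]

/-- The Hellinger distance does not increase under marginalization. -/
lemma sq_sqrt_sum_sub_le {f g : α → ℝ} (hf : ∀ a, 0 ≤ f a) (hg : ∀ a, 0 ≤ g a) :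
    (√(∑ a, f a) - √(∑ a, g a)) ^ 2 ≤ ∑ a, (√(f a) - √(g a)) ^ 2 := by
  have h := Real.sum_sqrt_mul_sqrt_le Finset.univ hf hg
  have e : ∀ a, (√(f a) - √(g a)) ^ 2 = f a + g a - 2 * (√(f a) * √(g a)) := by
    intro a
    rw [sub_sq, Real.sq_sqrt (hf a), Real.sq_sqrt (hg a)]; ring
  rw [sub_sq, Real.sq_sqrt (Finset.sum_nonneg fun a _ => hf a),
    Real.sq_sqrt (Finset.sum_nonneg fun a _ => hg a), Finset.sum_congr rfl fun a _ => e a,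
    Finset.sum_sub_distrib, Finset.sum_add_distrib, ← Finset.mul_sum]
  linarith

end Hellinger

/-! ### From an almost Markov triple to a point of the entropy hull -/

section SingleLetter

variable {Ω α β υ : Type*} [Fintype Ω] [Fintype α] [Fintype β] [Fintype υ]

lemma sum_massEnt_law {p : Ω → ℝ} (U : Ω → υ) (A : Ω → α) :
    ∑ u, massEnt (fun a => law p (fun ω => (U ω, A ω)) (u, a))
      = ent p (fun ω => (U ω, A ω)) - ent p U := by
  simp only [massEnt, sum_law_pair, Finset.sum_sub_distrib]
  rw [ent_eq_sum_negMulLog, ent_eq_sum_negMulLog, Fintype.sum_prod_type]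

/-- If the channel from `A` to `B` given `U` is within divergence `κ` of `W`, then replacing it by
`W` raises `H(B|U)` by at most a multiple of `√κ`. -/
lemma sum_massEnt_output_le {p : Ω → ℝ} (hp : p ∈ stdSimplex ℝ Ω) (U : Ω → υ) (A : Ω → α)
    (B : Ω → β) {W : α → β → ℝ} (hW : ∀ a b, 0 ≤ W a b)
    (hW1 : ∀ ω, 0 < p ω → ∑ b, W (A ω) b = 1)
    (hpos : ∀ ω, 0 < p ω → 0 < W (A ω) (B ω)) {κ : ℝ}
    (hκ : ∑ ω, p ω * -Real.log (W (A ω) (B ω))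
      - (ent p (fun ω => (U ω, A ω, B ω)) - ent p (fun ω => (U ω, A ω))) ≤ κ) :
    ∑ u, massEnt (output W fun a => law p (fun ω => (U ω, A ω)) (u, a))
      ≤ ent p (fun ω => (U ω, B ω)) - ent p U + 6 * Fintype.card β * √κ := by
  classical
  set f : υ → α → ℝ := fun u a => law p (fun ω => (U ω, A ω)) (u, a) with hf
  have hf0 : ∀ u a, 0 ≤ f u a := fun u a => law_nonneg hp.1 _ _
  set s : υ → β → ℝ := fun u b => law p (fun ω => (U ω, B ω)) (u, b) with hs
  have hs0 : ∀ u b, 0 ≤ s u b := fun u b => law_nonneg hp.1 _ _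
  have hss : ∀ u, ∑ b, s u b = law p U u := fun u => sum_law_pair p U B u
  have hr0 : ∀ u b, 0 ≤ output W (f u) b := fun u b =>
    Finset.sum_nonneg fun a _ => mul_nonneg (hf0 u a) (hW a b)
  have hfW : ∀ u a, f u a * ∑ b, W a b = f u a := by
    intro u a
    by_cases h : f u a = 0
    · simp [h]
    · obtain ⟨ω, h2, h1⟩ := exists_of_law_ne_zero h
      obtain ⟨-, rfl⟩ := Prod.mk.inj h1
      rw [hW1 ω ((hp.1 ω).lt_of_ne' h2), mul_one]
  have hrs : ∀ u, ∑ b, output W (f u) b = law p U u := by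
    intro u
    simp only [output]
    rw [Finset.sum_comm, ← sum_law_pair p U A u]
    refine Finset.sum_congr rfl fun a _ => ?_
    rw [← Finset.mul_sum]
    exact hfW u a
  have hell : ∑ b, ∑ u, (√(output W (f u) b) - √(s u b)) ^ 2 ≤ κ := by
    have h := ent_add_hellinger_le hp (fun ω => (U ω, A ω, B ω))
      (q := fun x => f x.1 x.2.1 * W x.2.1 x.2.2) (fun x => mul_nonneg (hf0 _ _) (hW _ _)) ?_ ?_
    · have h2 : ∑ ω, p ω * -Real.log (f (U ω) (A ω) * W (A ω) (B ω))
          = ent p (fun ω => (U ω, A ω)) + ∑ ω, p ω * -Real.log (W (A ω) (B ω)) := by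
        rw [ent, ← Finset.sum_add_distrib]
        refine Finset.sum_congr rfl fun ω _ => ?_
        rcases (hp.1 ω).eq_or_lt with h0 | h0
        · simp [← h0]
        · rw [Real.log_mul (h0.trans_le (le_law hp.1 (fun ω => (U ω, A ω)) ω)).ne'
            (hpos ω h0).ne']
          ring
      have h3 : ∑ b, ∑ u, (√(output W (f u) b) - √(s u b)) ^ 2
          ≤ ∑ x : υ × α × β, (√(law p (fun ω => (U ω, A ω, B ω)) x)
            - √(f x.1 x.2.1 * W x.2.1 x.2.2)) ^ 2 := by
        rw [Finset.sum_comm, Fintype.sum_prod_type]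
        refine Finset.sum_le_sum fun u _ => ?_
        rw [Fintype.sum_prod_type, Finset.sum_comm]
        refine Finset.sum_le_sum fun b _ => ?_
        have h4 : s u b = ∑ a, law p (fun ω => (U ω, A ω, B ω)) (u, a, b) := by
          have := sum_law_pair p (fun ω => (U ω, B ω)) A (u, b)
          refine this.symm.trans ?_
          exact Finset.sum_congr rfl fun a _ => law_congr fun ω => by
            simp only [Prod.mk.injEq]; tauto
        rw [h4, ← neg_sub, neg_sq]
        exact sq_sqrt_sum_sub_le (fun a => law_nonneg hp.1 _ _)
          fun a => mul_nonneg (hf0 u a) (hW a b)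
      linarith
    · rw [Fintype.sum_prod_type]
      simp only [Fintype.sum_prod_type, ← Finset.mul_sum]
      calc ∑ u, ∑ a, f u a * ∑ b, W a b = ∑ u, ∑ a, f u a := by simp only [hfW]
        _ = 1 := by
          rw [← Fintype.sum_prod_type' (f := f)]
          exact (sum_law p _).trans hp.2
        _ ≤ 1 := le_rfl
    · intro ω h0
      exact mul_pos (h0.trans_le (le_law hp.1 (fun ω => (U ω, A ω)) ω)) (hpos ω h0)
  rw [← sum_massEnt_law, ← sub_le_iff_le_add', ← Finset.sum_sub_distrib]
  calc ∑ u, (massEnt (output W (f u)) - massEnt (s u))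
      ≤ ∑ u, 6 * ∑ b, √(law p U u) * |√(output W (f u) b) - √(s u b)| := by
        refine Finset.sum_le_sum fun u _ => ?_
        have := massEnt_sub_le (hr0 u) (hs0 u) ((hrs u).trans (hss u).symm)
        rwa [hss u] at this
    _ = 6 * ∑ b, ∑ u, √(law p U u) * |√(output W (f u) b) - √(s u b)| := by
        rw [← Finset.mul_sum, Finset.sum_comm]
    _ ≤ 6 * ∑ _b : β, √κ := by
        refine mul_le_mul_of_nonneg_left (Finset.sum_le_sum fun b _ => ?_) (by norm_num)
        refine (Real.sum_mul_le_sqrt_mul_sqrt _ _ _).trans ?_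
        have h1 : ∑ u, √(law p U u) ^ 2 = 1 := by
          rw [Finset.sum_congr rfl fun u _ => Real.sq_sqrt (law_nonneg hp.1 U u), sum_law, hp.2]
        rw [h1, Real.sqrt_one, one_mul]
        refine Real.sqrt_le_sqrt (le_trans ?_ hell)
        simp only [sq_abs]
        exact Finset.single_le_sum (f := fun b => ∑ u, (√(output W (f u) b) - √(s u b)) ^ 2)
          (fun b _ => Finset.sum_nonneg fun u _ => sq_nonneg _) (Finset.mem_univ b)
    _ = 6 * Fintype.card β * √κ := by simp; ring

/-- A triple `(U, A, B)` whose channel from `A` to `B` given `U` is within divergence `κ` of `W`,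
and for which the law of `A` exceeds `π` by at most `τ`, is close to a point of the hull over `π`.
The law `π` is a mixture of the law of `A` and of point masses, the latter of total weight at most
`τ / c`. -/
lemma exists_mem_entHull_near {p : Ω → ℝ} (hp : p ∈ stdSimplex ℝ Ω) (U : Ω → υ) (A : Ω → α)
    (B : Ω → β) {W : α → β → ℝ} (hW : ∀ a b, 0 ≤ W a b) (hWle : ∀ a, ∑ b, W a b ≤ 1)
    {π : α → ℝ} (hπ : π ∈ stdSimplex ℝ α) (hWπ : ∀ a, 0 < π a → ∑ b, W a b = 1)
    (hA : ∀ ω, 0 < p ω → 0 < π (A ω)) (hpos : ∀ ω, 0 < p ω → 0 < W (A ω) (B ω))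
    {c κ τ : ℝ} (hc : 0 < c) (hcπ : ∀ a, 0 < π a → c ≤ π a) (hτ0 : 0 ≤ τ)
    (hτ : ∀ a, law p A a - π a ≤ τ)
    (hκ : ∑ ω, p ω * -Real.log (W (A ω) (B ω))
      - (ent p (fun ω => (U ω, A ω, B ω)) - ent p (fun ω => (U ω, A ω))) ≤ κ) :
    ∃ s t, (π, s, t) ∈ entHull W ∧
      ent p (fun ω => (U ω, A ω)) - ent p U - Fintype.card α * (τ / c) ≤ s ∧
      t ≤ ent p (fun ω => (U ω, B ω)) - ent p U + 6 * Fintype.card β * √κ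
        + Fintype.card β * (τ / c) := by
  classical
  set t : ℝ := min 1 (τ / c) with ht
  have ht0 : 0 ≤ t := le_min zero_le_one (div_nonneg hτ0 hc.le)
  have ht1 : t ≤ 1 := min_le_left _ _
  have htτ : t ≤ τ / c := min_le_right _ _
  have hlaw0 : ∀ a, 0 ≤ law p A a := fun a => law_nonneg hp.1 A a
  have hR : ∀ a, 0 ≤ π a - (1 - t) * law p A a := by
    intro a
    rcases (hπ.1 a).eq_or_lt with h0 | h0
    · have : law p A a = 0 := by
        by_contra hne
        obtain ⟨ω, h1, rfl⟩ := exists_of_law_ne_zero hne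
        exact (hA ω ((hp.1 ω).lt_of_ne' h1)).ne h0
      rw [this, ← h0]; simp
    · rcases min_choice 1 (τ / c) with h | h
      · rw [ht, h]; simpa using h0.le
      · rcases le_total (law p A a) (π a) with h1 | h1
        · nlinarith [hlaw0 a]
        · have h2 : c * t = τ := by rw [ht, h]; field_simp
          have h3 : c ≤ law p A a := (hcπ a h0).trans h1
          nlinarith [hτ a]
  set f : υ → α → ℝ := fun u a => law p (fun ω => (U ω, A ω)) (u, a) with hf
  have hf0 : ∀ u a, 0 ≤ f u a := fun u a => law_nonneg hp.1 _ _
  have hf1 : ∑ u, ∑ a, f u a = 1 := by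
    rw [← Fintype.sum_prod_type' (f := f)]
    exact (sum_law p _).trans hp.2
  have hfa : ∀ a, ∑ u, f u a = law p A a := fun a => sum_law_pair' p U A a
  have hRsum : ∑ a, (π a - (1 - t) * law p A a) = t := by
    rw [Finset.sum_sub_distrib, ← Finset.mul_sum, sum_law, hp.2, hπ.2]; ring
  have hmem := sum_mem_entHull W (m := Sum.elim (fun u a => (1 - t) * f u a)
    (fun a' a => (π a' - (1 - t) * law p A a') * if a = a' then 1 else 0)) ?_ ?_
  rotate_left
  · rintro (u | a') a
    · exact mul_nonneg (by linarith) (hf0 u a)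
    · exact mul_nonneg (hR a') (by split_ifs <;> norm_num)
  · simp only [Fintype.sum_sum_type, Sum.elim_inl, Sum.elim_inr, ← Finset.mul_sum, hf1]
    simp [hRsum]
  simp only [Fintype.sum_sum_type, Sum.elim_inl, Sum.elim_inr, massEnt_smul, output_smul,
    ← Finset.mul_sum] at hmem
  have hfst : (fun a => (1 - t) * ∑ u, f u a
      + ∑ a', (π a' - (1 - t) * law p A a') * if a = a' then 1 else 0) = π := by
    ext a
    simp [hfa]
  rw [hfst] at hmem
  have hdelta : ∀ a' : α, massEnt (fun a : α => if a = a' then (1 : ℝ) else 0) = 0 := by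
    intro a'
    simp [massEnt, apply_ite Real.negMulLog]
  simp only [hdelta, mul_zero, Finset.sum_const_zero, add_zero] at hmem
  refine ⟨_, _, hmem, ?_, ?_⟩
  · have h1 : ∑ u, massEnt (f u) ≤ Fintype.card α := by
      calc ∑ u, massEnt (f u) ≤ ∑ u, Fintype.card α * ∑ a, f u a :=
            Finset.sum_le_sum fun u _ => massEnt_le (hf0 u)
        _ = Fintype.card α := by rw [← Finset.mul_sum, hf1, mul_one]
    rw [← sum_massEnt_law]
    have h2 : t * ∑ u, massEnt (f u) ≤ Fintype.card α * (τ / c) := by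
      rw [mul_comm]
      exact mul_le_mul h1 htτ ht0 (Nat.cast_nonneg _)
    linarith
  · have h1 := sum_massEnt_output_le hp U A B hW (fun ω h => hWπ _ (hA ω h)) hpos hκ
    have h2 : 0 ≤ ∑ u, massEnt (output W (f u)) := Finset.sum_nonneg fun u _ =>
      massEnt_nonneg fun b => Finset.sum_nonneg fun a _ => mul_nonneg (hf0 u a) (hW a b)
    have h3 : ∀ a' : α, massEnt (output W fun a => if a = a' then (1 : ℝ) else 0)
        ≤ Fintype.card β := by
      intro a'
      have h4 : (output W fun a => if a = a' then (1 : ℝ) else 0) = W a' := by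
        ext b; simp [output]
      rw [h4]
      exact (massEnt_le (hW a')).trans (mul_le_of_le_one_right (Nat.cast_nonneg _) (hWle a'))
    have h5 : ∑ a', (π a' - (1 - t) * law p A a')
        * massEnt (output W fun a => if a = a' then (1 : ℝ) else 0)
        ≤ Fintype.card β * (τ / c) := by
      calc _ ≤ ∑ a', (π a' - (1 - t) * law p A a') * Fintype.card β :=
            Finset.sum_le_sum fun a' _ => mul_le_mul_of_nonneg_left (h3 a') (hR a')
        _ = t * Fintype.card β := by rw [← Finset.sum_mul, hRsum]
        _ ≤ _ := by rw [mul_comm]; exact mul_le_mul_of_nonneg_left htτ (Nat.cast_nonneg _)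
    nlinarith

end SingleLetter

/-! ### Single-letterization -/

section Block

variable {Ω α β μ : Type*} [Fintype Ω] {n : ℕ}

/-- The letters of `x` before time `i`, the others being masked. Since the type does not depend on
`i`, this can be part of an auxiliary random variable that includes a random time. -/
def past (i : ℕ) (x : Fin n → α) : Fin n → Option α :=
  fun j => if (j : ℕ) < i then some (x j) else none

lemma past_eq_iff {i : ℕ} {x x' : Fin n → α} :
    past i x = past i x' ↔ ∀ j : Fin n, (j : ℕ) < i → x j = x' j := by
  constructor
  · intro h j hj
    simpa [past, hj] using congrFun h j
  · intro h
    ext1 j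
    by_cases hj : (j : ℕ) < i
    · simp [past, hj, h j hj]
    · simp [past, hj]

lemma past_succ_eq_iff {i : Fin n} {x x' : Fin n → α} :
    past (i + 1 : ℕ) x = past (i + 1 : ℕ) x' ↔ past (i : ℕ) x = past (i : ℕ) x' ∧ x i = x' i := by
  simp only [past_eq_iff]
  constructor
  · exact fun h => ⟨fun j hj => h j (by omega), h i (by omega)⟩
  · rintro ⟨h1, h2⟩ j hj
    rcases Nat.lt_succ_iff_lt_or_eq.1 hj with h | h
    · exact h1 j h
    · rwa [Fin.ext h]

lemma past_zero (x : Fin n → α) : past 0 x = fun _ => none := by ext1 j; simp [past]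

lemma past_all_eq_iff {x x' : Fin n → α} : past n x = past n x' ↔ x = x' := by
  rw [past_eq_iff]
  exact ⟨fun h => funext fun j => h j j.2, fun h j _ => h ▸ rfl⟩

lemma sum_fin_sub (F : ℕ → ℝ) : ∑ i : Fin n, (F (i + 1) - F i) = F n - F 0 := by
  rw [Fin.sum_univ_eq_sum_range (fun i => F (i + 1) - F i) n, Finset.sum_range_sub]

/-- The joint distribution of a uniform time in `Fin n` and an independent sample point of law
`p`. -/
noncomputable def timed (n : ℕ) (p : Ω → ℝ) (w : Fin n × Ω) : ℝ := (1 / n : ℝ) * p w.2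

lemma sum_timed_mul (p : Ω → ℝ) (g : Fin n × Ω → ℝ) :
    ∑ w, timed n p w * g w = (1 / n : ℝ) * ∑ i, ∑ ω, p ω * g (i, ω) := by
  rw [Fintype.sum_prod_type, Finset.mul_sum]
  refine Finset.sum_congr rfl fun i _ => ?_
  rw [Finset.mul_sum]
  exact Finset.sum_congr rfl fun ω _ => by simp only [timed]; ring

lemma timed_mem_stdSimplex (hn : 0 < n) {p : Ω → ℝ} (hp : p ∈ stdSimplex ℝ Ω) :
    timed n p ∈ stdSimplex ℝ (Fin n × Ω) := by
  refine ⟨fun w => mul_nonneg (by positivity) (hp.1 _), ?_⟩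
  have := sum_timed_mul (n := n) p (fun _ => 1)
  simp only [mul_one, hp.2] at this
  rw [this]
  have : (n : ℝ) ≠ 0 := by positivity
  simp [this]

lemma law_timed_pair (p : Ω → ℝ) (A : Fin n → Ω → α) (i : Fin n) (a : α) :
    law (timed n p) (fun w => (w.1, A w.1 w.2)) (i, a) = (1 / n : ℝ) * law p (A i) a := by
  classical
  simp only [law, Fintype.sum_prod_type, Prod.mk.injEq, timed, Finset.mul_sum]
  rw [Finset.sum_eq_single i]
  · refine Finset.sum_congr rfl fun ω _ => ?_
    by_cases h : A i ω = a <;> simp [h]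
  · intro j _ hj
    exact Finset.sum_eq_zero fun ω _ => by simp [hj]
  · simp

lemma ent_timed_pair (hn : 0 < n) {p : Ω → ℝ} (hp : p ∈ stdSimplex ℝ Ω) (A : Fin n → Ω → α) :
    ent (timed n p) (fun w => (w.1, A w.1 w.2)) = Real.log n + (1 / n : ℝ) * ∑ i, ent p (A i) := by
  have hn' : (n : ℝ) ≠ 0 := by positivity
  rw [ent, sum_timed_mul]
  have h : ∀ i, ∑ ω, p ω * -Real.log (law (timed n p) (fun w => (w.1, A w.1 w.2)) (i, A i ω))
      = Real.log n + ent p (A i) := by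
    intro i
    have : Real.log n = ∑ ω, p ω * Real.log n := by rw [← Finset.sum_mul, hp.2, one_mul]
    rw [this, ent, ← Finset.sum_add_distrib]
    refine Finset.sum_congr rfl fun ω _ => ?_
    rcases (hp.1 ω).eq_or_lt with h0 | h0
    · simp [← h0]
    · rw [law_timed_pair, Real.log_mul (by positivity) (h0.trans_le (le_law hp.1 (A i) ω)).ne',
        one_div, Real.log_inv]
      ring
  rw [Finset.sum_congr rfl fun i _ => h i, Finset.sum_add_distrib, mul_add]
  simp [hn']

lemma sum_ent_past_eq {p : Ω → ℝ} (M : Ω → μ) (x : Ω → Fin n → α) (y : Ω → Fin n → β) :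
    ∑ i : Fin n, (ent p (fun ω => ((M ω, past i (x ω), past i (y ω)), x ω i, y ω i))
      - ent p (fun ω => (M ω, past i (x ω), past i (y ω))))
      = ent p (fun ω => (M ω, x ω, y ω)) - ent p M := by
  have h1 : ent p (fun ω => (M ω, x ω, y ω)) = ent p (fun ω => (M ω, past n (x ω), past n (y ω))) :=
    ent_congr fun ω ω' => by simp only [Prod.mk.injEq, past_all_eq_iff]
  have h0 : ent p M = ent p (fun ω => (M ω, past 0 (x ω), past 0 (y ω))) :=
    ent_congr fun ω ω' => by simp [past_zero]
  rw [h0, h1,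
    ← sum_fin_sub (n := n) fun k => ent p (fun ω => (M ω, past k (x ω), past k (y ω)))]
  refine Finset.sum_congr rfl fun i _ => ?_
  congr 1
  exact ent_congr fun ω ω' => by simp only [Prod.mk.injEq, past_succ_eq_iff]; tauto

variable [Fintype α] [Fintype β] [Fintype μ]

lemma ent_le_sum_ent {p : Ω → ℝ} (hp : p ∈ stdSimplex ℝ Ω) (x : Ω → Fin n → α) :
    ent p x ≤ ∑ i, ent p (fun ω => x ω i) := by
  have h1 : ent p x = ent p (fun ω => past n (x ω)) :=
    ent_congr fun ω ω' => past_all_eq_iff.symm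
  have h2 := sum_fin_sub (n := n) fun k => ent p (fun ω => past k (x ω))
  have h3 : ∑ i : Fin n, (ent p (fun ω => past (i + 1 : ℕ) (x ω)) - ent p (fun ω => past i (x ω)))
      ≤ ∑ i, ent p (fun ω => x ω i) := by
    refine Finset.sum_le_sum fun i _ => ?_
    have h4 : ent p (fun ω => past (i + 1 : ℕ) (x ω)) = ent p (fun ω => (past i (x ω), x ω i)) :=
      ent_congr fun ω ω' => by rw [past_succ_eq_iff, Prod.mk.injEq]
    have := ent_pair_le_add hp (fun ω => past i (x ω)) (fun ω => x ω i)
    linarith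
  have h5 : ent p (fun ω => past 0 (x ω)) = 0 := by
    have : ∀ ω, law p (fun ω => past 0 (x ω)) (past 0 (x ω)) = 1 := by
      intro ω
      rw [← hp.2]
      simp only [law]
      exact Finset.sum_congr rfl fun ω' _ => if_pos (by rw [past_zero, past_zero])
    simp [ent, this]
  linarith

/-- If the law of the block `x` has divergence at most `L` from the product law `π ^ n`, then the
average marginal of `x` is within `O(√(L / n))` of `π`, and so is the entropy rate of `x` from the
entropy of `π`. -/
lemma averages_of_divergence_le (hn : 0 < n) {p : Ω → ℝ} (hp : p ∈ stdSimplex ℝ Ω)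
    (x : Ω → Fin n → α) {π : α → ℝ} (hπ : π ∈ stdSimplex ℝ α)
    (hx : ∀ ω, 0 < p ω → ∀ i, 0 < π (x ω i)) {c L : ℝ} (hc : 0 < c)
    (hcπ : ∀ a, 0 < π a → c ≤ π a)
    (hL : ∑ i, ∑ ω, p ω * -Real.log (π (x ω i)) - L ≤ ent p x) :
    (∀ a, law (timed n p) (fun w => x w.2 w.1) a - π a ≤ 2 * √(L / n)) ∧
    massEnt π - Fintype.card α * (2 * √(L / n) * -Real.log c) - L / n ≤ (1 / n) * ent p x ∧
    (1 / n) * ent p x ≤ massEnt π + Fintype.card α * (2 * √(L / n) * -Real.log c) := by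
  have hp' := timed_mem_stdSimplex hn hp
  set P := law (timed n p) (fun w => x w.2 w.1) with hP
  have hPs : P ∈ stdSimplex ℝ α := law_mem_stdSimplex hp' _
  have hc1 : 0 ≤ -Real.log c := by
    obtain ⟨a, ha⟩ : ∃ a, 0 < π a := by
      by_contra! h
      have := hπ.2
      rw [Finset.sum_eq_zero fun a _ => le_antisymm (h a) (hπ.1 a)] at this
      exact zero_ne_one this
    have h1 : π a ≤ 1 := hπ.2 ▸ Finset.single_le_sum (fun a _ => hπ.1 a) (Finset.mem_univ a)
    linarith [Real.log_nonpos hc.le ((hcπ a ha).trans h1)]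
  have hpos : ∀ w : Fin n × Ω, 0 < timed n p w → 0 < π (x w.2 w.1) := by
    intro w hw
    refine hx _ ((hp.1 _).lt_of_ne' fun h => ?_) _
    simp [timed, h] at hw
  have hsub : ent p x ≤ ∑ i, ent p (fun ω => x ω i) := ent_le_sum_ent hp x
  have h1 := ent_timed_pair hn hp (fun i ω => x ω i)
  have h2 := ent_pair_le_add hp' (fun w => w.1) (fun w => x w.2 w.1)
  have h3 : ent (timed n p) (fun w => w.1) ≤ Real.log n := by
    simpa using ent_le_log_card hp' (fun w => w.1)
  have hcross : ∑ w, timed n p w * -Real.log (π (x w.2 w.1))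
      = (1 / n : ℝ) * ∑ i, ∑ ω, p ω * -Real.log (π (x ω i)) := sum_timed_mul p _
  have hhell := ent_add_hellinger_le hp' (fun w => x w.2 w.1) hπ.1 hπ.2.le hpos
  rw [hcross, ← hP] at hhell
  have hLn : ∑ a, (√(P a) - √(π a)) ^ 2 ≤ L / n := by
    have h4 : (1 / n : ℝ) * (∑ i, ∑ ω, p ω * -Real.log (π (x ω i)) - L)
        ≤ (1 / n : ℝ) * ∑ i, ent p (fun ω => x ω i) :=
      mul_le_mul_of_nonneg_left (hL.trans hsub) (by positivity)
    have h5 : (1 / n : ℝ) * L = L / n := by ring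
    have h6 : ent (timed n p) (fun w => (w.1, x w.2 w.1)) =
      Real.log n + (1 / n : ℝ) * ∑ i, ent p (fun ω => x ω i) := h1
    have h7 : ent (timed n p) (fun w => (w.1, x w.2 w.1))
      ≤ ent (timed n p) (fun w => w.1) + ent (timed n p) (fun w => x w.2 w.1) := h2
    rw [mul_sub, h5] at h4
    linarith
  have habs : ∀ a, |P a - π a| ≤ 2 * √(L / n) := by
    intro a
    have h4 : |√(P a) - √(π a)| ≤ √(L / n) := by
      refine Real.abs_le_sqrt (le_trans ?_ hLn)
      exact Finset.single_le_sum (f := fun a => (√(P a) - √(π a)) ^ 2) (fun a _ => sq_nonneg _)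
        (Finset.mem_univ a)
    have h5 : P a - π a = (√(P a) + √(π a)) * (√(P a) - √(π a)) := by
      have := Real.mul_self_sqrt (hPs.1 a)
      have := Real.mul_self_sqrt (hπ.1 a)
      nlinarith
    have h6 : √(P a) ≤ 1 := Real.sqrt_le_one.2 (law_le_one hp' _ a)
    have h7 : √(π a) ≤ 1 :=
      Real.sqrt_le_one.2 (hπ.2 ▸ Finset.single_le_sum (fun a _ => hπ.1 a) (Finset.mem_univ a))
    rw [h5, abs_mul, abs_of_nonneg (add_nonneg (Real.sqrt_nonneg _) (Real.sqrt_nonneg _))]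
    exact mul_le_mul (by linarith) h4 (abs_nonneg _) (by norm_num)
  have hdiff : |(1 / n : ℝ) * ∑ i, ∑ ω, p ω * -Real.log (π (x ω i)) - massEnt π|
      ≤ Fintype.card α * (2 * √(L / n) * -Real.log c) := by
    have h4 : massEnt π = ∑ a, π a * -Real.log (π a) := by
      simp [massEnt, hπ.2, Real.negMulLog]
    rw [← hcross, ← sum_law_mul (timed n p) (fun w => x w.2 w.1) (fun a => -Real.log (π a)), h4,
      ← Finset.sum_sub_distrib]
    refine (Finset.abs_sum_le_sum_abs _ _).trans ?_
    have h5 : ∀ a, |P a * -Real.log (π a) - π a * -Real.log (π a)|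
        ≤ 2 * √(L / n) * -Real.log c := by
      intro a
      rw [← sub_mul, abs_mul]
      refine mul_le_mul (habs a) ?_ (abs_nonneg _) (by positivity)
      rcases (hπ.1 a).eq_or_lt with h | h
      · rw [← h]; simpa using hc1
      · have h7 : π a ≤ 1 := hπ.2 ▸ Finset.single_le_sum (fun a _ => hπ.1 a) (Finset.mem_univ a)
        rw [abs_of_nonneg (by linarith [Real.log_nonpos h.le h7])]
        linarith [Real.log_le_log hc (hcπ a h)]
    refine (Finset.sum_le_sum fun a _ => h5 a).trans ?_
    simp
  have hgibbs : ∑ i, ent p (fun ω => x ω i) ≤ ∑ i, ∑ ω, p ω * -Real.log (π (x ω i)) :=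
    Finset.sum_le_sum fun i _ => ent_le_cross hp _ hπ.1 hπ.2.le fun ω h => hx ω h i
  refine ⟨fun a => (le_abs_self _).trans (habs a), ?_, ?_⟩
  · have h4 : (1 / n : ℝ) * (∑ i, ∑ ω, p ω * -Real.log (π (x ω i)) - L) ≤ (1 / n : ℝ) * ent p x :=
      mul_le_mul_of_nonneg_left hL (by positivity)
    have h5 : (1 / n : ℝ) * L = L / n := by ring
    rw [mul_sub, h5] at h4
    linarith [(abs_le.1 hdiff).1]
  · have h4 : (1 / n : ℝ) * ent p x ≤ (1 / n : ℝ) * ∑ i, ∑ ω, p ω * -Real.log (π (x ω i)) :=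
      mul_le_mul_of_nonneg_left (hsub.trans hgibbs) (by positivity)
    linarith [(abs_le.1 hdiff).2]

/-- Chain rule bound: `∑ i, H(y_i | M, x^{<i}, y^{<i}) ≤ H(y | M)`. -/
lemma sum_ent_past_le {p : Ω → ℝ} (hp : p ∈ stdSimplex ℝ Ω) (M : Ω → μ) (x : Ω → Fin n → α)
    (y : Ω → Fin n → β) :
    ∑ i : Fin n, (ent p (fun ω => ((M ω, past i (x ω), past i (y ω)), y ω i))
      - ent p (fun ω => (M ω, past i (x ω), past i (y ω))))
      ≤ ent p (fun ω => (M ω, y ω)) - ent p M := by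
  have h1 : ent p (fun ω => (M ω, y ω)) = ent p (fun ω => (M ω, past n (y ω))) :=
    ent_congr fun ω ω' => by simp only [Prod.mk.injEq, past_all_eq_iff]
  have h0 : ent p M = ent p (fun ω => (M ω, past 0 (y ω))) :=
    ent_congr fun ω ω' => by simp [past_zero]
  rw [h0, h1, ← sum_fin_sub (n := n) fun k => ent p (fun ω => (M ω, past k (y ω)))]
  refine Finset.sum_le_sum fun i _ => ?_
  have h := ent_submodular hp (fun ω => y ω i) (fun ω => past i (x ω))
    (fun ω => (M ω, past i (y ω)))
  have e1 : ent p (fun ω => ((M ω, past i (x ω), past i (y ω)), y ω i))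
      = ent p (fun ω => (y ω i, past i (x ω), (M ω, past i (y ω)))) :=
    ent_congr fun ω ω' => by simp only [Prod.mk.injEq]; tauto
  have e2 : ent p (fun ω => (M ω, past i (x ω), past i (y ω)))
      = ent p (fun ω => (past i (x ω), (M ω, past i (y ω)))) :=
    ent_congr fun ω ω' => by simp only [Prod.mk.injEq]; tauto
  have e3 : ent p (fun ω => (M ω, past (i + 1 : ℕ) (y ω)))
      = ent p (fun ω => (y ω i, (M ω, past i (y ω)))) :=
    ent_congr fun ω ω' => by simp only [Prod.mk.injEq, past_succ_eq_iff]; tauto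
  linarith

/-- Single-letterization. Let `x`, `y` be blocks whose laws are within divergence `L` of the i.i.d.
laws, with `M - x - y` a Markov chain up to `L` in the sense of `hML`. Then some auxiliary variable
`U` over the single-letter law satisfies `I(U;A) ≤ I(M;x) / n` and `I(U;B) ≥ I(M;y) / n`, up to
`O(1 / √n)`. It is `(J, M, x^{<J}, y^{<J})` with a uniform time `J`. -/
theorem exists_mem_entHull_of_block (hn : 0 < n) {p : Ω → ℝ} (hp : p ∈ stdSimplex ℝ Ω)
    (M : Ω → μ) (x : Ω → Fin n → α) (y : Ω → Fin n → β)
    {W : α → β → ℝ} (hW : ∀ a b, 0 ≤ W a b) (hWle : ∀ a, ∑ b, W a b ≤ 1)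
    {π : α → ℝ} (hπ : π ∈ stdSimplex ℝ α) (hWπ : ∀ a, 0 < π a → ∑ b, W a b = 1)
    {ρ : β → ℝ} (hρ : ρ ∈ stdSimplex ℝ β)
    (hx : ∀ ω, 0 < p ω → ∀ i, 0 < π (x ω i)) (hy : ∀ ω, 0 < p ω → ∀ i, 0 < ρ (y ω i))
    (hxy : ∀ ω, 0 < p ω → ∀ i, 0 < W (x ω i) (y ω i)) {c L : ℝ} (hc : 0 < c)
    (hcπ : ∀ a, 0 < π a → c ≤ π a) (hcρ : ∀ b, 0 < ρ b → c ≤ ρ b)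
    (hLx : ∑ i, ∑ ω, p ω * -Real.log (π (x ω i)) - L ≤ ent p x)
    (hLy : ∑ i, ∑ ω, p ω * -Real.log (ρ (y ω i)) - L ≤ ent p y)
    (hML : ∑ i, ∑ ω, p ω * -Real.log (W (x ω i) (y ω i)) - L
      ≤ ent p (fun ω => (M ω, x ω, y ω)) - ent p (fun ω => (M ω, x ω))) :
    ∃ s t, (π, s, t) ∈ entHull W ∧
      massEnt π - s ≤ (1 / n) * (ent p x + ent p M - ent p (fun ω => (M ω, x ω)))
        + Fintype.card α * (2 * √(L / n) * -Real.log c) + Fintype.card α * (2 * √(L / n) / c)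
        + 2 * (L / n) ∧
      (1 / n) * (ent p y + ent p M - ent p (fun ω => (M ω, y ω)))
        - Fintype.card β * (2 * √(L / n) * -Real.log c) - Fintype.card β * (2 * √(L / n) / c)
        - 6 * Fintype.card β * √(L / n) ≤ massEnt ρ - t := by
  have hp' := timed_mem_stdSimplex hn hp
  obtain ⟨hx1, hx2, -⟩ := averages_of_divergence_le hn hp x hπ hx hc hcπ hLx
  obtain ⟨-, -, hy2⟩ := averages_of_divergence_le hn hp y hρ hy hc hcρ hLy
  have hpos : ∀ w : Fin n × Ω, 0 < timed n p w → 0 < p w.2 := fun w hw =>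
    (hp.1 _).lt_of_ne' fun h => by simp [timed, h] at hw
  set T : Fin n → Ω → μ × (Fin n → Option α) × (Fin n → Option β) :=
    fun i ω => (M ω, past i (x ω), past i (y ω)) with hT
  have eU : ent (timed n p) (fun w => (w.1, T w.1 w.2)) = _ := ent_timed_pair hn hp T
  have eUA : ent (timed n p) (fun w => ((w.1, T w.1 w.2), x w.2 w.1))
      = Real.log n + (1 / n : ℝ) * ∑ i, ent p (fun ω => (T i ω, x ω i)) := by
    rw [← ent_timed_pair hn hp fun i ω => (T i ω, x ω i)]
    exact ent_congr fun w w' => by simp only [Prod.mk.injEq]; tauto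
  have eUB : ent (timed n p) (fun w => ((w.1, T w.1 w.2), y w.2 w.1))
      = Real.log n + (1 / n : ℝ) * ∑ i, ent p (fun ω => (T i ω, y ω i)) := by
    rw [← ent_timed_pair hn hp fun i ω => (T i ω, y ω i)]
    exact ent_congr fun w w' => by simp only [Prod.mk.injEq]; tauto
  have eUAB : ent (timed n p) (fun w => ((w.1, T w.1 w.2), x w.2 w.1, y w.2 w.1))
      = Real.log n + (1 / n : ℝ) * ∑ i, ent p (fun ω => (T i ω, x ω i, y ω i)) := by
    rw [← ent_timed_pair hn hp fun i ω => (T i ω, x ω i, y ω i)]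
    exact ent_congr fun w w' => by simp only [Prod.mk.injEq]; tauto
  have eW : ∑ w, timed n p w * -Real.log (W (x w.2 w.1) (y w.2 w.1))
      = (1 / n : ℝ) * ∑ i, ∑ ω, p ω * -Real.log (W (x ω i) (y ω i)) := sum_timed_mul p _
  -- The chain rule for `(x, y)` given `M` is exact, while the one for `y` given `M` loses.
  have cXY : ∑ i, ent p (fun ω => (T i ω, x ω i, y ω i)) - ∑ i, ent p (T i)
      = ent p (fun ω => (M ω, x ω, y ω)) - ent p M := by
    rw [← Finset.sum_sub_distrib]; exact sum_ent_past_eq M x y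
  have cY : ∑ i, ent p (fun ω => (T i ω, y ω i)) - ∑ i, ent p (T i)
      ≤ ent p (fun ω => (M ω, y ω)) - ent p M := by
    rw [← Finset.sum_sub_distrib]; exact sum_ent_past_le hp M x y
  have cX : ∑ i, ent p (fun ω => (T i ω, x ω i)) - ∑ i, ent p (T i)
      ≤ ent p (fun ω => (M ω, x ω)) - ent p M := by
    rw [← Finset.sum_sub_distrib]
    refine le_trans (le_of_eq (Finset.sum_congr rfl fun i _ => ?_)) (sum_ent_past_le hp M y x)
    congr 1 <;> exact ent_congr fun ω ω' => by simp only [hT, Prod.mk.injEq]; tauto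
  have cG : ∑ i, ent p (fun ω => (T i ω, x ω i, y ω i)) - ∑ i, ent p (fun ω => (T i ω, x ω i))
      ≤ ∑ i, ∑ ω, p ω * -Real.log (W (x ω i) (y ω i)) := by
    rw [← Finset.sum_sub_distrib]
    refine Finset.sum_le_sum fun i _ => ?_
    have h := ent_pair_le_cross hp (fun ω => (T i ω, x ω i)) (fun ω => y ω i)
      (W := fun u b => W u.2 b) (fun _ _ => hW _ _) (fun _ => hWle _) fun ω h => hxy ω h i
    have e : ent p (fun ω => ((T i ω, x ω i), y ω i)) = ent p (fun ω => (T i ω, x ω i, y ω i)) :=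
      ent_congr fun ω ω' => by simp only [Prod.mk.injEq]; tauto
    linarith
  have hLn : (1 / n : ℝ) * L = L / n := by ring
  have hκ : ∑ w, timed n p w * -Real.log (W (x w.2 w.1) (y w.2 w.1))
      - (ent (timed n p) (fun w => ((w.1, T w.1 w.2), x w.2 w.1, y w.2 w.1))
        - ent (timed n p) (fun w => ((w.1, T w.1 w.2), x w.2 w.1))) ≤ L / n := by
    rw [eUAB, eUA, eW, ← hLn]
    have h : (1 / n : ℝ) * (∑ i, ∑ ω, p ω * -Real.log (W (x ω i) (y ω i))
        - (∑ i, ent p (fun ω => (T i ω, x ω i, y ω i)) - ∑ i, ent p (fun ω => (T i ω, x ω i))))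
        ≤ (1 / n : ℝ) * L :=
      mul_le_mul_of_nonneg_left (by linarith) (by positivity)
    linarith
  obtain ⟨s, t, hst, hs, ht⟩ := exists_mem_entHull_near hp' (fun w => (w.1, T w.1 w.2))
    (fun w => x w.2 w.1) (fun w => y w.2 w.1) hW hWle hπ hWπ (fun w h => hx _ (hpos w h) _)
    (fun w h => hxy _ (hpos w h) _) hc hcπ (τ := 2 * √(L / n)) (by positivity) hx1
    hκ
  refine ⟨s, t, hst, ?_, ?_⟩
  · rw [eUA, eU] at hs
    have h : (1 / n : ℝ) * (ent p (fun ω => (M ω, x ω)) - ent p M - L)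
        ≤ (1 / n : ℝ) * (∑ i, ent p (fun ω => (T i ω, x ω i)) - ∑ i, ent p (T i)) :=
      mul_le_mul_of_nonneg_left (by linarith) (by positivity)
    linarith
  · rw [eUB, eU] at ht
    have h : (1 / n : ℝ) * (∑ i, ent p (fun ω => (T i ω, y ω i)) - ∑ i, ent p (T i))
        ≤ (1 / n : ℝ) * (ent p (fun ω => (M ω, y ω)) - ent p M) :=
      mul_le_mul_of_nonneg_left cY (by positivity)
    linarith

end Block

/-! ### Product distributions -/

section Product

variable {Ω α β γ : Type*} [Fintype Ω] {n : ℕ}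

lemma law_comp [Fintype α] (p : Ω → ℝ) (A : Ω → α) (f : α → β) (b : β) :
    law p (fun ω => f (A ω)) b = law (law p A) f b := by
  classical
  have := sum_law_mul p A (fun a => if f a = b then 1 else 0)
  simp only [mul_ite, mul_one, mul_zero] at this
  simpa only [law] using this.symm

lemma law_id (p : Ω → ℝ) (ω : Ω) : law p (fun ω => ω) ω = p ω := by
  classical
  simp [law]

/-- The product distribution `p ^ n`. -/
def iid (n : ℕ) (p : Ω → ℝ) (ω : Fin n → Ω) : ℝ := ∏ i, p (ω i)

lemma iid_mem_stdSimplex {p : Ω → ℝ} (hp : p ∈ stdSimplex ℝ Ω) :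
    iid n p ∈ stdSimplex ℝ (Fin n → Ω) := by
  refine ⟨fun ω => Finset.prod_nonneg fun i _ => hp.1 _, ?_⟩
  simp only [iid]
  rw [← Fintype.prod_sum fun (_ : Fin n) ω => p ω]
  simp [hp.2]

lemma law_iid (p : Ω → ℝ) (f : Ω → α) : law (iid n p) (fun ω i => f (ω i)) = iid n (law p f) := by
  classical
  ext a
  simp only [iid, law]
  rw [Fintype.prod_sum fun (i : Fin n) ω => if f ω = a i then p ω else 0]
  refine Finset.sum_congr rfl fun ω _ => ?_
  rw [funext_iff]
  split_ifs with h
  · exact Finset.prod_congr rfl fun i _ => by simp [h i]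
  · obtain ⟨i, hi⟩ := not_forall.1 h
    exact (Finset.prod_eq_zero (Finset.mem_univ i) (by simp [hi])).symm

lemma iid_pos_iff {p : α → ℝ} (hp : ∀ ω, 0 ≤ p ω) {ω : Fin n → α} :
    0 < iid n p ω ↔ ∀ i, 0 < p (ω i) := by
  refine ⟨fun h i => (hp _).lt_of_ne' fun h0 => ?_, fun h => Finset.prod_pos fun i _ => h i⟩
  exact h.ne' (Finset.prod_eq_zero (Finset.mem_univ i) h0)

/-- A conditional probability `P(B = b | A = a)`; it is `0` if `P(A = a) = 0`. -/
noncomputable def condLaw (p : Ω → ℝ) (A : Ω → α) (B : Ω → β) (a : α) (b : β) : ℝ :=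
  law p (fun ω => (A ω, B ω)) (a, b) / law p A a

lemma condLaw_nonneg {p : Ω → ℝ} (hp : ∀ ω, 0 ≤ p ω) (A : Ω → α) (B : Ω → β) (a : α) (b : β) :
    0 ≤ condLaw p A B a b := div_nonneg (law_nonneg hp _ _) (law_nonneg hp _ _)

lemma sum_condLaw [Fintype β] {p : Ω → ℝ} (A : Ω → α) (B : Ω → β) {a : α}
    (h : 0 < law p A a) : ∑ b, condLaw p A B a b = 1 := by
  simp only [condLaw]
  rw [← Finset.sum_div, sum_law_pair, div_self h.ne']

lemma sum_condLaw_le [Fintype β] {p : Ω → ℝ} (A : Ω → α) (B : Ω → β) (a : α) :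
    ∑ b, condLaw p A B a b ≤ 1 := by
  simp only [condLaw]
  rw [← Finset.sum_div, sum_law_pair]
  exact div_self_le_one _

lemma law_mul_condLaw {p : Ω → ℝ} (hp : ∀ ω, 0 ≤ p ω) (A : Ω → α) (B : Ω → β) (a : α) (b : β) :
    law p A a * condLaw p A B a b = law p (fun ω => (A ω, B ω)) (a, b) := by
  by_cases h : law p A a = 0
  · have h1 : law p (fun ω => (A ω, B ω)) (a, b) ≤ law p A a :=
      law_le_law hp fun ω h => (Prod.mk.inj h).1
    rw [h, zero_mul]
    exact le_antisymm (law_nonneg hp _ _) (h1.trans_eq h)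
  · rw [condLaw]; field_simp

end Product

/-! ### Change of measure -/

section ChangeOfMeasure

variable {Ω α β γ : Type*} [Fintype Ω]

/-- The cross-entropy of `A` relative to `q`. -/
noncomputable def crossEnt (p : Ω → ℝ) (A : Ω → α) (q : α → ℝ) : ℝ :=
  ∑ ω, p ω * -Real.log (q (A ω))

/-- Conditioning on an event of probability at least `δ` multiplies densities by at most `1 / δ`. -/
lemma exists_conditioned {p₀ : Ω → ℝ} (h0 : p₀ ∈ stdSimplex ℝ Ω) (S : Ω → Prop) [DecidablePred S]
    {δ : ℝ} (hδ : 0 < δ) (hS : δ ≤ ∑ ω, if S ω then p₀ ω else 0) :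
    ∃ p ∈ stdSimplex ℝ Ω, (∀ ω, 0 < p ω → S ω ∧ 0 < p₀ ω) ∧
      ∀ ω, p ω ≤ Real.exp (-Real.log δ) * p₀ ω := by
  set m := ∑ ω, if S ω then p₀ ω else 0 with hm
  have hm0 : 0 < m := hδ.trans_le hS
  refine ⟨fun ω => (if S ω then p₀ ω else 0) / m, ⟨fun ω => div_nonneg ?_ hm0.le, ?_⟩, ?_, ?_⟩
  · split_ifs <;> simp [h0.1 ω]
  · rw [← Finset.sum_div]; exact div_self hm0.ne'
  · intro ω h
    by_cases hs : S ω
    · simp only [hs, if_true] at h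
      exact ⟨hs, (h0.1 ω).lt_of_ne' fun h' => by simp [h'] at h⟩
    · simp [hs] at h
  · intro ω
    rw [Real.exp_neg, Real.exp_log hδ, inv_mul_eq_div]
    refine div_le_div₀ (h0.1 ω) ?_ hδ hS
    split_ifs
    · exact le_rfl
    · exact h0.1 ω

lemma crossEnt_sub_le_ent {p p₀ : Ω → ℝ} (hp : p ∈ stdSimplex ℝ Ω) {L : ℝ}
    (hpp : ∀ ω, p ω ≤ Real.exp L * p₀ ω) (A : Ω → α) :
    crossEnt p A (law p₀ A) - L ≤ ent p A := by
  classical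
  have hlaw : ∀ a, law p A a ≤ Real.exp L * law p₀ A a := by
    intro a
    simp only [law, Finset.mul_sum]
    refine Finset.sum_le_sum fun ω _ => ?_
    split_ifs
    · exact hpp ω
    · simp
  have : L = ∑ ω, p ω * L := by rw [← Finset.sum_mul, hp.2, one_mul]
  rw [crossEnt, this, ← Finset.sum_sub_distrib]
  refine Finset.sum_le_sum fun ω _ => ?_
  rcases (hp.1 ω).eq_or_lt with h | h
  · simp [← h]
  · have h1 : 0 < law p A (A ω) := h.trans_le (le_law hp.1 A ω)
    have h2 := h1.trans_le (hlaw (A ω))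
    have h3 := Real.log_le_log h1 (hlaw (A ω))
    rw [Real.log_mul (Real.exp_pos L).ne' (pos_of_mul_pos_right h2 (Real.exp_pos L).le).ne',
      Real.log_exp] at h3
    nlinarith

/-- If a test accepts with certainty under `p`, then the `R`-mass of its acceptance region is at
least the exponential of minus the divergence from `R`. -/
lemma log_accept_ge [Fintype α] {p : Ω → ℝ} (hp : p ∈ stdSimplex ℝ Ω) (A : Ω → α) {R : α → ℝ}
    (hR : ∀ a, 0 ≤ R a) (acc : α → Prop) [DecidablePred acc]
    (h : ∀ ω, 0 < p ω → acc (A ω) ∧ 0 < R (A ω)) :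
    0 < (∑ a, if acc a then R a else 0) ∧
      ent p A - crossEnt p A R ≤ Real.log (∑ a, if acc a then R a else 0) := by
  set b := ∑ a, if acc a then R a else 0 with hb
  have hnn : ∀ a, 0 ≤ if acc a then R a else 0 := fun a => by split_ifs <;> simp [hR a]
  have hb0 : 0 < b := by
    obtain ⟨ω, -, hω⟩ : ∃ ω ∈ Finset.univ, 0 < p ω :=
      Finset.exists_lt_of_sum_lt (by simp [hp.2])
    obtain ⟨h1, h2⟩ := h ω hω
    refine h2.trans_le ?_
    have := Finset.single_le_sum (fun a _ => hnn a) (Finset.mem_univ (A ω))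
    simpa [h1] using this
  refine ⟨hb0, ?_⟩
  have := ent_le_cross hp A (q := fun a => (if acc a then R a else 0) / b)
    (fun a => div_nonneg (hnn a) hb0.le) (by rw [← Finset.sum_div]; exact (div_self hb0.ne').le)
    (fun ω hω => by simp only [(h ω hω).1, if_true]; exact div_pos (h ω hω).2 hb0)
  have e : ∑ ω, p ω * -Real.log ((if acc (A ω) then R (A ω) else 0) / b)
      = crossEnt p A R + Real.log b := by
    have : Real.log b = ∑ ω, p ω * Real.log b := by rw [← Finset.sum_mul, hp.2, one_mul]
    rw [this, crossEnt, ← Finset.sum_add_distrib]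
    refine Finset.sum_congr rfl fun ω _ => ?_
    rcases (hp.1 ω).eq_or_lt with h0 | h0
    · simp [← h0]
    · simp only [(h ω h0).1, if_true]
      rw [Real.log_div (h ω h0).2.ne' hb0.ne']; ring
  linarith

/-- The data processing inequality for the divergence from a measure `R`. -/
lemma crossEnt_comp_le [Fintype α] [Fintype γ] {p : Ω → ℝ} (hp : p ∈ stdSimplex ℝ Ω) (A : Ω → α)
    {R : α → ℝ}
    (hR : ∀ a, 0 ≤ R a) (h : ∀ ω, 0 < p ω → 0 < R (A ω)) (f : α → γ) :
    crossEnt p (fun ω => f (A ω)) (law R f)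
      ≤ crossEnt p A R + ent p (fun ω => f (A ω)) - ent p A := by
  set l := law p (fun ω => f (A ω)) with hl
  have hl0 : ∀ c, 0 ≤ l c := fun c => law_nonneg hp.1 _ c
  have hRf0 : ∀ c, 0 ≤ law R f c := fun c => law_nonneg hR f c
  have hlpos : ∀ ω, 0 < p ω → 0 < l (f (A ω)) := fun ω h0 =>
    h0.trans_le (le_law hp.1 (fun ω => f (A ω)) ω)
  have hRpos : ∀ ω, 0 < p ω → 0 < law R f (f (A ω)) := fun ω h0 =>
    (h ω h0).trans_le (le_law hR f (A ω))
  have := ent_le_cross hp A (q := fun a => R a * (l (f a) / law R f (f a)))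
    (fun a => mul_nonneg (hR a) (div_nonneg (hl0 _) (hRf0 _))) ?_
    (fun ω h0 => mul_pos (h ω h0) (div_pos (hlpos ω h0) (hRpos ω h0)))
  · have e : ∑ ω, p ω * -Real.log (R (A ω) * (l (f (A ω)) / law R f (f (A ω))))
        = crossEnt p A R + ent p (fun ω => f (A ω))
          - crossEnt p (fun ω => f (A ω)) (law R f) := by
      rw [crossEnt, crossEnt, ent, ← Finset.sum_add_distrib, ← Finset.sum_sub_distrib]
      refine Finset.sum_congr rfl fun ω _ => ?_
      rcases (hp.1 ω).eq_or_lt with h0 | h0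
      · simp [← h0]
      · rw [Real.log_mul (h ω h0).ne' (div_pos (hlpos ω h0) (hRpos ω h0)).ne',
          Real.log_div (hlpos ω h0).ne' (hRpos ω h0).ne']
        ring
    linarith
  · rw [← sum_law_mul R f (fun c => l c / law R f c)]
    have hl1 : ∑ c, l c = 1 := by rw [hl, sum_law, hp.2]
    rw [← hl1]
    refine Finset.sum_le_sum fun c _ => ?_
    rcases (hRf0 c).eq_or_lt with h0 | h0
    · rw [← h0]; simpa using hl0 c
    · rw [mul_div_cancel₀ _ h0.ne']

lemma crossEnt_mul {p : Ω → ℝ} (hp : ∀ ω, 0 ≤ p ω) (A : Ω → α) (B : Ω → γ) {q : α → ℝ} {r : γ → ℝ}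
    (hq : ∀ ω, 0 < p ω → 0 < q (A ω)) (hr : ∀ ω, 0 < p ω → 0 < r (B ω)) :
    crossEnt p (fun ω => (A ω, B ω)) (fun x => q x.1 * r x.2)
      = crossEnt p A q + crossEnt p B r := by
  rw [crossEnt, crossEnt, crossEnt, ← Finset.sum_add_distrib]
  refine Finset.sum_congr rfl fun ω _ => ?_
  rcases (hp ω).eq_or_lt with h0 | h0
  · simp [← h0]
  · rw [Real.log_mul (hq ω h0).ne' (hr ω h0).ne']; ring

lemma crossEnt_iid {n : ℕ} {p : Ω → ℝ} (hp : ∀ ω, 0 ≤ p ω) (x : Ω → Fin n → α) {q : α → ℝ}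
    (hx : ∀ ω, 0 < p ω → ∀ i, 0 < q (x ω i)) :
    crossEnt p x (iid n q) = ∑ i, ∑ ω, p ω * -Real.log (q (x ω i)) := by
  rw [crossEnt, Finset.sum_comm]
  refine Finset.sum_congr rfl fun ω _ => ?_
  rcases (hp ω).eq_or_lt with h0 | h0
  · simp [← h0]
  · rw [iid, Real.log_prod fun i _ => (hx ω h0 i).ne', ← Finset.mul_sum, Finset.sum_neg_distrib]

end ChangeOfMeasure

/-! ### Error probabilities of a code on a single sample space -/

section Errors

variable {X Y Z : Type*} [Fintype X] [Fintype Y] [Fintype Z] {n N₁ N₂ : ℕ}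

lemma sum_triple (F : (Fin n → X) → (Fin n → Y) → (Fin n → Z) → ℝ) :
    ∑ x, ∑ y, ∑ z, F x y z = ∑ ω : Fin n → X × Y × Z,
      F (fun i => (ω i).1) (fun i => (ω i).2.1) (fun i => (ω i).2.2) := by
  let e : (Fin n → X × Y × Z) ≃ (Fin n → X) × (Fin n → Y) × (Fin n → Z) :=
    { toFun := fun ω => (fun i => (ω i).1, fun i => (ω i).2.1, fun i => (ω i).2.2)
      invFun := fun w i => (w.1 i, w.2.1 i, w.2.2 i)
      left_inv := fun ω => rfl
      right_inv := fun w => rfl }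
  rw [← e.symm.sum_comp, Fintype.sum_prod_type]
  simp only [Fintype.sum_prod_type]
  rfl

open Classical in
lemma Code.beta1_eq (C : Code X Y Z n N₁ N₂) (P : X × Y × Z → ℝ) :
    C.beta1 P = ∑ ω, if C.g₁ (C.f₁ fun i => (ω i).1) (fun i => (ω i).2.1) = Hyp.H0 then 0
      else iid n P ω := by
  rw [Code.beta1]
  refine Eq.trans ?_ (sum_triple fun x y z => if C.g₁ (C.f₁ x) y = Hyp.H0 then 0
    else ∏ i, P (x i, y i, z i))
  refine Finset.sum_congr rfl fun x _ => Finset.sum_congr rfl fun y _ =>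
    Finset.sum_congr rfl fun z _ => ?_
  rw [Finset.sum_eq_single (C.f₁ x), Finset.sum_eq_single (C.f₂ (C.f₁ x) y)]
  · simp [Code.jointH0]
  · intro m _ hm
    simp [Code.jointH0, hm.symm]
  · simp
  · intro m _ hm
    simp [Code.jointH0, hm.symm]
  · simp

open Classical in
lemma Code.eta1_eq (C : Code X Y Z n N₁ N₂) (P : X × Y × Z → ℝ) :
    C.eta1 P = ∑ ω, if C.g₂ (C.f₂ (C.f₁ fun i => (ω i).1) fun i => (ω i).2.1)
      (fun i => (ω i).2.2) = Hyp.H0 then 0 else iid n P ω := by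
  rw [Code.eta1]
  refine Eq.trans ?_ (sum_triple fun x y z => if C.g₂ (C.f₂ (C.f₁ x) y) z = Hyp.H0 then 0
    else ∏ i, P (x i, y i, z i))
  refine Finset.sum_congr rfl fun x _ => Finset.sum_congr rfl fun y _ =>
    Finset.sum_congr rfl fun z _ => ?_
  rw [Finset.sum_eq_single (C.f₁ x), Finset.sum_eq_single (C.f₂ (C.f₁ x) y)]
  · simp [Code.jointH0]
  · intro m _ hm
    simp [Code.jointH0, hm.symm]
  · simp
  · intro m _ hm
    simp [Code.jointH0, hm.symm]
  · simp

open Classical in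
lemma Code.beta2_eq (C : Code X Y Z n N₁ N₂) {P : X × Y × Z → ℝ}
    (hP : P ∈ stdSimplex ℝ (X × Y × Z)) :
    C.beta2 P = ∑ x, ∑ y, if C.g₁ (C.f₁ x) y = Hyp.H0 then
      iid n (law P fun ω => ω.1) x * iid n (law P fun ω => ω.2.1) y else 0 := by
  refine Finset.sum_congr rfl fun x _ => Finset.sum_congr rfl fun y _ => ?_
  have h : ∀ z, (∑ m₁ : Fin N₁, ∑ m₂ : Fin N₂,
      if C.g₁ m₁ y = Hyp.H0 then C.jointH1 P x y z m₁ m₂ else 0)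
      = (if C.g₁ (C.f₁ x) y = Hyp.H0 then
      iid n (law P fun ω => ω.1) x * iid n (law P fun ω => ω.2.1) y else 0)
        * iid n (law P fun ω => ω.2.2) z := by
    intro z
    rw [Finset.sum_eq_single (C.f₁ x), Finset.sum_eq_single (C.f₂ (C.f₁ x) y)]
    · simp [Code.jointH1, iid]
    · intro m _ hm
      simp [Code.jointH1, hm.symm]
    · simp
    · intro m _ hm
      simp [Code.jointH1, hm.symm]
    · simp
  rw [Finset.sum_congr rfl fun z _ => h z, ← Finset.mul_sum,
    (iid_mem_stdSimplex (law_mem_stdSimplex hP _)).2, mul_one]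

open Classical in
lemma Code.eta2_eq (C : Code X Y Z n N₁ N₂) (P : X × Y × Z → ℝ) :
    C.eta2 P = ∑ x, ∑ y, ∑ z, if C.g₂ (C.f₂ (C.f₁ x) y) z = Hyp.H0 then
      iid n (law P fun ω => ω.1) x * iid n (law P fun ω => ω.2.1) y
        * iid n (law P fun ω => ω.2.2) z else 0 := by
  refine Finset.sum_congr rfl fun x _ => Finset.sum_congr rfl fun y _ =>
    Finset.sum_congr rfl fun z _ => ?_
  rw [Finset.sum_eq_single (C.f₁ x), Finset.sum_eq_single (C.f₂ (C.f₁ x) y)]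
  · simp [Code.jointH1, iid]
  · intro m _ hm
    simp [Code.jointH1, hm.symm]
  · simp
  · intro m _ hm
    simp [Code.jointH1, hm.symm]
  · simp

end Errors

/-! ### The strong converse -/

section Converse

lemma exists_pos_le_of_pos {α : Type*} [Finite α] (q : α → ℝ) :
    ∃ c, 0 < c ∧ c ≤ 1 ∧ ∀ a, 0 < q a → c ≤ q a := by
  have h : ∀ᶠ c : ℝ in 𝓝[>] 0, ∀ a, 0 < q a → c ≤ q a := by
    rw [Filter.eventually_all]
    intro a
    by_cases ha : 0 < q a
    · filter_upwards [Ioo_mem_nhdsGT ha] with c hc _ using hc.2.le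
    · exact Filter.Eventually.of_forall fun c h => absurd h ha
  obtain ⟨c, h1, h2⟩ := (h.and (Ioo_mem_nhdsGT (zero_lt_one (α := ℝ)))).exists
  exact ⟨c, h2.1, h2.2.le, h1⟩

variable {X Y Z : Type*} [Fintype X] [Fintype Y] [Fintype Z]

/-- The channel `P_{Y|X}`. -/
noncomputable def kerXY (P : X × Y × Z → ℝ) : X → Y → ℝ :=
  condLaw P (fun ω => ω.1) (fun ω => ω.2.1)

/-- The channel `P_{Z|Y}`. -/
noncomputable def kerYZ (P : X × Y × Z → ℝ) : Y → Z → ℝ :=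
  condLaw P (fun ω => ω.2.1) (fun ω => ω.2.2)

variable {P : X × Y × Z → ℝ}

lemma neg_log_condLaw {Ω α β : Type*} [Fintype Ω] {p : Ω → ℝ} {A : Ω → α} {B : Ω → β} {a : α}
    {b : β} (h1 : 0 < law p A a) (h2 : 0 < law p (fun ω => (A ω, B ω)) (a, b)) :
    -Real.log (condLaw p A B a b)
      = -Real.log (law p (fun ω => (A ω, B ω)) (a, b)) - -Real.log (law p A a) := by
  rw [condLaw, Real.log_div h2.ne' h1.ne']; ring

set_option maxHeartbeats 1000000 in
open Classical in
/-- The strong converse for one code, in terms of the entropy hulls of the two hops. Condition the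
source on the event that both decoders accept `H0`. This costs at most `log (1 / δ)` in divergence,
keeps the Markov chains up to that amount, and turns the type-II error probabilities into
divergences of distributions under which the tests never fail. -/
theorem Code.exists_mem_entHull (hP : IsSource P) {δ : ℝ} (hδ : 0 < δ) (hδ1 : δ ≤ 1) :
    ∃ K, 0 ≤ K ∧ ∀ (n N₁ N₂ : ℕ), 0 < n → ∀ C : Code X Y Z n N₁ N₂,
      C.beta1 P + C.eta1 P ≤ 1 - δ → 0 < C.beta2 P ∧ 0 < C.eta2 P ∧
      ∃ s t s' t', (law P (fun ω => ω.1), s, t) ∈ entHull (kerXY P) ∧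
        (law P (fun ω => ω.2.1), s', t') ∈ entHull (kerYZ P) ∧
        massEnt (law P fun ω => ω.1) - s ≤ 1 / n * Real.log N₁ + K / √n ∧
        massEnt (law P fun ω => ω.2.1) - s' ≤ 1 / n * Real.log N₂ + K / √n ∧
        -(1 / n) * Real.log (C.beta2 P) ≤ massEnt (law P fun ω => ω.2.1) - t + K / √n ∧
        -(1 / n) * Real.log (C.eta2 P) ≤ massEnt (law P fun ω => ω.2.1) - t
          + (massEnt (law P fun ω => ω.2.2) - t') + K / √n := by
  have hPs := hP.mem_simplex
  obtain ⟨c₁, hc₁, hc₁1, hcπ⟩ := exists_pos_le_of_pos (law P fun ω => ω.1)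
  obtain ⟨c₂, hc₂, hc₂1, hcρ⟩ := exists_pos_le_of_pos (law P fun ω => ω.2.1)
  obtain ⟨c₃, hc₃, hc₃1, hcσ⟩ := exists_pos_le_of_pos (law P fun ω => ω.2.2)
  set c := min c₁ (min c₂ c₃) with hcdef
  have hc : 0 < c := lt_min hc₁ (lt_min hc₂ hc₃)
  have hcc₁ : c ≤ c₁ := min_le_left _ _
  have hcc₂ : c ≤ c₂ := (min_le_right _ _).trans (min_le_left _ _)
  have hcc₃ : c ≤ c₃ := (min_le_right _ _).trans (min_le_right _ _)
  have hlogc : 0 ≤ -Real.log c := by linarith [Real.log_nonpos hc.le (hcc₁.trans hc₁1)]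
  set L := -Real.log δ with hL
  have hL0 : 0 ≤ L := by linarith [Real.log_nonpos hδ.le hδ1]
  set g := 2 * -Real.log c + 2 / c + 6 with hg
  refine ⟨2 * (Fintype.card X + Fintype.card Y + Fintype.card Z) * (g * √L) + 3 * L,
    by positivity, ?_⟩
  intro n N₁ N₂ hn C hC
  have hn' : (0 : ℝ) < n := by exact_mod_cast hn
  set x : (Fin n → X × Y × Z) → Fin n → X := fun ω i => (ω i).1 with hx
  set y : (Fin n → X × Y × Z) → Fin n → Y := fun ω i => (ω i).2.1 with hy
  set z : (Fin n → X × Y × Z) → Fin n → Z := fun ω i => (ω i).2.2 with hz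
  set M₁ : (Fin n → X × Y × Z) → Fin N₁ := fun ω => C.f₁ (x ω) with hM₁
  set M₂ : (Fin n → X × Y × Z) → Fin N₂ := fun ω => C.f₂ (M₁ ω) (y ω) with hM₂
  have hp₀ : iid n P ∈ stdSimplex ℝ (Fin n → X × Y × Z) := iid_mem_stdSimplex hPs
  set π := law P (fun ω => ω.1) with hπ
  set ρ := law P (fun ω => ω.2.1) with hρ
  set σ := law P (fun ω => ω.2.2) with hσ
  have lx : law (iid n P) x = iid n π := law_iid P fun ω => ω.1
  have ly : law (iid n P) y = iid n ρ := law_iid P fun ω => ω.2.1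
  have lz : law (iid n P) z = iid n σ := law_iid P fun ω => ω.2.2
  have lxy : law (iid n P) (fun ω i => ((ω i).1, (ω i).2.1))
      = iid n (law P fun ω => (ω.1, ω.2.1)) := law_iid P fun ω => (ω.1, ω.2.1)
  have lid : law (iid n P) (fun ω => ω) = iid n P := funext fun ω => law_id _ ω
  -- Condition on joint acceptance.
  obtain ⟨p, hp, hpS, hpp⟩ := exists_conditioned hp₀
    (fun ω => C.g₁ (M₁ ω) (y ω) = Hyp.H0 ∧ C.g₂ (M₂ ω) (z ω) = Hyp.H0) hδ (by
      have h1 : ∀ ω, iid n P ω - (if C.g₁ (M₁ ω) (y ω) = Hyp.H0 then 0 else iid n P ω)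
          - (if C.g₂ (M₂ ω) (z ω) = Hyp.H0 then 0 else iid n P ω)
          ≤ if C.g₁ (M₁ ω) (y ω) = Hyp.H0 ∧ C.g₂ (M₂ ω) (z ω) = Hyp.H0 then iid n P ω else 0 := by
        intro ω
        have := hp₀.1 ω
        by_cases h1 : C.g₁ (M₁ ω) (y ω) = Hyp.H0 <;> by_cases h2 : C.g₂ (M₂ ω) (z ω) = Hyp.H0 <;>
          simp [h1, h2, this]
      have h2 := Finset.sum_le_sum fun ω (_ : ω ∈ Finset.univ) => h1 ω
      rw [Finset.sum_sub_distrib, Finset.sum_sub_distrib, hp₀.2] at h2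
      have h3 := C.beta1_eq P
      have h4 := C.eta1_eq P
      refine le_trans ?_ h2
      rw [h3, h4] at hC
      linarith)
  have hPpos : ∀ ω, 0 < p ω → ∀ i, 0 < P (ω i) := fun ω h => (iid_pos_iff hPs.1).1 (hpS ω h).2
  have hπpos : ∀ ω, 0 < p ω → ∀ i, 0 < π (x ω i) := fun ω h i =>
    (hPpos ω h i).trans_le (le_law hPs.1 (fun ω => ω.1) (ω i))
  have hρpos : ∀ ω, 0 < p ω → ∀ i, 0 < ρ (y ω i) := fun ω h i =>
    (hPpos ω h i).trans_le (le_law hPs.1 (fun ω => ω.2.1) (ω i))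
  have hσpos : ∀ ω, 0 < p ω → ∀ i, 0 < σ (z ω i) := fun ω h i =>
    (hPpos ω h i).trans_le (le_law hPs.1 (fun ω => ω.2.2) (ω i))
  have hxypos : ∀ ω, 0 < p ω → ∀ i, 0 < law P (fun ω => (ω.1, ω.2.1)) (x ω i, y ω i) :=
    fun ω h i => (hPpos ω h i).trans_le (le_law hPs.1 (fun ω => (ω.1, ω.2.1)) (ω i))
  have hyzpos : ∀ ω, 0 < p ω → ∀ i, 0 < law P (fun ω => (ω.2.1, ω.2.2)) (y ω i, z ω i) :=
    fun ω h i => (hPpos ω h i).trans_le (le_law hPs.1 (fun ω => (ω.2.1, ω.2.2)) (ω i))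
  -- The entropies of the blocks are within `L` of the cross-entropies.
  have dx : crossEnt p x (iid n π) - L ≤ ent p x := lx ▸ crossEnt_sub_le_ent hp hpp x
  have dy : crossEnt p y (iid n ρ) - L ≤ ent p y := ly ▸ crossEnt_sub_le_ent hp hpp y
  have dz : crossEnt p z (iid n σ) - L ≤ ent p z := lz ▸ crossEnt_sub_le_ent hp hpp z
  have dxy := crossEnt_sub_le_ent hp hpp (fun ω i => ((ω i).1, (ω i).2.1))
  have did := crossEnt_sub_le_ent hp hpp (fun ω => ω)
  rw [lxy] at dxy
  rw [lid] at did
  have cx := crossEnt_iid hp.1 x hπpos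
  have cy := crossEnt_iid hp.1 y hρpos
  have cz := crossEnt_iid hp.1 z hσpos
  have cxy := crossEnt_iid hp.1 (fun ω i => ((ω i).1, (ω i).2.1)) hxypos
  have cid := crossEnt_iid hp.1 (fun ω => ω) hPpos
  have gx : ent p x ≤ crossEnt p x (iid n π) := ent_le_cross hp x
    (iid_mem_stdSimplex (law_mem_stdSimplex hPs _)).1
    (iid_mem_stdSimplex (law_mem_stdSimplex hPs _)).2.le
    fun ω h => Finset.prod_pos fun i _ => hπpos ω h i
  have gxy : ent p (fun ω i => ((ω i).1, (ω i).2.1))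
      ≤ crossEnt p (fun ω i => ((ω i).1, (ω i).2.1)) (iid n (law P fun ω => (ω.1, ω.2.1))) :=
    ent_le_cross hp _ (iid_mem_stdSimplex (law_mem_stdSimplex hPs _)).1
    (iid_mem_stdSimplex (law_mem_stdSimplex hPs _)).2.le
    fun ω h => Finset.prod_pos fun i _ => hxypos ω h i
  have exy : ent p (fun ω => (x ω, y ω)) = ent p (fun ω i => ((ω i).1, (ω i).2.1)) :=
    ent_congr fun ω ω' => by simp only [hx, hy, Prod.mk.injEq, funext_iff, forall_and]
  -- The Markov chain of the first hop.
  have hML₁ : ∑ i, ∑ ω, p ω * -Real.log (kerXY P (x ω i) (y ω i)) - L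
      ≤ ent p (fun ω => (M₁ ω, x ω, y ω)) - ent p (fun ω => (M₁ ω, x ω)) := by
    have e1 : ent p (fun ω => (M₁ ω, x ω, y ω)) = ent p (fun ω => (x ω, y ω)) :=
      ent_congr fun ω ω' => by
        simp only [Prod.mk.injEq]
        exact ⟨fun h => h.2, fun h => ⟨by rw [hM₁]; simp only [h.1], h⟩⟩
    have e2 : ent p (fun ω => (M₁ ω, x ω)) = ent p x :=
      ent_congr fun ω ω' => by
        simp only [Prod.mk.injEq]
        exact ⟨fun h => h.2, fun h => ⟨by rw [hM₁]; simp only [h], h⟩⟩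
    have e3 : ∑ i, ∑ ω, p ω * -Real.log (kerXY P (x ω i) (y ω i))
        = crossEnt p (fun ω i => ((ω i).1, (ω i).2.1)) (iid n (law P fun ω => (ω.1, ω.2.1)))
          - crossEnt p x (iid n π) := by
      rw [cxy, cx, ← Finset.sum_sub_distrib]
      refine Finset.sum_congr rfl fun i _ => ?_
      rw [← Finset.sum_sub_distrib]
      refine Finset.sum_congr rfl fun ω _ => ?_
      rcases (hp.1 ω).eq_or_lt with h0 | h0
      · simp [← h0]
      · rw [kerXY, neg_log_condLaw (hπpos ω h0 i) (hxypos ω h0 i)]; ring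
    linarith
  -- The Markov chain of the second hop, whose message depends on `x` as well.
  have hML₂ : ∑ i, ∑ ω, p ω * -Real.log (kerYZ P (y ω i) (z ω i)) - L
      ≤ ent p (fun ω => (M₂ ω, y ω, z ω)) - ent p (fun ω => (M₂ ω, y ω)) := by
    have h := ent_submodular hp z x (fun ω => (M₂ ω, y ω))
    have e0 : ent p (fun ω => (M₂ ω, y ω, z ω)) = ent p (fun ω => (z ω, (M₂ ω, y ω))) :=
      ent_congr fun ω ω' => by simp only [Prod.mk.injEq]; tauto
    have e1 : ent p (fun ω => (z ω, x ω, (M₂ ω, y ω))) = ent p (fun ω => ω) :=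
      ent_congr fun ω ω' => by
        simp only [Prod.mk.injEq]
        refine ⟨fun h => ?_, fun h => by rw [h]; simp⟩
        ext1 i
        have h1 := congrFun h.1 i
        have h2 := congrFun h.2.1 i
        have h3 := congrFun h.2.2.2 i
        exact Prod.ext h2 (Prod.ext h3 h1)
    have e2 : ent p (fun ω => (x ω, (M₂ ω, y ω))) = ent p (fun ω => (x ω, y ω)) :=
      ent_congr fun ω ω' => by
        simp only [Prod.mk.injEq]
        exact ⟨fun h => ⟨h.1, h.2.2⟩, fun h => ⟨h.1, by simp only [hM₂, hM₁, h.1, h.2], h.2⟩⟩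
    have e3 : ∑ i, ∑ ω, p ω * -Real.log (kerYZ P (y ω i) (z ω i))
        = crossEnt p (fun ω => ω) (iid n P)
          - crossEnt p (fun ω i => ((ω i).1, (ω i).2.1)) (iid n (law P fun ω => (ω.1, ω.2.1))) := by
      rw [cxy, cid, ← Finset.sum_sub_distrib]
      refine Finset.sum_congr rfl fun i _ => ?_
      rw [← Finset.sum_sub_distrib]
      refine Finset.sum_congr rfl fun ω _ => ?_
      rcases (hp.1 ω).eq_or_lt with h0 | h0
      · simp [← h0]
      · rw [kerYZ, neg_log_condLaw (hρpos ω h0 i) (hyzpos ω h0 i), ← mul_sub]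
        congr 1
        have hm := hP.markov (x ω i) (y ω i) (z ω i)
        have hid : law P (fun ω => (ω.1, ω.2.1, ω.2.2)) (x ω i, y ω i, z ω i) = P (ω i) :=
          law_id P (ω i)
        rw [hid] at hm
        have hm' := congrArg Real.log hm
        rw [Real.log_mul (hPpos ω h0 i).ne' (hρpos ω h0 i).ne',
          Real.log_mul (hxypos ω h0 i).ne' (hyzpos ω h0 i).ne'] at hm'
        have hm'' : Real.log (P (ω i)) + Real.log (ρ (y ω i))
          = Real.log (law P (fun ω => (ω.1, ω.2.1)) (x ω i, y ω i))
            + Real.log (law P (fun ω => (ω.2.1, ω.2.2)) (y ω i, z ω i)) := hm'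
        have e5 : (x ω i, y ω i) = ((ω i).1, (ω i).2.1) := rfl
        rw [e5] at hm''
        linarith
    linarith
  obtain ⟨s, t, hst, hs, ht⟩ := exists_mem_entHull_of_block hn hp M₁ x y
    (condLaw_nonneg hPs.1 _ _) (sum_condLaw_le _ _) (law_mem_stdSimplex hPs fun ω => ω.1)
    (fun a ha => sum_condLaw _ _ ha) (law_mem_stdSimplex hPs fun ω => ω.2.1) hπpos hρpos
    (fun ω h i => div_pos (hxypos ω h i) (hπpos ω h i)) hc
    (fun a h => hcc₁.trans (hcπ a h)) (fun a h => hcc₂.trans (hcρ a h))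
    (cx ▸ dx) (cy ▸ dy) hML₁
  obtain ⟨s', t', hst', hs', ht'⟩ := exists_mem_entHull_of_block hn hp M₂ y z
    (condLaw_nonneg hPs.1 _ _) (sum_condLaw_le _ _) (law_mem_stdSimplex hPs fun ω => ω.2.1)
    (fun a ha => sum_condLaw _ _ ha) (law_mem_stdSimplex hPs fun ω => ω.2.2) hρpos hσpos
    (fun ω h i => div_pos (hyzpos ω h i) (hρpos ω h i)) hc
    (fun a h => hcc₂.trans (hcρ a h)) (fun a h => hcc₃.trans (hcσ a h))
    (cy ▸ dy) (cz ▸ dz) hML₂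
  -- Type-II error at the relay.
  set P₁ := law (iid n P) M₁ with hP₁
  have hP₁0 : ∀ m, 0 ≤ P₁ m := fun m => law_nonneg hp₀.1 _ _
  have hP₁pos : ∀ ω, 0 < p ω → 0 < P₁ (M₁ ω) := fun ω h =>
    (hpS ω h).2.trans_le (le_law hp₀.1 M₁ ω)
  have hρn0 : ∀ b, 0 ≤ iid n ρ b := (iid_mem_stdSimplex (law_mem_stdSimplex hPs _)).1
  have hσn0 : ∀ b, 0 ≤ iid n σ b := (iid_mem_stdSimplex (law_mem_stdSimplex hPs _)).1
  have hρn : ∀ ω, 0 < p ω → 0 < iid n ρ (y ω) := fun ω h =>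
    Finset.prod_pos fun i _ => hρpos ω h i
  have hσn : ∀ ω, 0 < p ω → 0 < iid n σ (z ω) := fun ω h =>
    Finset.prod_pos fun i _ => hσpos ω h i
  set R : Fin N₁ × (Fin n → Y) → ℝ := fun a => P₁ a.1 * iid n ρ a.2 with hR
  have hR0 : ∀ a, 0 ≤ R a := fun a => mul_nonneg (hP₁0 _) (hρn0 _)
  have hRpos : ∀ ω, 0 < p ω → 0 < R (M₁ ω, y ω) := fun ω h => mul_pos (hP₁pos ω h) (hρn ω h)
  have hM₁law : ∀ m, P₁ m = law (iid n π) C.f₁ m := fun m => by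
    rw [hP₁, ← lx]; exact law_comp _ x C.f₁ m
  have hβ : C.beta2 P = ∑ a, if C.g₁ a.1 a.2 = Hyp.H0 then R a else 0 := by
    rw [C.beta2_eq hPs, Fintype.sum_prod_type]
    have := sum_law_mul (iid n π) C.f₁
      (fun m => ∑ b, if C.g₁ m b = Hyp.H0 then iid n ρ b else 0)
    simp only [Finset.mul_sum, mul_ite, mul_zero] at this
    simp only [hR, hM₁law]
    exact this.symm
  obtain ⟨hβ0, hβlog⟩ := log_accept_ge hp (fun ω => (M₁ ω, y ω)) hR0
    (fun a => C.g₁ a.1 a.2 = Hyp.H0) (fun ω h => ⟨(hpS ω h).1.1, hRpos ω h⟩)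
  rw [← hβ] at hβ0 hβlog
  have cR : crossEnt p (fun ω => (M₁ ω, y ω)) R = crossEnt p M₁ P₁ + crossEnt p y (iid n ρ) :=
    crossEnt_mul hp.1 M₁ y hP₁pos hρn
  have dM₁ : crossEnt p M₁ P₁ - L ≤ ent p M₁ := crossEnt_sub_le_ent hp hpp M₁
  -- Type-II error at the receiver.
  set P₂ := law R (fun a => C.f₂ a.1 a.2) with hP₂
  have hP₂0 : ∀ m, 0 ≤ P₂ m := fun m => law_nonneg hR0 _ _
  have hP₂pos : ∀ ω, 0 < p ω → 0 < P₂ (M₂ ω) := fun ω h =>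
    (hRpos ω h).trans_le (le_law hR0 (fun a => C.f₂ a.1 a.2) (M₁ ω, y ω))
  have hη : C.eta2 P = ∑ a : Fin N₂ × (Fin n → Z),
      if C.g₂ a.1 a.2 = Hyp.H0 then P₂ a.1 * iid n σ a.2 else 0 := by
    rw [C.eta2_eq P, Fintype.sum_prod_type]
    have h2 := sum_law_mul R (fun a => C.f₂ a.1 a.2)
      (fun m => ∑ b, if C.g₂ m b = Hyp.H0 then iid n σ b else 0)
    have h1 := sum_law_mul (iid n π) C.f₁ (fun m => ∑ b, iid n ρ b *
      ∑ w, if C.g₂ (C.f₂ m b) w = Hyp.H0 then iid n σ w else 0)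
    simp only [Finset.mul_sum, mul_ite, mul_zero, Fintype.sum_prod_type] at h1 h2
    rw [h2]
    simp only [hR, hM₁law, mul_assoc]
    exact h1.symm
  obtain ⟨hη0, hηlog⟩ := log_accept_ge hp (fun ω => (M₂ ω, z ω))
    (R := fun a => P₂ a.1 * iid n σ a.2) (fun a => mul_nonneg (hP₂0 _) (hσn0 _))
    (fun a => C.g₂ a.1 a.2 = Hyp.H0)
    (fun ω h => ⟨(hpS ω h).1.2, mul_pos (hP₂pos ω h) (hσn ω h)⟩)
  rw [← hη] at hη0 hηlog
  rw [crossEnt_mul hp.1 M₂ z hP₂pos hσn] at hηlog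
  have dM₂ : crossEnt p M₂ P₂ ≤ crossEnt p (fun ω => (M₁ ω, y ω)) R + ent p M₂
      - ent p (fun ω => (M₁ ω, y ω)) :=
    crossEnt_comp_le hp (fun ω => (M₁ ω, y ω)) hR0 hRpos fun a => C.f₂ a.1 a.2
  -- The rates.
  have hN₁ : ent p M₁ ≤ Real.log N₁ := by simpa using ent_le_log_card hp M₁
  have hN₂ : ent p M₂ ≤ Real.log N₂ := by simpa using ent_le_log_card hp M₂
  have hMx : ent p x ≤ ent p (fun ω => (M₁ ω, x ω)) :=
    ent_mono hp.1 fun ω ω' h => (Prod.mk.inj h).2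
  have hMy : ent p y ≤ ent p (fun ω => (M₂ ω, y ω)) :=
    ent_mono hp.1 fun ω ω' h => (Prod.mk.inj h).2
  -- Collect the errors.
  set r := √(L / n) with hr
  have hrL : r = √L / √n := Real.sqrt_div hL0 n
  have hsn : 0 < √(n : ℝ) := Real.sqrt_pos.2 hn'
  have hLn : L / n ≤ L / √n := by
    refine div_le_div_of_nonneg_left hL0 hsn ?_
    rw [Real.sqrt_le_left hn'.le]
    exact le_self_pow₀ (by exact_mod_cast hn) two_ne_zero
  have hK : (2 * (Fintype.card X + Fintype.card Y + Fintype.card Z) * (g * √L) + 3 * L) / √n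
      = 2 * ((Fintype.card X : ℝ) * (g * r) + Fintype.card Y * (g * r) + Fintype.card Z * (g * r))
        + 3 * (L / √n) := by
    rw [hrL]; ring
  have hX : (Fintype.card X : ℝ) * (2 * r * -Real.log c) + Fintype.card X * (2 * r / c)
      ≤ Fintype.card X * (g * r) := by
    have : (Fintype.card X : ℝ) * (g * r) = Fintype.card X * (2 * r * -Real.log c)
      + Fintype.card X * (2 * r / c) + 6 * Fintype.card X * r := by rw [hg]; ring
    have : 0 ≤ 6 * (Fintype.card X : ℝ) * r := by positivity
    linarith
  have hY : (Fintype.card Y : ℝ) * (2 * r * -Real.log c) + Fintype.card Y * (2 * r / c)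
      + 6 * Fintype.card Y * r = Fintype.card Y * (g * r) := by rw [hg]; ring
  have hZ : (Fintype.card Z : ℝ) * (2 * r * -Real.log c) + Fintype.card Z * (2 * r / c)
      + 6 * Fintype.card Z * r = Fintype.card Z * (g * r) := by rw [hg]; ring
  have hX0 : 0 ≤ (Fintype.card X : ℝ) * (g * r) := by positivity
  have hY0 : 0 ≤ (Fintype.card Y : ℝ) * (g * r) := by positivity
  have hY1 : 0 ≤ 6 * (Fintype.card Y : ℝ) * r := by positivity
  have hZ0 : 0 ≤ (Fintype.card Z : ℝ) * (g * r) := by positivity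
  have hLn0 : 0 ≤ L / √n := by positivity
  have hLn' : (1 / n : ℝ) * L = L / n := by ring
  have hmul : ∀ {a b : ℝ}, a ≤ b → (1 / n : ℝ) * a ≤ (1 / n : ℝ) * b := fun h =>
    mul_le_mul_of_nonneg_left h (by positivity)
  refine ⟨hβ0, hη0, s, t, s', t', hst, hst', ?_, ?_, ?_, ?_⟩
  · have := hmul (a := ent p x + ent p M₁ - ent p (fun ω => (M₁ ω, x ω))) (b := Real.log N₁)
      (by linarith)
    rw [hK]
    linarith
  · have := hmul (a := ent p y + ent p M₂ - ent p (fun ω => (M₂ ω, y ω))) (b := Real.log N₂)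
      (by linarith)
    rw [hK]
    linarith
  · have := hmul (a := -Real.log (C.beta2 P))
      (b := (ent p y + ent p M₁ - ent p (fun ω => (M₁ ω, y ω))) + 2 * L) (by linarith)
    rw [hK]
    linarith
  · have := hmul (a := -Real.log (C.eta2 P))
      (b := (ent p y + ent p M₁ - ent p (fun ω => (M₁ ω, y ω)))
        + (ent p z + ent p M₂ - ent p (fun ω => (M₂ ω, z ω))) + 3 * L) (by linarith)
    rw [hK]
    linarith

end Converse

/-! ### Test distributions and entropy hulls -/

section Tests

variable {X Y Z : Type*} [Fintype X] [Fintype Y] [Fintype Z] {P : X × Y × Z → ℝ} {k l : ℕ}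
  {Q : X × Y × Z × Fin k × Fin l → ℝ}

lemma law_of_marginal (hQ : ∀ ω, law Q (fun w => (w.1, w.2.1, w.2.2.1)) ω = P ω) {γ : Type*}
    (F : X × Y × Z → γ) (a : γ) :
    law Q (fun w => F (w.1, w.2.1, w.2.2.1)) a = law P F a := by
  rw [law_comp Q (fun w => (w.1, w.2.1, w.2.2.1)) F a, funext hQ]

lemma IsTest.law_source (hQ : IsTest P Q) {γ : Type*} (F : X × Y × Z → γ) (a : γ) :
    law Q (fun w => F (w.1, w.2.1, w.2.2.1)) a = law P F a :=
  law_of_marginal (fun ω => hQ.marginal ω.1 ω.2.1 ω.2.2) F a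

lemma IsTest.ent_source (hQ : IsTest P Q) {γ : Type*} [Fintype γ] (F : X × Y × Z → γ) :
    ent Q (fun w => F (w.1, w.2.1, w.2.2.1)) = massEnt (law P F) := by
  have h1 : ∑ a, law P F a = 1 := by
    simp only [← hQ.law_source F]
    rw [sum_law, hQ.mem_simplex.2]
  rw [ent_eq_sum_negMulLog, massEnt, h1, Real.negMulLog_one, sub_zero]
  exact Finset.sum_congr rfl fun a _ => by rw [hQ.law_source]

/-- The entropy point of a Markov chain `U - A - B`. -/
lemma mem_entHull_of_isMarkov {Ω α β υ : Type*} [Fintype Ω] [Fintype α] [Fintype β] [Fintype υ]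
    {p : Ω → ℝ} (hp : p ∈ stdSimplex ℝ Ω) {U : Ω → υ} {A : Ω → α} {B : Ω → β}
    (h : IsMarkov p U A B) :
    (law p A, ent p A - mutualInfo p U A, ent p B - mutualInfo p U B)
      ∈ entHull (condLaw p A B) := by
  have hm := sum_mem_entHull (condLaw p A B)
    (m := fun u a => law p (fun ω => (U ω, A ω)) (u, a)) (fun u a => law_nonneg hp.1 _ _) (by
      rw [← Fintype.sum_prod_type' (f := fun u a => law p (fun ω => (U ω, A ω)) (u, a))]
      exact (sum_law p _).trans hp.2)
  have hout : ∀ u, output (condLaw p A B) (fun a => law p (fun ω => (U ω, A ω)) (u, a))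
      = fun b => law p (fun ω => (U ω, B ω)) (u, b) := by
    intro u
    ext b
    have h1 := sum_law_pair p (fun ω => (U ω, B ω)) A (u, b)
    rw [← h1, output]
    refine Finset.sum_congr rfl fun a _ => ?_
    have h2 : law p (fun ω => ((U ω, B ω), A ω)) ((u, b), a)
        = law p (fun ω => (U ω, A ω, B ω)) (u, a, b) := law_congr fun ω => by
      simp only [Prod.mk.injEq]; tauto
    rw [h2, condLaw]
    by_cases h0 : law p A a = 0
    · have h3 : law p (fun ω => (U ω, A ω, B ω)) (u, a, b) ≤ law p A a :=
        law_le_law hp.1 fun ω h => by simp only [Prod.mk.injEq] at h; exact h.2.1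
      rw [h0] at h3
      rw [le_antisymm h3 (law_nonneg hp.1 _ _), h0, div_zero, mul_zero]
    · rw [← mul_div_assoc, ← h u a b]; field_simp
  simp only [hout, sum_massEnt_law, sum_law_pair'] at hm
  rw [mutualInfo_eq hp.1, mutualInfo_eq hp.1]
  convert hm using 3 <;> ring

lemma IsTest.mem_entHull (hQ : IsTest P Q) :
    (law P (fun ω => ω.1), massEnt (law P fun ω => ω.1) - infoUX Q,
        massEnt (law P fun ω => ω.2.1) - infoUY Q) ∈ entHull (kerXY P) ∧
      (law P (fun ω => ω.2.1), massEnt (law P fun ω => ω.2.1) - infoVY Q,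
        massEnt (law P fun ω => ω.2.2) - infoVZ Q) ∈ entHull (kerYZ P) := by
  have h1 := mem_entHull_of_isMarkov hQ.mem_simplex hQ.markov_UXY
  have h2 := mem_entHull_of_isMarkov hQ.mem_simplex hQ.markov_VYZ
  have lX : law Q (fun w => w.1) = law P fun ω => ω.1 := funext (hQ.law_source fun ω => ω.1)
  have lY : law Q (fun w => w.2.1) = law P fun ω => ω.2.1 := funext (hQ.law_source fun ω => ω.2.1)
  have eX : ent Q (fun w => w.1) = massEnt (law P fun ω => ω.1) := hQ.ent_source fun ω => ω.1
  have eY : ent Q (fun w => w.2.1) = massEnt (law P fun ω => ω.2.1) := hQ.ent_source fun ω => ω.2.1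
  have eZ : ent Q (fun w => w.2.2.1) = massEnt (law P fun ω => ω.2.2) :=
    hQ.ent_source fun ω => ω.2.2
  have kXY : condLaw Q (fun w => w.1) (fun w => w.2.1) = kerXY P := by
    ext a b
    rw [condLaw, lX, hQ.law_source fun ω => (ω.1, ω.2.1)]; rfl
  have kYZ : condLaw Q (fun w => w.2.1) (fun w => w.2.2.1) = kerYZ P := by
    ext a b
    rw [condLaw, lY, hQ.law_source fun ω => (ω.2.1, ω.2.2)]; rfl
  rw [lX, eX, eY, kXY] at h1
  rw [lY, eY, eZ, kYZ] at h2
  exact ⟨h1, h2⟩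

/-- The two hops can be combined: points of the two hulls over the source marginals come from one
test distribution, in which `U` and `V` are conditionally independent given the source. -/
lemma exists_isTest (hP : P ∈ stdSimplex ℝ (X × Y × Z)) {s t s' t' : ℝ}
    (h : (law P (fun ω => ω.1), s, t) ∈ entHull (kerXY P))
    (h' : (law P (fun ω => ω.2.1), s', t') ∈ entHull (kerYZ P)) :
    ∃ (k l : ℕ) (Q : X × Y × Z × Fin k × Fin l → ℝ), IsTest P Q ∧
      infoUX Q = massEnt (law P fun ω => ω.1) - s ∧
      infoUY Q = massEnt (law P fun ω => ω.2.1) - t ∧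
      infoVY Q = massEnt (law P fun ω => ω.2.1) - s' ∧
      infoVZ Q = massEnt (law P fun ω => ω.2.2) - t' := by
  classical
  obtain ⟨k, m, hm0, hm, hms, hmt⟩ := exists_of_mem_entHull h
  obtain ⟨l, m', hm0', hm', hms', hmt'⟩ := exists_of_mem_entHull h'
  dsimp only at hm hms hmt hm' hms' hmt'
  set π := law P (fun ω => ω.1) with hπ
  set ρ := law P (fun ω => ω.2.1) with hρ
  have hπ0 : ∀ x, 0 ≤ π x := fun x => law_nonneg hP.1 _ _
  have hρ0 : ∀ y, 0 ≤ ρ y := fun y => law_nonneg hP.1 _ _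
  have hmle : ∀ u x, m u x ≤ π x := fun u x => by
    rw [← congrFun hm x]
    exact Finset.single_le_sum (f := fun i => m i x) (fun i _ => hm0 i x) (Finset.mem_univ u)
  have hmle' : ∀ v y, m' v y ≤ ρ y := fun v y => by
    rw [← congrFun hm' y]
    exact Finset.single_le_sum (f := fun i => m' i y) (fun i _ => hm0' i y) (Finset.mem_univ v)
  set κ : Fin k → X → ℝ := fun u x => m u x / π x with hκ
  set κ' : Fin l → Y → ℝ := fun v y => m' v y / ρ y with hκ'
  have hκ1 : ∀ x y z, P (x, y, z) * ∑ u, κ u x = P (x, y, z) := by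
    intro x y z
    rcases (hP.1 (x, y, z)).eq_or_lt with h0 | h0
    · rw [← h0, zero_mul]
    · have : 0 < π x := h0.trans_le (le_law hP.1 (fun ω => ω.1) (x, y, z))
      simp only [hκ]
      rw [← Finset.sum_div, congrFun hm x, div_self this.ne', mul_one]
  have hκ1' : ∀ x y z, P (x, y, z) * ∑ v, κ' v y = P (x, y, z) := by
    intro x y z
    rcases (hP.1 (x, y, z)).eq_or_lt with h0 | h0
    · rw [← h0, zero_mul]
    · have : 0 < ρ y := h0.trans_le (le_law hP.1 (fun ω => ω.2.1) (x, y, z))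
      simp only [hκ']
      rw [← Finset.sum_div, congrFun hm' y, div_self this.ne', mul_one]
  set Q : X × Y × Z × Fin k × Fin l → ℝ :=
    fun w => P (w.1, w.2.1, w.2.2.1) * κ w.2.2.2.1 w.1 * κ' w.2.2.2.2 w.2.1 with hQ
  have hQ0 : ∀ w, 0 ≤ Q w := fun w => mul_nonneg (mul_nonneg (hP.1 _)
    (div_nonneg (hm0 _ _) (hπ0 _))) (div_nonneg (hm0' _ _) (hρ0 _))
  -- Expectations under `Q` of functions of the source and of one auxiliary variable.
  have hU : ∀ g : X × Y × Z → Fin k → ℝ, ∑ w, Q w * g (w.1, w.2.1, w.2.2.1) w.2.2.2.1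
      = ∑ ω, ∑ u, P ω * κ u ω.1 * g ω u := by
    intro g
    simp only [Fintype.sum_prod_type]
    refine Finset.sum_congr rfl fun x _ => Finset.sum_congr rfl fun y _ =>
      Finset.sum_congr rfl fun z _ => Finset.sum_congr rfl fun u _ => ?_
    have : ∀ v, P (x, y, z) * κ u x * κ' v y * g (x, y, z) u
        = (κ u x * g (x, y, z) u) * (P (x, y, z) * κ' v y) := fun v => by ring
    simp only [hQ, this]
    rw [← Finset.mul_sum, ← Finset.mul_sum, hκ1']
    ring
  have hV : ∀ g : X × Y × Z → Fin l → ℝ, ∑ w, Q w * g (w.1, w.2.1, w.2.2.1) w.2.2.2.2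
      = ∑ ω, ∑ v, P ω * κ' v ω.2.1 * g ω v := by
    intro g
    simp only [Fintype.sum_prod_type]
    refine Finset.sum_congr rfl fun x _ => Finset.sum_congr rfl fun y _ =>
      Finset.sum_congr rfl fun z _ => ?_
    rw [Finset.sum_comm]
    refine Finset.sum_congr rfl fun v _ => ?_
    have : ∀ u, P (x, y, z) * κ u x * κ' v y * g (x, y, z) v
        = (κ' v y * g (x, y, z) v) * (P (x, y, z) * κ u x) := fun v => by ring
    simp only [hQ, this]
    rw [← Finset.mul_sum, ← Finset.mul_sum, hκ1]
    ring
  have hmarg : ∀ ω, law Q (fun w => (w.1, w.2.1, w.2.2.1)) ω = P ω := by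
    intro ω
    simp only [law]
    have h1 := hU fun ω' _ => if ω' = ω then 1 else 0
    simp only [mul_ite, mul_one, mul_zero] at h1
    refine (Finset.sum_congr rfl fun w _ => by congr).trans (h1.trans ?_)
    simp only [← Finset.mul_sum, Finset.sum_ite_irrel, Finset.sum_const_zero]
    simpa using hκ1 ω.1 ω.2.1 ω.2.2
  have lUXY : ∀ u x y, law Q (fun w => (w.2.2.2.1, w.1, w.2.1)) (u, x, y)
      = κ u x * law P (fun ω => (ω.1, ω.2.1)) (x, y) := by
    intro u x y
    have h1 := hU fun ω' u' => if (u', ω'.1, ω'.2.1) = (u, x, y) then 1 else 0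
    simp only [mul_ite, mul_one, mul_zero] at h1
    simp only [law, Finset.mul_sum]
    refine (Finset.sum_congr rfl fun w _ => by congr).trans (h1.trans ?_)
    refine Finset.sum_congr rfl fun ω _ => ?_
    rw [Finset.sum_eq_single u]
    · by_cases h2 : (ω.1, ω.2.1) = (x, y)
      · obtain ⟨h3, h4⟩ := Prod.mk.inj h2
        simp [h3, h4, mul_comm]
      · have : ¬ ((u, ω.1, ω.2.1) = (u, x, y)) := fun h3 => h2 (Prod.mk.inj h3).2
        simp [h2, this]
    · intro u' _ hu'
      simp [hu']
    · simp
  have lVYZ : ∀ v y z, law Q (fun w => (w.2.2.2.2, w.2.1, w.2.2.1)) (v, y, z)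
      = κ' v y * law P (fun ω => (ω.2.1, ω.2.2)) (y, z) := by
    intro v y z
    have h1 := hV fun ω' v' => if (v', ω'.2.1, ω'.2.2) = (v, y, z) then 1 else 0
    simp only [mul_ite, mul_one, mul_zero] at h1
    simp only [law, Finset.mul_sum]
    refine (Finset.sum_congr rfl fun w _ => by congr).trans (h1.trans ?_)
    refine Finset.sum_congr rfl fun ω _ => ?_
    rw [Finset.sum_eq_single v]
    · by_cases h2 : (ω.2.1, ω.2.2) = (y, z)
      · obtain ⟨h3, h4⟩ := Prod.mk.inj h2
        simp [h3, h4, mul_comm]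
      · have : ¬ ((v, ω.2.1, ω.2.2) = (v, y, z)) := fun h3 => h2 (Prod.mk.inj h3).2
        simp [h2, this]
    · intro v' _ hv'
      simp [hv']
    · simp
  have hκπ : ∀ u x, κ u x * π x = m u x := by
    intro u x
    rcases (hπ0 x).eq_or_lt with h0 | h0
    · rw [← h0, mul_zero]
      exact le_antisymm (hm0 u x) ((hmle u x).trans h0.symm.le)
    · exact div_mul_cancel₀ _ h0.ne'
  have hκρ : ∀ v y, κ' v y * ρ y = m' v y := by
    intro v y
    rcases (hρ0 y).eq_or_lt with h0 | h0
    · rw [← h0, mul_zero]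
      exact le_antisymm (hm0' v y) ((hmle' v y).trans h0.symm.le)
    · exact div_mul_cancel₀ _ h0.ne'
  have lUX : ∀ u x, law Q (fun w => (w.2.2.2.1, w.1)) (u, x) = m u x := by
    intro u x
    rw [← sum_law_pair Q (fun w => (w.2.2.2.1, w.1)) (fun w => w.2.1) (u, x)]
    have h1 : ∀ y, law Q (fun w => ((w.2.2.2.1, w.1), w.2.1)) ((u, x), y)
        = κ u x * law P (fun ω => (ω.1, ω.2.1)) (x, y) := fun y => by
      rw [← lUXY]; exact law_congr fun ω => by simp only [Prod.mk.injEq]; tauto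
    rw [Finset.sum_congr rfl fun y _ => h1 y, ← Finset.mul_sum, sum_law_pair]
    exact hκπ u x
  have lVY : ∀ v y, law Q (fun w => (w.2.2.2.2, w.2.1)) (v, y) = m' v y := by
    intro v y
    rw [← sum_law_pair Q (fun w => (w.2.2.2.2, w.2.1)) (fun w => w.2.2.1) (v, y)]
    have h1 : ∀ z, law Q (fun w => ((w.2.2.2.2, w.2.1), w.2.2.1)) ((v, y), z)
        = κ' v y * law P (fun ω => (ω.2.1, ω.2.2)) (y, z) := fun z => by
      rw [← lVYZ]; exact law_congr fun ω => by simp only [Prod.mk.injEq]; tauto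
    rw [Finset.sum_congr rfl fun y _ => h1 y, ← Finset.mul_sum, sum_law_pair]
    exact hκρ v y
  have hT : IsTest P Q := by
    refine ⟨⟨hQ0, ?_⟩, fun x y z => hmarg _, ?_, ?_⟩
    · rw [← sum_law Q (fun w => (w.1, w.2.1, w.2.2.1)), Finset.sum_congr rfl fun ω _ => hmarg ω,
        hP.2]
    · intro u x y
      rw [lUXY, lUX, law_of_marginal hmarg fun ω => ω.1,
        law_of_marginal hmarg fun ω => (ω.1, ω.2.1), ← hκπ]
      ring
    · intro v y z
      rw [lVYZ, lVY, law_of_marginal hmarg fun ω => ω.2.1,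
        law_of_marginal hmarg fun ω => (ω.2.1, ω.2.2), ← hκρ]
      ring
  have lUY : ∀ u y, law Q (fun w => (w.2.2.2.1, w.2.1)) (u, y) = output (kerXY P) (m u) y := by
    intro u y
    rw [← sum_law_pair Q (fun w => (w.2.2.2.1, w.2.1)) (fun w => w.1) (u, y), output]
    refine Finset.sum_congr rfl fun x _ => ?_
    have h1 : law Q (fun w => ((w.2.2.2.1, w.2.1), w.1)) ((u, y), x)
        = law Q (fun w => (w.2.2.2.1, w.1, w.2.1)) (u, x, y) :=
      law_congr fun ω => by simp only [Prod.mk.injEq]; tauto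
    rw [h1, lUXY, ← hκπ, mul_assoc]
    congr 1
    exact (law_mul_condLaw hP.1 (fun ω => ω.1) (fun ω => ω.2.1) x y).symm
  have lVZ : ∀ v z, law Q (fun w => (w.2.2.2.2, w.2.2.1)) (v, z) = output (kerYZ P) (m' v) z := by
    intro v z
    rw [← sum_law_pair Q (fun w => (w.2.2.2.2, w.2.2.1)) (fun w => w.2.1) (v, z), output]
    refine Finset.sum_congr rfl fun y _ => ?_
    have h1 : law Q (fun w => ((w.2.2.2.2, w.2.2.1), w.2.1)) ((v, z), y)
        = law Q (fun w => (w.2.2.2.2, w.2.1, w.2.2.1)) (v, y, z) :=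
      law_congr fun ω => by simp only [Prod.mk.injEq]; tauto
    rw [h1, lVYZ, ← hκρ, mul_assoc]
    congr 1
    exact (law_mul_condLaw hP.1 (fun ω => ω.2.1) (fun ω => ω.2.2) y z).symm
  have eX : ent Q (fun w => w.1) = massEnt π := hT.ent_source fun ω => ω.1
  have eY : ent Q (fun w => w.2.1) = massEnt ρ := hT.ent_source fun ω => ω.2.1
  have eZ : ent Q (fun w => w.2.2.1) = massEnt (law P fun ω => ω.2.2) :=
    hT.ent_source fun ω => ω.2.2
  refine ⟨k, l, Q, hT, ?_, ?_, ?_, ?_⟩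
  · have := sum_massEnt_law (p := Q) (fun w => w.2.2.2.1) (fun w => w.1)
    simp only [lUX] at this
    rw [infoUX, mutualInfo_eq hQ0, eX]
    linarith
  · have := sum_massEnt_law (p := Q) (fun w => w.2.2.2.1) (fun w => w.2.1)
    simp only [lUY] at this
    rw [infoUY, mutualInfo_eq hQ0, eY]
    linarith
  · have := sum_massEnt_law (p := Q) (fun w => w.2.2.2.2) (fun w => w.2.1)
    simp only [lVY] at this
    rw [infoVY, mutualInfo_eq hQ0, eY]
    linarith
  · have := sum_massEnt_law (p := Q) (fun w => w.2.2.2.2) (fun w => w.2.2.1)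
    simp only [lVZ] at this
    rw [infoVZ, mutualInfo_eq hQ0, eZ]
    linarith

/-- The region `𝓡*` is closed: by compactness of the entropy hulls, no cardinality bound on the
auxiliary alphabets is needed. -/
lemma isClosed_regionStar (hP : P ∈ stdSimplex ℝ (X × Y × Z)) : IsClosed (regionStar P) := by
  set K := entHull (kerXY P) ×ˢ entHull (kerYZ P) with hK
  have hKc : IsCompact K := (isCompact_entHull _).prod (isCompact_entHull _)
  have : CompactSpace K := isCompact_iff_compactSpace.1 hKc
  set hx := massEnt (law P fun ω => ω.1)
  set hy := massEnt (law P fun ω => ω.2.1)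
  set hz := massEnt (law P fun ω => ω.2.2)
  have hcl : IsClosed {w : K × (ℝ × ℝ × ℝ × ℝ) | w.1.1.1.1 = (law P fun ω => ω.1) ∧
      w.1.1.2.1 = (law P fun ω => ω.2.1) ∧ hx - w.1.1.1.2.1 ≤ w.2.1 ∧ hy - w.1.1.2.2.1 ≤ w.2.2.1 ∧
      w.2.2.2.1 ≤ hy - w.1.1.1.2.2 ∧ w.2.2.2.2 ≤ hy - w.1.1.1.2.2 + (hz - w.1.1.2.2.2)} := by
    simp only [Set.ofPred_and]
    refine (isClosed_eq (by fun_prop) (by fun_prop)).inter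
      ((isClosed_eq (by fun_prop) (by fun_prop)).inter
      ((isClosed_le (by fun_prop) (by fun_prop)).inter
      ((isClosed_le (by fun_prop) (by fun_prop)).inter
      ((isClosed_le (by fun_prop) (by fun_prop)).inter
      (isClosed_le (by fun_prop) (by fun_prop))))))
  convert isClosedMap_snd_of_compactSpace _ hcl using 1
  ext T
  constructor
  · rintro ⟨k, l, Q, hQ, h1, h2, h3, h4⟩
    obtain ⟨hU, hV⟩ := hQ.mem_entHull
    refine ⟨(⟨(_, _), hU, hV⟩, T), ⟨rfl, rfl, ?_, ?_, ?_, ?_⟩, rfl⟩ <;> simpa [hx, hy, hz]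
  · rintro ⟨⟨⟨⟨⟨π, s, t⟩, ⟨ρ, s', t'⟩⟩, h, h'⟩, T⟩, ⟨h1, h2, h3, h4, h5, h6⟩, rfl⟩
    dsimp only at h h' h1 h2 h3 h4 h5 h6
    subst h1 h2
    obtain ⟨k, l, Q, hQ, e1, e2, e3, e4⟩ := exists_isTest hP h h'
    exact ⟨k, l, Q, hQ, by rwa [e1], by rwa [e3], by rwa [e2], by rwa [e2, e4]⟩

end Tests

/-! ### The remainder term and the converse inclusion -/

section Bounds

variable {X Y Z : Type*} [Fintype X] [Fintype Y] [Fintype Z] {P : X × Y × Z → ℝ}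

/-- The strong converse for one code: up to `O(1 / √n)`, the rates and exponents of a code whose
type-I error probabilities add up to at most `1 - δ` are dominated by a test distribution. -/
theorem Code.exists_isTest (hP : IsSource P) {δ : ℝ} (hδ : 0 < δ) (hδ1 : δ ≤ 1) :
    ∃ K, 0 ≤ K ∧ ∀ (n N₁ N₂ : ℕ), 0 < n → ∀ C : Code X Y Z n N₁ N₂,
      C.beta1 P + C.eta1 P ≤ 1 - δ → 0 < C.beta2 P ∧ 0 < C.eta2 P ∧
      ∃ (k l : ℕ) (Q : X × Y × Z × Fin k × Fin l → ℝ), IsTest P Q ∧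
        infoUX Q ≤ 1 / n * Real.log N₁ + K / √n ∧
        infoVY Q ≤ 1 / n * Real.log N₂ + K / √n ∧
        -(1 / n) * Real.log (C.beta2 P) ≤ infoUY Q + K / √n ∧
        -(1 / n) * Real.log (C.eta2 P) ≤ infoUY Q + infoVZ Q + K / √n := by
  obtain ⟨K, hK0, hK⟩ := Code.exists_mem_entHull hP hδ hδ1
  refine ⟨K, hK0, fun n N₁ N₂ hn C hC => ?_⟩
  obtain ⟨hβ, hη, s, t, s', t', h, h', h1, h2, h3, h4⟩ := hK n N₁ N₂ hn C hC
  obtain ⟨k, l, Q, hQ, e1, e2, e3, e4⟩ := TwoHop.exists_isTest hP.mem_simplex h h'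
  exact ⟨hβ, hη, k, l, Q, hQ, by rwa [e1], by rwa [e3], by rwa [e2], by rwa [e2, e4]⟩

lemma minWeightedInfo_le {b c d : ℝ} (hb : 0 ≤ b) (hc : 0 ≤ c) (hd : 0 ≤ d) {k l : ℕ}
    {Q : X × Y × Z × Fin k × Fin l → ℝ} (hQ : IsTest P Q) :
    minWeightedInfo P b c d ≤ weightedInfo b c d Q := by
  refine csInf_le ⟨-(1 + c) * Real.log (Fintype.card Y) - c * Real.log (Fintype.card Z), ?_⟩
    ⟨k, l, Q, hQ, rfl⟩
  rintro _ ⟨k, l, Q, hQ, rfl⟩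
  have h1 : infoUY Q ≤ Real.log (Fintype.card Y) := mutualInfo_le_log_card hQ.mem_simplex _ _
  have h2 : infoVZ Q ≤ Real.log (Fintype.card Z) := mutualInfo_le_log_card hQ.mem_simplex _ _
  have h3 : 0 ≤ b * infoUX Q := mul_nonneg hb (mutualInfo_nonneg hQ.mem_simplex _ _)
  have h4 : 0 ≤ d * infoVY Q := mul_nonneg hd (mutualInfo_nonneg hQ.mem_simplex _ _)
  have h5 := mul_le_mul_of_nonneg_left h1 hc
  have h6 := mul_le_mul_of_nonneg_left h2 hc
  rw [weightedInfo]
  linarith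

lemma sqrt_le_rpow_mul_log {n : ℕ} (hn : 1 ≤ n) :
    √(n : ℝ) ≤ 2 * ((n : ℝ) ^ (3 / 4 : ℝ) * Real.log n + 1) := by
  rcases hn.eq_or_lt with rfl | h
  · norm_num
  · have h2 : (2 : ℝ) ≤ n := by exact_mod_cast h
    have h3 : (1 : ℝ) / 2 ≤ Real.log n :=
      le_trans (by linarith [Real.log_two_gt_d9]) (Real.log_le_log (by norm_num) h2)
    have h4 : √(n : ℝ) ≤ (n : ℝ) ^ (3 / 4 : ℝ) := by
      rw [Real.sqrt_eq_rpow]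
      exact Real.rpow_le_rpow_of_exponent_le (by linarith) (by norm_num)
    have h5 : 0 ≤ (n : ℝ) ^ (3 / 4 : ℝ) := by positivity
    nlinarith

lemma isTheta_remainder {K : ℝ} (hK : 0 < K) :
    (fun n : ℕ => -(K * ((n : ℝ) ^ (3 / 4 : ℝ) * Real.log n + 1)))
      =Θ[atTop] (fun n : ℕ => (n : ℝ) ^ (3 / 4 : ℝ) * Real.log n) := by
  have hev : ∀ᶠ n : ℕ in atTop, (1 : ℝ) ≤ (n : ℝ) ^ (3 / 4 : ℝ) * Real.log n := by
    filter_upwards [eventually_ge_atTop 3] with n hn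
    have h3 : (3 : ℝ) ≤ n := by exact_mod_cast hn
    have h1 : 1 ≤ Real.log n := by
      rw [Real.le_log_iff_exp_le (by linarith)]
      linarith [Real.exp_one_lt_d9]
    have h2 : 1 ≤ (n : ℝ) ^ (3 / 4 : ℝ) := Real.one_le_rpow (by linarith) (by norm_num)
    nlinarith
  constructor
  · refine IsBigO.of_bound (2 * K) ?_
    filter_upwards [hev] with n hn
    rw [norm_neg, Real.norm_of_nonneg (by positivity), Real.norm_of_nonneg (by linarith)]
    nlinarith
  · refine IsBigO.of_bound (1 / K) ?_
    filter_upwards [hev] with n hn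
    rw [norm_neg, Real.norm_of_nonneg (by linarith), Real.norm_of_nonneg (by positivity)]
    field_simp
    linarith

/-- The non-asymptotic strong converse. The loss is of order `√n` only; the remainder is enlarged to
the order `n ^ (3 / 4) log n`, and the summand `1` in it serves `n = 1`, where the logarithm
vanishes. -/
theorem exists_remainder (hP : IsSource P) {ε₁ ε₂ : ℝ} (hε₁ : 0 < ε₁) (hε₂ : 0 < ε₂)
    (hε : ε₁ + ε₂ < 1) {b c d : ℝ} (hb : 0 ≤ b) (hc : 0 ≤ c) (hd : 0 ≤ d) :
    ∃ r : ℕ → ℝ, r =Θ[atTop] (fun n : ℕ => (n : ℝ) ^ (3 / 4 : ℝ) * Real.log n) ∧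
      ∀ (n N₁ N₂ : ℕ), 1 ≤ n → ∀ C : Code X Y Z n N₁ N₂,
        C.beta1 P ≤ ε₁ → C.eta1 P ≤ ε₂ →
          0 < C.beta2 P ∧ 0 < C.eta2 P ∧
          n * minWeightedInfo P b c d + r n ≤
            Real.log (C.beta2 P) + b * Real.log N₁ + c * Real.log (C.eta2 P)
              + d * Real.log N₂ := by
  obtain ⟨K, hK0, hK⟩ := Code.exists_isTest hP (δ := 1 - ε₁ - ε₂) (by linarith) (by linarith)
  refine ⟨_, isTheta_remainder (K := 2 * (1 + b + c + d) * (K + 1)) (by positivity), ?_⟩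
  intro n N₁ N₂ hn C h1 h2
  obtain ⟨hβ, hη, k, l, Q, hQ, e1, e2, e3, e4⟩ := hK n N₁ N₂ hn C (by linarith)
  refine ⟨hβ, hη, ?_⟩
  have hn' : (0 : ℝ) < n := by exact_mod_cast hn
  have hmin := mul_le_mul_of_nonneg_left (minWeightedInfo_le hb hc hd hQ) hn'.le
  have hKn : n * (K / √n) = K * √n := by
    rw [mul_comm, div_mul_eq_mul_div, mul_div_assoc, Real.div_sqrt]
  have hscale : ∀ {a b' : ℝ}, 1 / n * a ≤ b' → a ≤ n * b' := by
    intro a b' h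
    have := mul_le_mul_of_nonneg_left h hn'.le
    rwa [← mul_assoc, mul_one_div_cancel hn'.ne', one_mul] at this
  have e1' : n * infoUX Q ≤ Real.log N₁ + K * √n := by
    have := mul_le_mul_of_nonneg_left e1 hn'.le
    rwa [mul_add, ← mul_assoc, mul_one_div_cancel hn'.ne', one_mul, hKn] at this
  have e2' : n * infoVY Q ≤ Real.log N₂ + K * √n := by
    have := mul_le_mul_of_nonneg_left e2 hn'.le
    rwa [mul_add, ← mul_assoc, mul_one_div_cancel hn'.ne', one_mul, hKn] at this
  have e3' : -Real.log (C.beta2 P) ≤ n * infoUY Q + K * √n := by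
    have := hscale (a := -Real.log (C.beta2 P)) (b' := infoUY Q + K / √n)
      (by rwa [mul_neg, ← neg_mul])
    rwa [mul_add, hKn] at this
  have e4' : -Real.log (C.eta2 P) ≤ n * (infoUY Q + infoVZ Q) + K * √n := by
    have := hscale (a := -Real.log (C.eta2 P)) (b' := (infoUY Q + infoVZ Q) + K / √n)
      (by rwa [mul_neg, ← neg_mul])
    rwa [mul_add, hKn] at this
  have f1 := mul_le_mul_of_nonneg_left e1' hb
  have f2 := mul_le_mul_of_nonneg_left e2' hd
  have f4 := mul_le_mul_of_nonneg_left e4' hc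
  have hsq := sqrt_le_rpow_mul_log hn
  have hfin : (1 + b + c + d) * K * √n
      ≤ 2 * (1 + b + c + d) * (K + 1) * ((n : ℝ) ^ (3 / 4 : ℝ) * Real.log n + 1) := by
    calc (1 + b + c + d) * K * √n ≤ (1 + b + c + d) * (K + 1) * √n := by
          gcongr; linarith
      _ ≤ (1 + b + c + d) * (K + 1) * (2 * ((n : ℝ) ^ (3 / 4 : ℝ) * Real.log n + 1)) := by
          gcongr
      _ = _ := by ring
  rw [weightedInfo] at hmin
  linarith

lemma tendsto_relaxed (T : ℝ × ℝ × ℝ × ℝ) :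
    Tendsto (fun e : ℝ => (T.1 + e, T.2.1 + e, T.2.2.1 - e, T.2.2.2 - e)) (𝓝[>] 0) (𝓝 T) := by
  have hc : Continuous fun e : ℝ => (T.1 + e, T.2.1 + e, T.2.2.1 - e, T.2.2.2 - e) := by fun_prop
  have := (hc.tendsto 0).mono_left (nhdsWithin_le_nhds (s := Set.Ioi 0))
  simpa using this

/-- The test distributions dominating the codes of an achieving sequence show that every relaxation
of `T` lies in `𝓡*`, which is closed. -/
lemma IsAchievable.mem_regionStar (hP : IsSource P) {ε₁ ε₂ : ℝ} (hε₁ : 0 < ε₁) (hε₂ : 0 < ε₂)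
    (hε : ε₁ + ε₂ < 1) {T : ℝ × ℝ × ℝ × ℝ} (hT : IsAchievable P ε₁ ε₂ T) : T ∈ regionStar P := by
  obtain ⟨N₁, N₂, C, hR₁, hR₂, hβ₁, hη₁, hE₁, hE₂⟩ := hT
  set δ := (1 - ε₁ - ε₂) / 2 with hδ
  obtain ⟨K, hK0, hK⟩ := Code.exists_isTest hP (δ := δ) (by linarith) (by linarith)
  have hup : ∀ {u : ℕ → ℝ} {a b : ℝ}, limsup (fun n => (u n : EReal)) atTop ≤ a → a < b →
      ∀ᶠ n in atTop, u n < b := by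
    intro u a b h hab
    filter_upwards [eventually_lt_of_limsup_lt (h.trans_lt (EReal.coe_lt_coe_iff.2 hab))] with n hn
    exact EReal.coe_lt_coe_iff.1 hn
  have hlow : ∀ {u : ℕ → ℝ} {a b : ℝ}, a ≤ liminf (fun n => (u n : EReal)) atTop → b < a →
      ∀ᶠ n in atTop, b < u n := by
    intro u a b h hab
    filter_upwards [eventually_lt_of_lt_liminf ((EReal.coe_lt_coe_iff.2 hab).trans_le h)] with n hn
    exact EReal.coe_lt_coe_iff.1 hn
  have hKlim : Tendsto (fun n : ℕ => K / √(n : ℝ)) atTop (𝓝 0) :=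
    tendsto_const_nhds.div_atTop
      (Real.tendsto_sqrt_atTop.comp tendsto_natCast_atTop_atTop)
  have key : ∀ e : ℝ, 0 < e → (T.1 + e, T.2.1 + e, T.2.2.1 - e, T.2.2.2 - e) ∈ regionStar P := by
    intro e he
    have h := (hup hR₁ (b := T.1 + e / 2) (by linarith)).and
      ((hup hR₂ (b := T.2.1 + e / 2) (by linarith)).and
      ((hup hβ₁ (b := ε₁ + δ / 2) (by linarith)).and
      ((hup hη₁ (b := ε₂ + δ / 2) (by linarith)).and
      ((hlow hE₁ (b := T.2.2.1 - e / 2) (by linarith)).and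
      ((hlow hE₂ (b := T.2.2.2 - e / 2) (by linarith)).and
      ((hKlim.eventually_lt_const (show (0 : ℝ) < e / 2 by linarith)).and
        (eventually_gt_atTop 0)))))))
    obtain ⟨n, h1, h2, h3, h4, h5, h6, h7, hn⟩ := h.exists
    obtain ⟨-, -, k, l, Q, hQ, e1, e2, e3, e4⟩ := hK n _ _ hn (C n) (by linarith)
    exact ⟨k, l, Q, hQ, by dsimp only; linarith, by dsimp only; linarith,
      by dsimp only; linarith, by dsimp only; linarith⟩
  refine (isClosed_regionStar hP.mem_simplex).mem_of_tendsto (tendsto_relaxed T) ?_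
  filter_upwards [self_mem_nhdsWithin] with e he using key e he

theorem region_subset_regionStar (hP : IsSource P) {ε₁ ε₂ : ℝ} (hε₁ : 0 < ε₁) (hε₂ : 0 < ε₂)
    (hε : ε₁ + ε₂ < 1) : region P ε₁ ε₂ ⊆ regionStar P :=
  closure_minimal (fun _ hT => hT.mem_regionStar hP hε₁ hε₂ hε) (isClosed_regionStar hP.mem_simplex)

end Bounds

/-! ### Large deviations and covering -/

section Covering

variable {Ω α β υ : Type*} [Fintype Ω]

open Classical in
/-- Chernoff's bound, in the form of a weak law of large numbers. -/
lemma eventually_sum_iid_le {q : Ω → ℝ} (hq : q ∈ stdSimplex ℝ Ω) (f : Ω → ℝ) {δ θ : ℝ}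
    (hδ : 0 < δ) (hθ : 0 < θ) :
    ∀ᶠ n : ℕ in atTop, (∑ ω : Fin n → Ω,
      if n * (∑ v, q v * f v + δ) ≤ ∑ i, f (ω i) then iid n q ω else 0) ≤ θ := by
  set μ := ∑ v, q v * f v with hμ
  set g : Ω → ℝ := fun v => f v - μ with hg
  have hg0 : ∑ v, q v * g v = 0 := by
    simp only [hg, mul_sub, Finset.sum_sub_distrib, ← Finset.sum_mul, hq.2]
    linarith
  set B : ℝ := ∑ v, |g v| + 1 with hB
  have hB1 : 0 < B := by positivity
  have hgB : ∀ v, |g v| ≤ B := fun v => by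
    have := Finset.single_le_sum (f := fun v => |g v|) (fun v _ => abs_nonneg _)
      (Finset.mem_univ v)
    linarith
  set s := min (1 / B) (δ / (2 * B ^ 2)) with hs
  have hs0 : 0 < s := lt_min (by positivity) (by positivity)
  have hsB : s * B ≤ 1 := by
    calc s * B ≤ 1 / B * B := mul_le_mul_of_nonneg_right (min_le_left _ _) hB1.le
      _ = 1 := by field_simp
  have hsδ : s * B ^ 2 ≤ δ / 2 := by
    calc s * B ^ 2 ≤ δ / (2 * B ^ 2) * B ^ 2 :=
          mul_le_mul_of_nonneg_right (min_le_right _ _) (by positivity)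
      _ = δ / 2 := by field_simp
  have hmgf : ∑ v, q v * Real.exp (s * g v) ≤ Real.exp (s * (δ / 2)) := by
    have h1 : ∀ v, q v * Real.exp (s * g v) ≤ q v * (1 + (s * B) ^ 2) + s * (q v * g v) := by
      intro v
      have h2 : |s * g v| ≤ s * B := by
        rw [abs_mul, abs_of_pos hs0]
        exact mul_le_mul_of_nonneg_left (hgB v) hs0.le
      have h3 := (abs_le.1 (Real.abs_exp_sub_one_sub_id_le (h2.trans hsB))).2
      have h4 : (s * g v) ^ 2 ≤ (s * B) ^ 2 := sq_le_sq' (by linarith [(abs_le.1 h2).1])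
        (abs_le.1 h2).2
      have := mul_le_mul_of_nonneg_left (show Real.exp (s * g v) ≤ 1 + (s * B) ^ 2 + s * g v by
        linarith) (hq.1 v)
      linarith
    calc ∑ v, q v * Real.exp (s * g v)
        ≤ ∑ v, (q v * (1 + (s * B) ^ 2) + s * (q v * g v)) := Finset.sum_le_sum fun v _ => h1 v
      _ = 1 + (s * B) ^ 2 := by
          rw [Finset.sum_add_distrib, ← Finset.sum_mul, ← Finset.mul_sum, hg0, hq.2]; ring
      _ ≤ 1 + s * (δ / 2) := by nlinarith
      _ ≤ _ := by linarith [Real.add_one_le_exp (s * (δ / 2))]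
  have hbound : ∀ n : ℕ, (∑ ω : Fin n → Ω,
      if n * (μ + δ) ≤ ∑ i, f (ω i) then iid n q ω else 0) ≤ Real.exp (-(s * (δ / 2))) ^ n := by
    intro n
    calc _ ≤ ∑ ω : Fin n → Ω,
            Real.exp (-(s * δ)) ^ n * ∏ i, (q (ω i) * Real.exp (s * g (ω i))) := by
          refine Finset.sum_le_sum fun ω _ => ?_
          have hnn : 0 ≤ iid n q ω := Finset.prod_nonneg fun i _ => hq.1 _
          rw [Finset.prod_mul_distrib, ← Real.exp_sum, ← Real.exp_nat_mul, mul_left_comm,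
            ← Real.exp_add]
          change _ ≤ iid n q ω * _
          split_ifs with h
          · refine le_mul_of_one_le_right hnn (Real.one_le_exp ?_)
            rw [← Finset.mul_sum]
            have : ∑ i, g (ω i) = ∑ i, f (ω i) - n * μ := by
              simp [hg]
            rw [this]
            nlinarith
          · exact mul_nonneg hnn (Real.exp_pos _).le
      _ = Real.exp (-(s * δ)) ^ n * (∑ v, q v * Real.exp (s * g v)) ^ n := by
          rw [← Finset.mul_sum]
          congr 1
          rw [← Fintype.prod_sum fun (_ : Fin n) v => q v * Real.exp (s * g v)]
          simp
      _ ≤ Real.exp (-(s * δ)) ^ n * Real.exp (s * (δ / 2)) ^ n := by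
          refine mul_le_mul_of_nonneg_left ?_ (by positivity)
          exact pow_le_pow_left₀ (Finset.sum_nonneg fun v _ =>
            mul_nonneg (hq.1 v) (Real.exp_pos _).le) hmgf n
      _ = _ := by
          rw [← mul_pow, ← Real.exp_add]
          congr 2
          ring
  have hlim := tendsto_pow_atTop_nhds_zero_of_lt_one (Real.exp_pos (-(s * (δ / 2)))).le
    (Real.exp_lt_one_iff.2 (by linarith [mul_pos hs0 (half_pos hδ)]))
  filter_upwards [hlim.eventually_le_const hθ] with n hn
  exact (hbound n).trans hn

/-- No word of the codebook covers `x`. -/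
def Uncovered (G : υ → α → Prop) {N : ℕ} (code : Fin N → υ) (x : α) : Prop := ∀ m, ¬ G (code m) x

open Classical in
/-- Greedy covering. If a random `u` covers on average a fraction `c` of what any set of points
weighs in excess of `θ`, then `N` suitable `u`s leave at most `θ + (1 - c) ^ N` uncovered. -/
lemma exists_greedy_cover [Fintype α] [Fintype υ] {a : υ → ℝ} (ha : a ∈ stdSimplex ℝ υ) {w : α → ℝ}
    (hw1 : ∑ x, w x ≤ 1) (G : υ → α → Prop) {c θ : ℝ} (hc1 : c ≤ 1) (hθ : 0 ≤ θ)
    (h : ∀ R : α → Prop, c * ((∑ x, if R x then w x else 0) - θ)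
      ≤ ∑ u, a u * ∑ x, if R x ∧ G u x then w x else 0) (N : ℕ) :
    ∃ code : Fin N → υ, (∑ x, if Uncovered G code x then w x else 0) ≤ θ + (1 - c) ^ N := by
  induction N with
  | zero =>
    refine ⟨Fin.elim0, ?_⟩
    simp only [Uncovered, IsEmpty.forall_iff, if_true, pow_zero]
    linarith
  | succ N ih =>
    obtain ⟨code, hcode⟩ := ih
    set R : α → Prop := Uncovered G code with hR
    obtain ⟨u, hu⟩ : ∃ u, c * ((∑ x, if R x then w x else 0) - θ)
        ≤ ∑ x, if R x ∧ G u x then w x else 0 := by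
      by_contra! hlt
      have h1 : ∑ u, a u * ∑ x, (if R x ∧ G u x then w x else 0)
          < ∑ u, a u * (c * ((∑ x, if R x then w x else 0) - θ)) := by
        refine Finset.sum_lt_sum (fun u _ => mul_le_mul_of_nonneg_left (hlt u).le (ha.1 u)) ?_
        obtain ⟨u, -, hu⟩ : ∃ u ∈ Finset.univ, 0 < a u :=
          Finset.exists_lt_of_sum_lt (by simp [ha.2])
        exact ⟨u, Finset.mem_univ u, mul_lt_mul_of_pos_left (hlt u) hu⟩
      rw [← Finset.sum_mul, ha.2, one_mul] at h1
      exact absurd (h R) (not_le.2 h1)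
    refine ⟨Fin.cons u code, ?_⟩
    have h2 : (∑ x, if Uncovered G (Fin.cons u code : Fin (N + 1) → υ) x then w x else 0)
        = (∑ x, if R x then w x else 0) - ∑ x, if R x ∧ G u x then w x else 0 := by
      rw [← Finset.sum_sub_distrib]
      refine Finset.sum_congr rfl fun x _ => ?_
      have h3 : Uncovered G (Fin.cons u code : Fin (N + 1) → υ) x ↔ ¬ G u x ∧ R x := by
        simp only [Uncovered, Fin.forall_fin_succ, Fin.cons_zero, Fin.cons_succ, hR]
      simp only [h3]
      by_cases h4 : R x <;> by_cases h5 : G u x <;> simp [h4, h5]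
    rw [h2, pow_succ]
    have h5 := mul_le_mul_of_nonneg_right hcode (sub_nonneg.2 hc1)
    nlinarith

open Classical in
/-- One-shot covering for a Markov chain `U - A - B`. The encoder maps `A` to the index of a
codeword `u` that is good for it, and the test on `B` accepts if the information density of `u` and
`B` is at least `E`. A good codeword has information density at most `D` with `A`, and the test
accepts with conditional probability at least `1 - ε` given `A`; this replaces joint typicality. -/
lemma exists_one_shot_code [Fintype α] [Fintype β] [Fintype υ] {q : Ω → ℝ}
    (hq : q ∈ stdSimplex ℝ Ω) {U : Ω → υ} {A : Ω → α} {B : Ω → β} (hM : IsMarkov q U A B)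
    {D E θ₁ θ₂ ε : ℝ} (hD : 0 ≤ D) (hε : 0 < ε)
    (h1 : (∑ ω, if Real.exp D * (law q U (U ω) * law q A (A ω))
      < law q (fun ω => (U ω, A ω)) (U ω, A ω) then q ω else 0) ≤ θ₁)
    (h2 : (∑ ω, if law q (fun ω => (U ω, B ω)) (U ω, B ω)
      < Real.exp E * (law q U (U ω) * law q B (B ω)) then q ω else 0) ≤ θ₂)
    {N : ℕ} (hN : 0 < N) :
    ∃ (enc : α → Fin N) (acc : Fin N → β → Prop),
      (∑ a, ∑ b, if acc (enc a) b then 0 else law q (fun ω => (A ω, B ω)) (a, b))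
        ≤ θ₁ + θ₂ / ε + (1 - Real.exp (-D)) ^ N + ε ∧
      ∀ m, (∑ b, if acc m b then law q B b else 0) ≤ Real.exp (-E) := by
  set acc' : υ → β → Prop := fun u b => law q B b * Real.exp E ≤ condLaw q U B u b with hacc
  set J : υ → α → ℝ := fun u a => law q (fun ω => (U ω, A ω)) (u, a) with hJ
  have hJ0 : ∀ u a, 0 ≤ J u a := fun u a => law_nonneg hq.1 _ _
  have hA0 : ∀ a, 0 ≤ law q A a := law_nonneg hq.1 A
  have hAB0 : ∀ a b, 0 ≤ law q (fun ω => (A ω, B ω)) (a, b) := fun a b => law_nonneg hq.1 _ _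
  have hUAB0 : ∀ u a b, 0 ≤ law q (fun ω => (U ω, A ω, B ω)) (u, a, b) :=
    fun u a b => law_nonneg hq.1 _ _
  set G : υ → α → Prop := fun u a => J u a ≤ Real.exp D * (law q U u * law q A a) ∧
    (∑ b, if acc' u b then 0 else law q (fun ω => (A ω, B ω)) (a, b)) ≤ ε * law q A a with hG
  have hθ₁ : 0 ≤ θ₁ := le_trans (Finset.sum_nonneg fun ω _ => by split_ifs <;> simp [hq.1 ω]) h1
  have hθ₂ : 0 ≤ θ₂ := le_trans (Finset.sum_nonneg fun ω _ => by split_ifs <;> simp [hq.1 ω]) h2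
  have hbad1 : (∑ u, ∑ a, if J u a ≤ Real.exp D * (law q U u * law q A a) then 0 else J u a)
      ≤ θ₁ := by
    have e := sum_law_mul q (fun ω => (U ω, A ω))
      (fun x => if J x.1 x.2 ≤ Real.exp D * (law q U x.1 * law q A x.2) then 0 else 1)
    simp only [Fintype.sum_prod_type, mul_ite, mul_zero, mul_one] at e
    refine e.trans_le (le_trans (Finset.sum_le_sum fun ω _ => ?_) h1)
    split_ifs with h3 h4 h4
    · exact absurd h4 (not_lt.2 h3)
    · exact le_rfl
    · exact le_rfl
    · exact absurd (not_lt.1 h4) h3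
  have hbad2 : (∑ u, ∑ a, if (∑ b, if acc' u b then 0 else
      law q (fun ω => (A ω, B ω)) (a, b)) ≤ ε * law q A a then 0 else J u a) ≤ θ₂ / ε := by
    have e := sum_law_mul q (fun ω => (U ω, A ω, B ω)) (fun x => if acc' x.1 x.2.2 then 0 else 1)
    simp only [Fintype.sum_prod_type, mul_ite, mul_zero, mul_one] at e
    have hle : (∑ ω, if acc' (U ω) (B ω) then 0 else q ω) ≤ θ₂ := by
      refine le_trans (Finset.sum_le_sum fun ω _ => ?_) h2
      by_cases h3 : acc' (U ω) (B ω)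
      · simp only [h3, if_true]
        split_ifs <;> simp [hq.1 ω]
      · simp only [h3, if_false]
        rcases (hq.1 ω).eq_or_lt with h0 | h0
        · simp [← h0]
        · have hUp : 0 < law q U (U ω) := h0.trans_le (le_law hq.1 U ω)
          rw [if_pos]
          have h4 := not_le.1 h3
          rw [condLaw, div_lt_iff₀ hUp] at h4
          linarith
    rw [le_div_iff₀ hε]
    refine le_trans ?_ (e.trans_le hle)
    rw [Finset.sum_mul]
    refine Finset.sum_le_sum fun u _ => ?_
    rw [Finset.sum_mul]
    refine Finset.sum_le_sum fun a _ => ?_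
    have hnn : 0 ≤ ∑ b, if acc' u b then 0 else law q (fun ω => (U ω, A ω, B ω)) (u, a, b) :=
      Finset.sum_nonneg fun b _ => by split_ifs <;> simp [hUAB0]
    split_ifs with h3
    · simpa using hnn
    · rcases (hA0 a).eq_or_lt with h0 | h0
      · have : J u a ≤ law q A a := law_le_law hq.1 fun ω h => (Prod.mk.inj h).2
        have : J u a = 0 := le_antisymm (this.trans h0.symm.le) (hJ0 u a)
        rw [this, zero_mul]; exact hnn
      · refine le_of_mul_le_mul_right ?_ h0
        calc J u a * ε * law q A a = J u a * (ε * law q A a) := by ring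
          _ ≤ J u a * ∑ b, (if acc' u b then 0 else law q (fun ω => (A ω, B ω)) (a, b)) :=
              mul_le_mul_of_nonneg_left (not_le.1 h3).le (hJ0 u a)
          _ = _ := by
              rw [Finset.mul_sum, Finset.sum_mul]
              refine Finset.sum_congr rfl fun b _ => ?_
              split_ifs
              · simp
              · exact (hM u a b).symm
  have hbad : (∑ u, ∑ a, if G u a then 0 else J u a) ≤ θ₁ + θ₂ / ε := by
    refine le_trans ?_ (add_le_add hbad1 hbad2)
    rw [← Finset.sum_add_distrib]
    refine Finset.sum_le_sum fun u _ => ?_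
    rw [← Finset.sum_add_distrib]
    refine Finset.sum_le_sum fun a _ => ?_
    have := hJ0 u a
    simp only [hG]
    split_ifs <;> first | tauto | linarith
  obtain ⟨code, hcode⟩ := exists_greedy_cover (law_mem_stdSimplex hq U)
    (law_mem_stdSimplex hq A).2.le G (c := Real.exp (-D)) (θ := θ₁ + θ₂ / ε)
    (by simpa using hD) (by positivity) (by
      intro R
      calc Real.exp (-D) * ((∑ a, if R a then law q A a else 0) - (θ₁ + θ₂ / ε))
          ≤ Real.exp (-D) * ((∑ a, if R a then law q A a else 0)
            - ∑ u, ∑ a, if G u a then 0 else J u a) :=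
            mul_le_mul_of_nonneg_left (by linarith) (Real.exp_pos _).le
        _ ≤ Real.exp (-D) * ∑ u, ∑ a, if R a ∧ G u a then J u a else 0 := by
            refine mul_le_mul_of_nonneg_left ?_ (Real.exp_pos _).le
            have e : (∑ a, if R a then law q A a else 0) = ∑ u, ∑ a, if R a then J u a else 0 := by
              rw [Finset.sum_comm]
              refine Finset.sum_congr rfl fun a _ => ?_
              rw [← sum_law_pair' q U A a]
              split_ifs <;> simp [hJ]
            rw [e, sub_le_iff_le_add, ← Finset.sum_add_distrib]
            refine Finset.sum_le_sum fun u _ => ?_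
            rw [← Finset.sum_add_distrib]
            refine Finset.sum_le_sum fun a _ => ?_
            have := hJ0 u a
            by_cases h3 : R a <;> by_cases h4 : G u a <;> simp [h3, h4, this]
        _ ≤ _ := by
            rw [Finset.mul_sum]
            refine Finset.sum_le_sum fun u _ => ?_
            rw [Finset.mul_sum, Finset.mul_sum]
            refine Finset.sum_le_sum fun a _ => ?_
            split_ifs with h3
            · calc Real.exp (-D) * J u a
                  ≤ Real.exp (-D) * (Real.exp D * (law q U u * law q A a)) :=
                    mul_le_mul_of_nonneg_left h3.2.1 (Real.exp_pos _).le
                _ = _ := by rw [← mul_assoc, ← Real.exp_add]; simp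
            · simp) N
  have : Nonempty (Fin N) := ⟨⟨0, hN⟩⟩
  set enc : α → Fin N := fun a => if h : ∃ m, G (code m) a then h.choose else ⟨0, hN⟩ with henc
  refine ⟨enc, fun m b => acc' (code m) b, ?_, fun m => ?_⟩
  · have h3 : ∀ a, (∑ b, if acc' (code (enc a)) b then 0 else law q (fun ω => (A ω, B ω)) (a, b))
        ≤ (if Uncovered G code a then law q A a else 0) + ε * law q A a := by
      intro a
      have hnn : 0 ≤ ε * law q A a := mul_nonneg hε.le (hA0 a)
      by_cases h4 : ∃ m, G (code m) a
      · have h5 : G (code (enc a)) a := by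
          simp only [henc, h4, dif_pos]
          exact h4.choose_spec
        rw [if_neg (by simpa [Uncovered] using h4), zero_add]
        exact h5.2
      · rw [if_pos (by simpa [Uncovered] using h4)]
        refine le_trans ?_ (le_add_of_nonneg_right hnn)
        rw [← sum_law_pair q A B a]
        refine Finset.sum_le_sum fun b _ => ?_
        split_ifs <;> simp [hAB0]
    refine (Finset.sum_le_sum fun a _ => h3 a).trans ?_
    rw [Finset.sum_add_distrib, ← Finset.mul_sum, sum_law, hq.2, mul_one]
    linarith
  · calc (∑ b, if acc' (code m) b then law q B b else 0)
        ≤ ∑ b, Real.exp (-E) * condLaw q U B (code m) b := by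
          refine Finset.sum_le_sum fun b _ => ?_
          split_ifs with h3
          · calc law q B b = Real.exp (-E) * (law q B b * Real.exp E) := by
                  rw [mul_left_comm, ← Real.exp_add]; simp
              _ ≤ _ := mul_le_mul_of_nonneg_left h3 (Real.exp_pos _).le
          · exact mul_nonneg (Real.exp_pos _).le (condLaw_nonneg hq.1 _ _ _ _)
      _ ≤ Real.exp (-E) := by
          rw [← Finset.mul_sum]
          exact mul_le_of_le_one_right (Real.exp_pos _).le (sum_condLaw_le _ _ _)

end Covering

/-! ### Coding one hop -/

section Hop

variable {Ω α β υ : Type*} [Fintype Ω] {n : ℕ}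

/-- The information density of `A` and `B`. -/
noncomputable def infoDensity (p : Ω → ℝ) (A : Ω → α) (B : Ω → β) (ω : Ω) : ℝ :=
  Real.log (law p (fun ω => (A ω, B ω)) (A ω, B ω) / (law p A (A ω) * law p B (B ω)))

lemma mutualInfo_eq_sum [Fintype α] [Fintype β] (p : Ω → ℝ) (A : Ω → α) (B : Ω → β) :
    mutualInfo p A B = ∑ ω, p ω * infoDensity p A B ω := by
  have := sum_law_mul p (fun ω => (A ω, B ω)) (fun ab =>
      Real.log (law p (fun ω => (A ω, B ω)) (ab.1, ab.2) / (law p A ab.1 * law p B ab.2)))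
  rw [Fintype.sum_prod_type] at this
  exact this

lemma law_iid_pair (p : Ω → ℝ) (A : Ω → α) (B : Ω → β) (a : Fin n → α) (b : Fin n → β) :
    law (iid n p) (fun ω => ((fun i => A (ω i)), fun i => B (ω i))) (a, b)
      = iid n (law p fun ω => (A ω, B ω)) (fun i => (a i, b i)) := by
  rw [← law_iid]
  exact law_congr fun ω => by simp only [Prod.mk.injEq, funext_iff, forall_and]

lemma law_iid_triple (p : Ω → ℝ) (U : Ω → υ) (A : Ω → α) (B : Ω → β) (u : Fin n → υ) (a : Fin n → α)
    (b : Fin n → β) :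
    law (iid n p) (fun ω => ((fun i => U (ω i)), (fun i => A (ω i)), fun i => B (ω i))) (u, a, b)
      = iid n (law p fun ω => (U ω, A ω, B ω)) (fun i => (u i, a i, b i)) := by
  rw [← law_iid]
  exact law_congr fun ω => by simp only [Prod.mk.injEq, funext_iff, forall_and]

lemma IsMarkov.iid {p : Ω → ℝ} {U : Ω → υ} {A : Ω → α} {B : Ω → β} (h : IsMarkov p U A B) :
    IsMarkov (iid n p) (fun ω i => U (ω i)) (fun ω i => A (ω i)) (fun ω i => B (ω i)) := by
  intro u a b
  rw [law_iid_triple, law_iid_pair, law_iid_pair, law_iid]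
  simp only [TwoHop.iid, ← Finset.prod_mul_distrib]
  exact Finset.prod_congr rfl fun i _ => h _ _ _

/-- The block information density is the sum of the information densities of the letters. -/
lemma law_iid_pair_eq_exp {p : Ω → ℝ} (hp : ∀ ω, 0 ≤ p ω) (A : Ω → α) (B : Ω → β)
    {ω : Fin n → Ω} (hω : 0 < iid n p ω) :
    law (iid n p) (fun ω => ((fun i => A (ω i)), fun i => B (ω i)))
        ((fun i => A (ω i)), fun i => B (ω i))
      = Real.exp (∑ i, infoDensity p A B (ω i)) *
        (law (iid n p) (fun ω i => A (ω i)) (fun i => A (ω i))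
          * law (iid n p) (fun ω i => B (ω i)) (fun i => B (ω i))) := by
  rw [law_iid_pair, law_iid, law_iid, Real.exp_sum]
  simp only [iid, ← Finset.prod_mul_distrib]
  refine Finset.prod_congr rfl fun i _ => ?_
  have h0 := (iid_pos_iff hp).1 hω i
  have hA := h0.trans_le (le_law hp A (ω i))
  have hB := h0.trans_le (le_law hp B (ω i))
  have hAB := h0.trans_le (le_law hp (fun ω => (A ω, B ω)) (ω i))
  rw [infoDensity, Real.exp_log (by positivity)]
  field_simp

open Classical in
/-- For a Markov chain `U - A - B`, an i.i.d. block of `A` can be described at any rate above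
`I(U;A)` so that dependence with `B` is tested with error exponent close to `I(U;B)`. -/
lemma eventually_exists_hop [Fintype α] [Fintype β] [Fintype υ] {p : Ω → ℝ}
    (hp : p ∈ stdSimplex ℝ Ω) {U : Ω → υ} {A : Ω → α} {B : Ω → β} (hM : IsMarkov p U A B)
    {δ ε : ℝ} (hδ : 0 < δ) (hε : 0 < ε) :
    ∀ᶠ n : ℕ in atTop, ∃ N : ℕ, 0 < N ∧ Real.log N ≤ n * (mutualInfo p U A + δ) ∧
      ∃ (enc : (Fin n → α) → Fin N) (acc : Fin N → (Fin n → β) → Prop),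
        (∑ a, ∑ b, if acc (enc a) b then 0
          else iid n (law p fun ω => (A ω, B ω)) (fun i => (a i, b i))) ≤ ε ∧
        ∀ m, (∑ b, if acc m b then iid n (law p B) b else 0)
          ≤ Real.exp (-(n * (mutualInfo p U B - δ))) := by
  have hI : 0 ≤ mutualInfo p U A := mutualInfo_nonneg hp U A
  have hev1 := eventually_sum_iid_le hp (infoDensity p U A) (half_pos hδ)
    (show 0 < ε / 4 by positivity)
  have hev2 := eventually_sum_iid_le hp (fun ω => -infoDensity p U B ω) hδ
    (show 0 < ε / 4 * (ε / 4) by positivity)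
  rw [← mutualInfo_eq_sum] at hev1
  simp only [mul_neg, Finset.sum_neg_distrib] at hev2
  rw [← mutualInfo_eq_sum] at hev2
  have hexp : Tendsto (fun n : ℕ => Real.exp (-(Real.exp (n * (δ / 2)) - 1))) atTop (𝓝 0) := by
    refine Real.tendsto_exp_neg_atTop_nhds_zero.comp ?_
    refine tendsto_atTop_add_const_right _ _ (Real.tendsto_exp_atTop.comp ?_)
    exact tendsto_natCast_atTop_atTop.atTop_mul_const (half_pos hδ)
  filter_upwards [hev1, hev2, hexp.eventually_le_const (show 0 < ε / 4 by positivity)]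
    with n h1 h2 h3
  have hq : iid n p ∈ stdSimplex ℝ (Fin n → Ω) := iid_mem_stdSimplex hp
  set R := (n : ℝ) * (mutualInfo p U A + δ) with hR
  have hR0 : 0 ≤ R := by positivity
  set N := ⌊Real.exp R⌋₊ with hN
  have hN0 : 0 < N := Nat.floor_pos.2 (Real.one_le_exp hR0)
  set D := (n : ℝ) * (mutualInfo p U A + δ / 2) with hD
  have hD0 : 0 ≤ D := by positivity
  obtain ⟨enc, acc, hi, hii⟩ := exists_one_shot_code hq (hM.iid (n := n)) (D := D)
    (E := n * (mutualInfo p U B - δ)) (θ₁ := ε / 4) (θ₂ := ε / 4 * (ε / 4)) (ε := ε / 4) hD0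
    (by positivity) (by
      refine le_trans (Finset.sum_le_sum fun ω _ => ?_) h1
      rcases (hq.1 ω).eq_or_lt with h0 | h0
      · simp [← h0]
      · split_ifs with h4 h5 h5
        · exact le_rfl
        · rw [law_iid_pair_eq_exp hp.1 U A h0] at h4
          have h6 := Real.exp_lt_exp.1 (lt_of_mul_lt_mul_right h4
            (mul_nonneg (law_nonneg hq.1 _ _) (law_nonneg hq.1 _ _)))
          exact absurd h6.le h5
        · exact h0.le
        · exact le_rfl) (by
      refine le_trans (Finset.sum_le_sum fun ω _ => ?_) h2
      rcases (hq.1 ω).eq_or_lt with h0 | h0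
      · simp [← h0]
      · split_ifs with h4 h5 h5
        · exact le_rfl
        · rw [law_iid_pair_eq_exp hp.1 U B h0] at h4
          have h6 := Real.exp_lt_exp.1 (lt_of_mul_lt_mul_right h4
            (mul_nonneg (law_nonneg hq.1 _ _) (law_nonneg hq.1 _ _)))
          exact absurd (by linarith) h5
        · exact h0.le
        · exact le_rfl) hN0
  refine ⟨N, hN0, ?_, enc, acc, ?_, ?_⟩
  · rw [Real.log_le_iff_le_exp (by exact_mod_cast hN0)]
    exact Nat.floor_le (Real.exp_pos _).le
  · simp only [law_iid_pair] at hi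
    have h4 : (1 - Real.exp (-D)) ^ N ≤ ε / 4 := by
      refine le_trans ?_ h3
      have h5 : 1 - Real.exp (-D) ≤ Real.exp (-Real.exp (-D)) := by
        linarith [Real.add_one_le_exp (-Real.exp (-D))]
      have h6 : 0 ≤ 1 - Real.exp (-D) := by simpa using hD0
      refine (pow_le_pow_left₀ h6 h5 N).trans ?_
      rw [← Real.exp_nat_mul]
      refine Real.exp_le_exp.2 ?_
      have h7 : Real.exp R - 1 ≤ N := by linarith [Nat.lt_floor_add_one (Real.exp R)]
      have h8 : Real.exp R * Real.exp (-D) = Real.exp (n * (δ / 2)) := by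
        rw [← Real.exp_add]; congr 1; rw [hR, hD]; ring
      have h9 : Real.exp (-D) ≤ 1 := by simpa using hD0
      have := mul_le_mul_of_nonneg_right h7 (Real.exp_pos (-D)).le
      nlinarith
    refine hi.trans ?_
    have h5 : ε / 4 * (ε / 4) / (ε / 4) = ε / 4 := by field_simp
    rw [h5]
    linarith
  · simpa only [law_iid] using hii

end Hop

/-! ### Achievability -/

section Achievability

variable {X Y Z : Type*} [Fintype X] [Fintype Y] [Fintype Z] {P : X × Y × Z → ℝ} {k l : ℕ}
  {Q : X × Y × Z × Fin k × Fin l → ℝ}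

open Classical in
/-- The relay forwards a description of its source if its own test accepts, and an error symbol
otherwise. The receiver rejects on the error symbol, so that under `H1` both tests have to fail for
it to err. -/
lemma exists_code_of_hops (hP : P ∈ stdSimplex ℝ (X × Y × Z)) {n N₁ N₂ : ℕ}
    (enc₁ : (Fin n → X) → Fin N₁) (acc₁ : Fin N₁ → (Fin n → Y) → Prop)
    (enc₂ : (Fin n → Y) → Fin N₂) (acc₂ : Fin N₂ → (Fin n → Z) → Prop) {ε A₁ A₂ : ℝ} (hA₂ : 0 ≤ A₂)
    (h₁ : (∑ x, ∑ y, if acc₁ (enc₁ x) y then 0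
      else iid n (law P fun ω => (ω.1, ω.2.1)) (fun i => (x i, y i))) ≤ ε)
    (h₂ : (∑ y, ∑ z, if acc₂ (enc₂ y) z then 0
      else iid n (law P fun ω => (ω.2.1, ω.2.2)) (fun i => (y i, z i))) ≤ ε)
    (hA₁ : ∀ m, (∑ y, if acc₁ m y then iid n (law P fun ω => ω.2.1) y else 0) ≤ A₁)
    (hA₂' : ∀ m, (∑ z, if acc₂ m z then iid n (law P fun ω => ω.2.2) z else 0) ≤ A₂) :
    ∃ C : Code X Y Z n N₁ (N₂ + 1), C.beta1 P ≤ ε ∧ C.eta1 P ≤ ε + ε ∧ C.beta2 P ≤ A₁ ∧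
      C.eta2 P ≤ A₁ * A₂ := by
  set C : Code X Y Z n N₁ (N₂ + 1) :=
    { f₁ := enc₁
      f₂ := fun m y => if acc₁ m y then (enc₂ y).succ else 0
      g₁ := fun m y => if acc₁ m y then Hyp.H0 else Hyp.H1
      g₂ := fun m z => Fin.cases Hyp.H1 (fun m => if acc₂ m z then Hyp.H0 else Hyp.H1) m } with hC
  have hg₁ : ∀ m y, C.g₁ m y = Hyp.H0 ↔ acc₁ m y := by
    intro m y
    simp only [hC]
    split_ifs with h <;> simp [h]
  have hg₂ : ∀ m y z, C.g₂ (C.f₂ m y) z = Hyp.H0 ↔ acc₁ m y ∧ acc₂ (enc₂ y) z := by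
    intro m y z
    simp only [hC]
    by_cases h1 : acc₁ m y
    · by_cases h2 : acc₂ (enc₂ y) z <;> simp [h1, h2]
    · simp [h1]
  have hf₁ : ∀ x, C.f₁ x = enc₁ x := fun x => rfl
  have hq : iid n P ∈ stdSimplex ℝ (Fin n → X × Y × Z) := iid_mem_stdSimplex hP
  have hX : iid n (law P fun ω => ω.1) ∈ stdSimplex ℝ _ :=
    iid_mem_stdSimplex (law_mem_stdSimplex hP _)
  have hY : iid n (law P fun ω => ω.2.1) ∈ stdSimplex ℝ _ :=
    iid_mem_stdSimplex (law_mem_stdSimplex hP _)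
  have e₁ : (∑ ω, if acc₁ (enc₁ fun i => (ω i).1) (fun i => (ω i).2.1) then 0 else iid n P ω)
      ≤ ε := by
    have := sum_law_mul (iid n P) (fun ω => ((fun i => (ω i).1), fun i => (ω i).2.1))
      (fun x => if acc₁ (enc₁ x.1) x.2 then 0 else 1)
    simp only [Fintype.sum_prod_type, mul_ite, mul_zero, mul_one] at this
    rw [← this]
    simpa only [law_iid_pair P (fun ω => ω.1) (fun ω => ω.2.1)] using h₁
  have e₂ : (∑ ω, if acc₂ (enc₂ fun i => (ω i).2.1) (fun i => (ω i).2.2) then 0 else iid n P ω)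
      ≤ ε := by
    have := sum_law_mul (iid n P) (fun ω => ((fun i => (ω i).2.1), fun i => (ω i).2.2))
      (fun x => if acc₂ (enc₂ x.1) x.2 then 0 else 1)
    simp only [Fintype.sum_prod_type, mul_ite, mul_zero, mul_one] at this
    rw [← this]
    simpa only [law_iid_pair P (fun ω => ω.2.1) (fun ω => ω.2.2)] using h₂
  refine ⟨C, ?_, ?_, ?_, ?_⟩
  · rw [C.beta1_eq]
    simpa only [hg₁] using e₁
  · rw [C.eta1_eq]
    refine le_trans ?_ (add_le_add e₁ e₂)
    rw [← Finset.sum_add_distrib]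
    refine Finset.sum_le_sum fun ω _ => ?_
    have := hq.1 ω
    simp only [hg₂, hf₁]
    split_ifs <;> first | tauto | linarith
  · rw [C.beta2_eq hP]
    simp only [hg₁, hf₁]
    calc (∑ x, ∑ y, if acc₁ (enc₁ x) y then
          iid n (law P fun ω => ω.1) x * iid n (law P fun ω => ω.2.1) y else 0)
        = ∑ x, iid n (law P fun ω => ω.1) x *
          ∑ y, if acc₁ (enc₁ x) y then iid n (law P fun ω => ω.2.1) y else 0 := by
          simp only [Finset.mul_sum, mul_ite, mul_zero]
      _ ≤ ∑ x, iid n (law P fun ω => ω.1) x * A₁ :=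
          Finset.sum_le_sum fun x _ => mul_le_mul_of_nonneg_left (hA₁ _) (hX.1 x)
      _ = A₁ := by rw [← Finset.sum_mul, hX.2, one_mul]
  · rw [C.eta2_eq]
    simp only [hg₂, hf₁]
    calc (∑ x, ∑ y, ∑ z, if acc₁ (enc₁ x) y ∧ acc₂ (enc₂ y) z then
          iid n (law P fun ω => ω.1) x * iid n (law P fun ω => ω.2.1) y
            * iid n (law P fun ω => ω.2.2) z else 0)
        = ∑ x, iid n (law P fun ω => ω.1) x *
          ∑ y, (if acc₁ (enc₁ x) y then iid n (law P fun ω => ω.2.1) y else 0) *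
            ∑ z, if acc₂ (enc₂ y) z then iid n (law P fun ω => ω.2.2) z else 0 := by
          simp only [Finset.mul_sum]
          refine Finset.sum_congr rfl fun x _ => Finset.sum_congr rfl fun y _ =>
            Finset.sum_congr rfl fun z _ => ?_
          by_cases h1 : acc₁ (enc₁ x) y <;> by_cases h2 : acc₂ (enc₂ y) z <;>
            simp [h1, h2, mul_assoc]
      _ ≤ ∑ x, iid n (law P fun ω => ω.1) x * (A₁ * A₂) := by
          refine Finset.sum_le_sum fun x _ => mul_le_mul_of_nonneg_left ?_ (hX.1 x)
          calc _ ≤ ∑ y, (if acc₁ (enc₁ x) y then iid n (law P fun ω => ω.2.1) y else 0) * A₂ := by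
                refine Finset.sum_le_sum fun y _ => mul_le_mul_of_nonneg_left (hA₂' _) ?_
                split_ifs
                · exact hY.1 y
                · exact le_rfl
            _ ≤ A₁ * A₂ := by
                rw [← Finset.sum_mul]
                exact mul_le_mul_of_nonneg_right (hA₁ _) hA₂
      _ = A₁ * A₂ := by rw [← Finset.sum_mul, hX.2, one_mul]

/-- For every test distribution, codes with vanishing loss in rates and exponents exist at all large
block lengths. -/
lemma IsTest.eventually_exists_code (hP : P ∈ stdSimplex ℝ (X × Y × Z)) (hQ : IsTest P Q)
    {δ ε : ℝ} (hδ : 0 < δ) (hε : 0 < ε) :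
    ∀ᶠ n : ℕ in atTop, ∃ (N₁ N₂ : ℕ) (C : Code X Y Z n N₁ N₂),
      Real.log N₁ ≤ n * (infoUX Q + δ) ∧ Real.log N₂ ≤ n * (infoVY Q + δ) ∧
      C.beta1 P ≤ ε ∧ C.eta1 P ≤ ε ∧
      C.beta2 P ≤ Real.exp (-(n * (infoUY Q - δ))) ∧
      C.eta2 P ≤ Real.exp (-(n * (infoUY Q + infoVZ Q - δ))) := by
  have hev1 := eventually_exists_hop hQ.mem_simplex hQ.markov_UXY (half_pos hδ) (half_pos hε)
  have hev2 := eventually_exists_hop hQ.mem_simplex hQ.markov_VYZ (half_pos hδ) (half_pos hε)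
  have hlog : ∀ᶠ n : ℕ in atTop, Real.log 2 ≤ n * (δ / 2) :=
    (tendsto_natCast_atTop_atTop.atTop_mul_const (half_pos hδ)).eventually_ge_atTop _
  have lXY : law Q (fun w => (w.1, w.2.1)) = law P fun ω => (ω.1, ω.2.1) :=
    funext (hQ.law_source fun ω => (ω.1, ω.2.1))
  have lYZ : law Q (fun w => (w.2.1, w.2.2.1)) = law P fun ω => (ω.2.1, ω.2.2) :=
    funext (hQ.law_source fun ω => (ω.2.1, ω.2.2))
  have lY : law Q (fun w => w.2.1) = law P fun ω => ω.2.1 := funext (hQ.law_source fun ω => ω.2.1)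
  have lZ : law Q (fun w => w.2.2.1) = law P fun ω => ω.2.2 :=
    funext (hQ.law_source fun ω => ω.2.2)
  rw [lXY, lY] at hev1
  rw [lYZ, lZ] at hev2
  filter_upwards [hev1, hev2, hlog] with n h1 h2 h3
  obtain ⟨N₁, hN₁, hR₁, enc₁, acc₁, hi₁, hii₁⟩ := h1
  obtain ⟨N₂, hN₂, hR₂, enc₂, acc₂, hi₂, hii₂⟩ := h2
  have hnδ : 0 ≤ (n : ℝ) * (δ / 2) := by positivity
  obtain ⟨C, hβ₁, hη₁, hβ₂, hη₂⟩ := exists_code_of_hops hP enc₁ acc₁ enc₂ acc₂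
    (Real.exp_pos _).le hi₁ hi₂ hii₁ hii₂
  refine ⟨N₁, N₂ + 1, C, ?_, ?_, by linarith, by linarith, ?_, ?_⟩
  · refine hR₁.trans ?_
    rw [infoUX]
    linarith
  · have hN₂' : (1 : ℝ) ≤ N₂ := by exact_mod_cast hN₂
    have h4 : Real.log ((N₂ + 1 : ℕ) : ℝ) ≤ Real.log 2 + Real.log N₂ := by
      rw [← Real.log_mul (by norm_num) (by linarith)]
      refine Real.log_le_log (by positivity) ?_
      push_cast
      linarith
    rw [infoVY]
    linarith
  · refine hβ₂.trans (Real.exp_le_exp.2 ?_)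
    rw [infoUY]
    linarith
  · refine hη₂.trans ?_
    rw [← Real.exp_add]
    refine Real.exp_le_exp.2 ?_
    rw [infoUY, infoVZ]
    linarith

/-- The converse is used here to know that the type-II error probabilities do not vanish, since
`Real.log 0 = 0` would spoil the exponents. -/
lemma IsTest.isAchievable (hP : IsSource P) {ε₁ ε₂ : ℝ} (hε₁ : 0 < ε₁) (hε₂ : 0 < ε₂)
    (hε : ε₁ + ε₂ < 1) (hQ : IsTest P Q) {δ : ℝ} (hδ : 0 < δ) {T : ℝ × ℝ × ℝ × ℝ}
    (h1 : infoUX Q + δ ≤ T.1) (h2 : infoVY Q + δ ≤ T.2.1) (h3 : T.2.2.1 ≤ infoUY Q - δ)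
    (h4 : T.2.2.2 ≤ infoUY Q + infoVZ Q - δ) : IsAchievable P ε₁ ε₂ T := by
  set good : (n N₁ N₂ : ℕ) → Code X Y Z n N₁ N₂ → Prop := fun n N₁ N₂ C =>
    Real.log N₁ ≤ n * (infoUX Q + δ) ∧ Real.log N₂ ≤ n * (infoVY Q + δ) ∧
      C.beta1 P ≤ min ε₁ ε₂ ∧ C.eta1 P ≤ min ε₁ ε₂ ∧
      C.beta2 P ≤ Real.exp (-(n * (infoUY Q - δ))) ∧
      C.eta2 P ≤ Real.exp (-(n * (infoUY Q + infoVZ Q - δ))) with hgood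
  have hev : ∀ᶠ n : ℕ in atTop, ∃ (N₁ N₂ : ℕ) (C : Code X Y Z n N₁ N₂), good n N₁ N₂ C :=
    hQ.eventually_exists_code hP.mem_simplex hδ (lt_min hε₁ hε₂)
  have hall : ∀ n : ℕ, ∃ (N₁ N₂ : ℕ) (C : Code X Y Z n N₁ N₂),
      (∃ (N₁ N₂ : ℕ) (C : Code X Y Z n N₁ N₂), good n N₁ N₂ C) → good n N₁ N₂ C := by
    intro n
    by_cases h : ∃ (N₁ N₂ : ℕ) (C : Code X Y Z n N₁ N₂), good n N₁ N₂ C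
    · obtain ⟨N₁, N₂, C, hC⟩ := h
      exact ⟨N₁, N₂, C, fun _ => hC⟩
    · exact ⟨1, 1, ⟨fun _ => 0, fun _ _ => 0, fun _ _ => Hyp.H0, fun _ _ => Hyp.H0⟩,
        fun h' => absurd h' h⟩
  choose N₁ N₂ C hC using hall
  obtain ⟨K, -, hK⟩ := Code.exists_isTest hP (δ := 1 - ε₁ - ε₂) (by linarith) (by linarith)
  have key : ∀ᶠ n in atTop, 0 < n ∧ good n _ _ (C n) := by
    filter_upwards [hev, eventually_gt_atTop 0] with n h hn using ⟨hn, hC n h⟩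
  have hscale : ∀ {n : ℕ} {a b : ℝ}, 0 < n → a ≤ n * b → 1 / (n : ℝ) * a ≤ b := by
    intro n a b hn h
    have hn' : (0 : ℝ) < n := by exact_mod_cast hn
    rw [one_div, inv_mul_le_iff₀ hn']
    exact h
  have hexpo : ∀ {n : ℕ} {a b : ℝ}, 0 < n → 0 < b → b ≤ Real.exp (-(n * a)) →
      a ≤ -(1 / (n : ℝ)) * Real.log b := by
    intro n a b hn hb h
    have hn' : (0 : ℝ) < n := by exact_mod_cast hn
    have h5 := (Real.log_le_iff_le_exp hb).2 h
    have h6 := hscale (a := Real.log b) (b := -a) hn (by linarith)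
    linarith
  refine ⟨N₁, N₂, C, ?_, ?_, ?_, ?_, ?_, ?_⟩
  · refine limsup_le_of_le (h := ?_)
    filter_upwards [key] with n ⟨hn, h⟩
    exact EReal.coe_le_coe_iff.2 ((hscale hn h.1).trans h1)
  · refine limsup_le_of_le (h := ?_)
    filter_upwards [key] with n ⟨hn, h⟩
    exact EReal.coe_le_coe_iff.2 ((hscale hn h.2.1).trans h2)
  · refine limsup_le_of_le (h := ?_)
    filter_upwards [key] with n ⟨hn, h⟩
    exact EReal.coe_le_coe_iff.2 (h.2.2.1.trans (min_le_left _ _))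
  · refine limsup_le_of_le (h := ?_)
    filter_upwards [key] with n ⟨hn, h⟩
    exact EReal.coe_le_coe_iff.2 (h.2.2.2.1.trans (min_le_right _ _))
  · refine le_liminf_of_le (h := ?_)
    filter_upwards [key] with n ⟨hn, h⟩
    have hβ := (hK n _ _ hn (C n) (by
      linarith [h.2.2.1.trans (min_le_left _ _), h.2.2.2.1.trans (min_le_right _ _)])).1
    exact EReal.coe_le_coe_iff.2 (h3.trans (hexpo hn hβ h.2.2.2.2.1))
  · refine le_liminf_of_le (h := ?_)
    filter_upwards [key] with n ⟨hn, h⟩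
    have hη := (hK n _ _ hn (C n) (by
      linarith [h.2.2.1.trans (min_le_left _ _), h.2.2.2.1.trans (min_le_right _ _)])).2.1
    exact EReal.coe_le_coe_iff.2 (h4.trans (hexpo hn hη h.2.2.2.2.2))

theorem regionStar_subset_region (hP : IsSource P) {ε₁ ε₂ : ℝ} (hε₁ : 0 < ε₁) (hε₂ : 0 < ε₂)
    (hε : ε₁ + ε₂ < 1) : regionStar P ⊆ region P ε₁ ε₂ := by
  rintro T ⟨k, l, Q, hQ, h1, h2, h3, h4⟩
  refine mem_closure_of_tendsto (tendsto_relaxed T) ?_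
  filter_upwards [self_mem_nhdsWithin] with e he
  exact hQ.isAchievable hP hε₁ hε₂ hε he (by dsimp only; linarith) (by dsimp only; linarith)
    (by dsimp only; linarith) (by dsimp only; linarith)

end Achievability

end TwoHop

theorem theorem2 {X Y Z : Type*} [Fintype X] [Fintype Y] [Fintype Z]
    (P : X × Y × Z → ℝ) (hP : TwoHop.IsSource P)
    (ε₁ ε₂ : ℝ) (hε₁ : ε₁ ∈ Set.Ioo (0 : ℝ) 1) (hε₂ : ε₂ ∈ Set.Ioo (0 : ℝ) 1)
    (hε : ε₁ + ε₂ < 1) :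
    (∀ b c d : ℝ, 0 ≤ b → 0 ≤ c → 0 ≤ d →
      ∃ r : ℕ → ℝ,
        r =Θ[atTop] (fun n : ℕ => (n : ℝ) ^ (3 / 4 : ℝ) * Real.log n) ∧
        ∀ (n N₁ N₂ : ℕ), 1 ≤ n → ∀ C : TwoHop.Code X Y Z n N₁ N₂,
          C.beta1 P ≤ ε₁ → C.eta1 P ≤ ε₂ →
            0 < C.beta2 P ∧ 0 < C.eta2 P ∧
            n * TwoHop.minWeightedInfo P b c d + r n ≤
              Real.log (C.beta2 P) + b * Real.log N₁ + c * Real.log (C.eta2 P)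
                + d * Real.log N₂) ∧
    TwoHop.region P ε₁ ε₂ = TwoHop.regionStar P :=
  ⟨fun _ _ _ hb hc hd => TwoHop.exists_remainder hP hε₁.1 hε₂.1 hε hb hc hd,
    (TwoHop.region_subset_regionStar hP hε₁.1 hε₂.1 hε).antisymm
      (TwoHop.regionStar_subset_region hP hε₁.1 hε₂.1 hε)⟩
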